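/- Work over an algebraically closed field $\mathbb{K}$ of characteristic zero, and let $\mathbb{G}_a^n=(\mathbb{K}^n,+)$. An additive action on an $n$-dimensional closed (irreducible) subvariety $X\subseteq\mathbb{P}^m$ is an effective algebraic group action $\mathbb{G}_a^n\times\mathbb{P}^m\to\mathbb{P}^m$ such that $X$ is $\mathbb{G}_a^n$-invariant and the induced action on $X$ has an open orbit $O$. A hyperquadric in a projective space is a hypersurface defined by an irreducible quadratic form. A subset of a projective space is called non-degenerate if it is not contained in any hyperplane (a non-degenerate hyperquadric may be singular). Theorem. Let an additive action of $\mathbb{G}_a^n$ on $X\subseteq\mathbb{P}^m$ with open orbit $O$ be given, where $X$ is either a hyperquadric in $\mathbb{P}^m$ or $X=\mathbb{P}^m$. Let $K(X)$ be the singular locus $\operatorname{Sing}(X)$ if $X$ is a hyperquadric, and the boundary $X\setminus O$ if $X=\mathbb{P}^m$. Suppose that $K(X)\nsubseteq \operatorname{Fix}(X)=\{x\in X : g\cdot x=x \text{ for all } g\in\mathbb{G}_a^n\}$. Choose $x_0\in O$, let $G^{(1)}=\bigcap_{x\in K(X)}G_x$ be the common stabilizer of the points of $K(X)$, let $\mathbf{L}^{(1)}$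 be the linear span of $G^{(1)}\cdot x_0$, and let $Q^{(1)}=\overline{G^{(1)}\cdot x_0}$ be the Zariski closure. Then: (i) $\mathbf{L}^{(1)}\subsetneq\mathbb{P}^m$. (ii) $\mathbf{L}^{(1)}$ is $G^{(1)}$-invariant and contains $Q^{(1)}$; the group $G^{(1)}$ is a vector group, $G^{(1)}\cong\mathbb{G}_a^k$ for some $k$ (it is a linear subspace of $\mathbb{K}^n$), and its action on $\mathbf{L}^{(1)}$ is an additive action on $Q^{(1)}\subseteq\mathbf{L}^{(1)}$ with open orbit $O^{(1)}=G^{(1)}\cdot x_0$ (in particular it is effective on $\mathbf{L}^{(1)}$ and $\dim Q^{(1)}=k$). Moreover, $Q^{(1)}$ is either a non-degenerate hyperquadric in $\mathbf{L}^{(1)}$ or the whole projective space $\mathbf{L}^{(1)}$. -/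

import Mathlib

open scoped LinearAlgebra.Projectivization

namespace AddAct

section

variable {K : Type*} [Field K] {V : Type*} [AddCommGroup V] [Module K V]

/-- The Zariski topology on the projective space `ℙ K V`: it is generated by the sets of points at
which a given homogeneous polynomial (in the linear forms on `V`) does not vanish. -/
instance zariskiTopology : TopologicalSpace (ℙ K V) :=
  TopologicalSpace.generateFrom
    {U | ∃ (d : ℕ) (p : MvPolynomial (Module.Dual K V) K), p.IsHomogeneous d ∧
      U = {x : ℙ K V | MvPolynomial.eval (fun ξ : Module.Dual K V => ξ x.rep) p ≠ 0}}

/-- `f : 𝔸ⁿ × V → K` is a polynomial function, homogeneous of degree `d` in the variable `v ∈ V`. -/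
def IsPolyHomogeneous (n d : ℕ) (f : (Fin n → K) → V → K) : Prop :=
  ∃ p : MvPolynomial (Fin n ⊕ Module.Dual K V) K,
    p.IsWeightedHomogeneous (Sum.elim (fun _ => 0) (fun _ => 1) : _ → ℕ) d ∧
    ∀ t v, f t v = MvPolynomial.eval (Sum.elim t (fun ξ : Module.Dual K V => ξ v)) p

/-- `φ : 𝔸ⁿ × ℙ(V) → ℙ(V)` is a morphism of varieties: around each point `(t₀, x₀)` it has the form
`(t, [v]) ↦ [F(t, v)]` on the open set `F ≠ 0`, where the coordinates of `F` are polynomials,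
homogeneous in `v` of a common degree. -/
def IsMorphism (n : ℕ) (φ : (Fin n → K) → ℙ K V → ℙ K V) : Prop :=
  ∀ (t₀ : Fin n → K) (x₀ : ℙ K V), ∃ (d : ℕ) (F : (Fin n → K) → V → V),
    (∀ ξ : Module.Dual K V, IsPolyHomogeneous n d (fun t v => ξ (F t v))) ∧
    F t₀ x₀.rep ≠ 0 ∧
    ∀ (t : Fin n → K) (v : V) (hv : v ≠ 0) (hF : F t v ≠ 0),
      φ t (Projectivization.mk K v hv) = Projectivization.mk K (F t v) hF

/-- `φ` is an additive action on the closed subvariety `X` of `ℙ(V)`, with open orbit `O`: an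
effective algebraic action of the vector group `𝔾ₐⁿ`, `n = dim X`, on `ℙ(V)` that leaves `X`
invariant and for which `O` is an orbit in `X` that is open in `X`. -/
structure IsAdditiveAction (n : ℕ) (φ : (Fin n → K) → ℙ K V → ℙ K V) (X O : Set (ℙ K V)) :
    Prop where
  zero_act : ∀ x, φ 0 x = x
  add_act : ∀ s t x, φ (s + t) x = φ s (φ t x)
  isMorphism : IsMorphism n φ
  effective : ∀ t, (∀ x, φ t x = x) → t = 0
  isClosed : IsClosed X
  isIrreducible : IsIrreducible X
  dim_eq : topologicalKrullDim X = n
  invariant : ∀ t, ∀ x ∈ X, φ t x ∈ X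
  isOrbit : ∃ x ∈ X, O = Set.range fun t => φ t x
  isOpen : IsOpen ((↑) ⁻¹' O : Set X)

/-- The quadratic form `q` is irreducible as a polynomial (in particular it is nonzero). -/
def IsIrreducibleForm (q : QuadraticForm K V) : Prop :=
  ¬ ∃ f g : Module.Dual K V, ∀ v, q v = f v * g v

/-- The zero locus of a quadratic form in `ℙ(V)`. -/
def quadric (q : QuadraticForm K V) : Set (ℙ K V) := {x | q x.rep = 0}

/-- `X` is a hyperquadric in `ℙ(V)`: the hypersurface defined by an irreducible quadratic form. -/
def IsHyperquadric (X : Set (ℙ K V)) : Prop :=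
  ∃ q : QuadraticForm K V, IsIrreducibleForm q ∧ X = quadric q

/-- The singular points of the hypersurface `q = 0`: the differential of `q` at `v`, which is
`w ↦ q (v + w) - q v - q w`, vanishes. For `q` irreducible this is the singular locus of the
variety `quadric q`. -/
def singularLocus (q : QuadraticForm K V) : Set (ℙ K V) :=
  {x | x ∈ quadric q ∧ ∀ w, QuadraticMap.polar q x.rep w = 0}

/-- `X` is a hyperquadric or the whole projective space, and `Z` is the set `K(X)`, i.e. the
singular locus of `X` in the first case and the boundary `X \ O` in the second one. -/
def IsKLocus (X O Z : Set (ℙ K V)) : Prop :=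
  (∃ q : QuadraticForm K V, IsIrreducibleForm q ∧ X = quadric q ∧ Z = singularLocus q) ∨
    (X = Set.univ ∧ Z = X \ O)

/-- The fixed points in `X`. -/
def fixedPoints {n : ℕ} (φ : (Fin n → K) → ℙ K V → ℙ K V) (X : Set (ℙ K V)) : Set (ℙ K V) :=
  {x | x ∈ X ∧ ∀ t, φ t x = x}

/-- The common stabilizer of the points of `Z`. -/
def commonStabilizer {n : ℕ} (φ : (Fin n → K) → ℙ K V → ℙ K V) (Z : Set (ℙ K V)) :
    Set (Fin n → K) :=
  {t | ∀ x ∈ Z, φ t x = x}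

/-- `S` is not contained in any hyperplane. -/
def IsNondegenerateSubset (S : Set (ℙ K V)) : Prop :=
  ∀ f : Module.Dual K V, f ≠ 0 → ∃ x ∈ S, f x.rep ≠ 0

/-- The inclusion into `ℙ(V)` of a linear subspace `L`, viewed as the projective space of the vector
subspace of `V` that underlies `L`. -/
def incl (L : Projectivization.Subspace K V) :
    ℙ K (Projectivization.Subspace.submodule L) → ℙ K V :=
  Projectivization.map (Projectivization.Subspace.submodule L).subtype
    (Submodule.subtype_injective _)

end

end AddAct

namespace AddAct

universe u

/-! The proof passes to local algebras (the Hassett–Tschinkel correspondence), where the theorem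
becomes a short computation.

An algebraic action of a vector group on `ℙ(V)` lifts to `t ↦ exp (N t)`, with `N` a linear family
of commuting nilpotent operators (`exists_nilpotent_family`). Since `X` spans `ℙ(V)`, so does the
orbit of `x₀`. Hence `x₀.rep` is a cyclic vector for the commutative algebra `A` generated by the `N
t`, and evaluation at it identifies `A` with `V` (`exists_local_algebra`). The algebra `A` is local
with residue field `K`; let `ε` be its augmentation, `𝔪 = ker ε`, and `U ⊆ 𝔪` the linear space of
logarithms of the group. Then `O = {[exp w] : w ∈ U}`. In the chart `ε ≠ 0` the logarithm turns the
orbit into the linear space `U`. So `U = 𝔪` when `X` is the projective space, and `U = {w ∈ 𝔪 : q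
(exp w) = 0}` when `X` is the quadric of `q`.

In both cases `K(X)` is the projectivisation of a linear subspace `J` of `A`, namely `𝔪` or the
radical of the polar form (`IsKLocus.exists_submodule`). Since `exp w - 1` is `w` times a unit, `exp
w` fixes `[a]` exactly when `w a = 0`. So `G₁` corresponds to `U₁ = {w ∈ U : w J = 0}`. The
exponentials of `U₁` span a subalgebra `A₁`, and `L₁ = ℙ(A₁)`.

The decisive remark is that `A₁` acts on `J` through the scalars `ε`. This gives `U ∩ A₁ = U₁`: an
element of `U ∩ A₁` has augmentation zero, hence kills `J`. Thus inside `𝔪 ∩ A₁` the space `U₁` is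
again either everything or cut out by `q (exp w) = 0`, now with `q` restricted to `A₁`. In the
second case the restricted form is irreducible because the irreducible orbit spans, and `U₁` has
codimension one in `𝔪 ∩ A₁` (`exists_sub_smul_mem`). This yields the additive action on `L₁` or on a
non-degenerate quadric (`exists_isAdditiveAction_span`). The same remark gives properness: if `A₁ =
A`, then all of `U` kills `J`, so every point of `K(X)` is fixed. -/

/-- A polynomial function of one variable. -/
def IsPolyFun {K : Type*} [Field K] (f : K → K) : Prop :=
  ∃ P : Polynomial K, ∀ r, f r = P.eval r

/-! ### Polynomial functions of one variable -/

namespace IsPolyFun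

variable {K : Type*} [Field K] {f g : K → K}

lemma const (c : K) : IsPolyFun (fun _ : K => c) := ⟨Polynomial.C c, by simp⟩

lemma id : IsPolyFun (fun r : K => r) := ⟨Polynomial.X, by simp⟩

lemma add (hf : IsPolyFun f) (hg : IsPolyFun g) : IsPolyFun (fun r => f r + g r) := by
  obtain ⟨P, hP⟩ := hf
  obtain ⟨Q, hQ⟩ := hg
  exact ⟨P + Q, by simp [hP, hQ]⟩

lemma sub (hf : IsPolyFun f) (hg : IsPolyFun g) : IsPolyFun (fun r => f r - g r) := by
  obtain ⟨P, hP⟩ := hf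
  obtain ⟨Q, hQ⟩ := hg
  exact ⟨P - Q, by simp [hP, hQ]⟩

lemma mul (hf : IsPolyFun f) (hg : IsPolyFun g) : IsPolyFun (fun r => f r * g r) := by
  obtain ⟨P, hP⟩ := hf
  obtain ⟨Q, hQ⟩ := hg
  exact ⟨P * Q, by simp [hP, hQ]⟩

lemma pow (hf : IsPolyFun f) (k : ℕ) : IsPolyFun (fun r => f r ^ k) := by
  obtain ⟨P, hP⟩ := hf
  exact ⟨P ^ k, by simp [hP]⟩

lemma sum {ι : Type*} (s : Finset ι) {f : ι → K → K} (hf : ∀ i ∈ s, IsPolyFun (f i)) :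
    IsPolyFun (fun r => ∑ i ∈ s, f i r) := by
  classical
  choose! P hP using hf
  refine ⟨∑ i ∈ s, P i, fun r => ?_⟩
  rw [Polynomial.eval_finsetSum]
  exact Finset.sum_congr rfl fun i hi => hP i hi r

lemma eval_mvPolynomial {σ : Type*} {c : K → σ → K} (hc : ∀ i, IsPolyFun fun r => c r i)
    (p : MvPolynomial σ K) : IsPolyFun (fun r => MvPolynomial.eval (c r) p) := by
  choose P hP using hc
  refine ⟨MvPolynomial.aeval P p, fun r => ?_⟩
  have : (Polynomial.evalRingHom r).comp (MvPolynomial.aeval P).toRingHom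
      = (MvPolynomial.eval (c r)) := by
    ext i
    · simp
    · simp [hP]
  exact (RingHom.congr_fun this p).symm

/-- A polynomial function without zeros over an algebraically closed field is constant. -/
lemma eq_of_forall_ne_zero [IsAlgClosed K] (hf : IsPolyFun f) (h : ∀ r, f r ≠ 0) (r s : K) :
    f r = f s := by
  obtain ⟨P, hP⟩ := hf
  have : P.degree = 0 := by
    by_contra hd
    obtain ⟨x, hx⟩ := IsAlgClosed.exists_root P hd
    exact h x (by rw [hP]; exact hx)
  rw [Polynomial.eq_C_of_degree_eq_zero this] at hP
  simp [hP]

/-- A polynomial function which vanishes wherever a nonzero one does not is zero. -/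
lemma eq_zero_of_forall_ne [Infinite K] (hf : IsPolyFun f) (hg : IsPolyFun g) {r₀ : K}
    (hr₀ : g r₀ ≠ 0) (h : ∀ r, g r ≠ 0 → f r = 0) (r : K) : f r = 0 := by
  obtain ⟨P, hP⟩ := hf
  obtain ⟨Q, hQ⟩ := hg
  have hPQ : P * Q = 0 := by
    refine Polynomial.funext fun r => ?_
    rw [Polynomial.eval_mul, ← hP, ← hQ, Polynomial.eval_zero]
    by_cases hr : g r = 0
    · simp [hr]
    · simp [h r hr]
  rcases mul_eq_zero.mp hPQ with h0 | h0
  · simp [hP, h0]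
  · exact absurd (by simp [hQ, h0]) hr₀

/-- This is the irreducibility of the affine line, the source of all density and irreducibility
arguments along curves below. -/
lemma exists_ne_zero_and [Infinite K] (hf : IsPolyFun f) (hg : IsPolyFun g) {r₀ r₁ : K}
    (hr₀ : f r₀ ≠ 0) (hr₁ : g r₁ ≠ 0) : ∃ r, f r ≠ 0 ∧ g r ≠ 0 := by
  by_contra! hcon
  exact hr₀ (hf.eq_zero_of_forall_ne hg hr₁ (fun r hr => by_contra fun h => hr (hcon r h)) r₀)

end IsPolyFun

/-! ### Weighted homogeneous polynomial functions -/

/-- `f` is a weighted homogeneous polynomial in the functions `c i`. -/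
def IsWPoly {K : Type*} [Field K] {σ X : Type*} (w : σ → ℕ) (c : σ → X → K) (d : ℕ) (f : X → K) :
    Prop :=
  ∃ p : MvPolynomial σ K, p.IsWeightedHomogeneous w d ∧
    ∀ x, f x = MvPolynomial.eval (fun i => c i x) p

namespace IsWPoly

variable {K : Type*} [Field K] {σ X : Type*} {w : σ → ℕ} {c : σ → X → K} {d e : ℕ} {f g : X → K}

lemma const (a : K) : IsWPoly w c 0 (fun _ => a) :=
  ⟨MvPolynomial.C a, MvPolynomial.isWeightedHomogeneous_C w a, by simp⟩

lemma zero (d : ℕ) : IsWPoly w c d (fun _ => 0) :=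
  ⟨0, MvPolynomial.isWeightedHomogeneous_zero K w d, by simp⟩

lemma coord (i : σ) : IsWPoly w c (w i) (c i) :=
  ⟨MvPolynomial.X i, MvPolynomial.isWeightedHomogeneous_X K w i, by simp⟩

lemma add (hf : IsWPoly w c d f) (hg : IsWPoly w c d g) : IsWPoly w c d (fun x => f x + g x) := by
  obtain ⟨p, hp, hp'⟩ := hf
  obtain ⟨q, hq, hq'⟩ := hg
  exact ⟨p + q, hp.add hq, by simp [hp', hq']⟩

lemma mul (hf : IsWPoly w c d f) (hg : IsWPoly w c e g) :
    IsWPoly w c (d + e) (fun x => f x * g x) := by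
  obtain ⟨p, hp, hp'⟩ := hf
  obtain ⟨q, hq, hq'⟩ := hg
  exact ⟨p * q, hp.mul hq, by simp [hp', hq']⟩

lemma const_mul (a : K) (hf : IsWPoly w c d f) : IsWPoly w c d (fun x => a * f x) := by
  simpa using (const (w := w) (c := c) a).mul hf

lemma pow (hf : IsWPoly w c d f) (k : ℕ) : IsWPoly w c (k * d) (fun x => f x ^ k) := by
  induction k with
  | zero => simpa using const (w := w) (c := c) (1 : K)
  | succ k ih => simpa [pow_succ, Nat.succ_mul] using ih.mul hf

lemma sum {ι : Type*} (s : Finset ι) {f : ι → X → K} (hf : ∀ i ∈ s, IsWPoly w c d (f i)) :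
    IsWPoly w c d (fun x => ∑ i ∈ s, f i x) := by
  classical
  induction s using Finset.induction_on with
  | empty => simpa using zero d
  | insert a s ha ih =>
    simp only [Finset.sum_insert ha]
    exact (hf a (by simp)).add (ih fun i hi => hf i (by simp [hi]))

/-- Substitution of homogeneous polynomial functions for the coordinates. -/
lemma subst {τ : Type*} {w' : τ → ℕ} {Y : Type*} {c' : τ → Y → K} (hf : IsWPoly w c d f)
    (h : Y → X) (hc : ∀ i, IsWPoly w' c' (w i) (fun y => c i (h y))) :
    IsWPoly w' c' d (fun y => f (h y)) := by
  classical
  obtain ⟨p, hp, hp'⟩ := hf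
  simp only [hp']
  clear hp'
  simp only [MvPolynomial.eval_eq]
  refine sum _ fun m hm => ?_
  have hd : Finsupp.weight w m = d := hp (MvPolynomial.mem_support_iff.mp hm)
  refine const_mul _ ?_
  rw [← hd, Finsupp.weight_apply, Finsupp.sum]
  clear hd hm
  induction m.support using Finset.induction_on with
  | empty => simpa using const (w := w') (c := c') (1 : K)
  | insert a s ha ih =>
    simp only [Finset.prod_insert ha, Finset.sum_insert ha, smul_eq_mul]
    exact ((hc a).pow _).mul ih

lemma eval_scale {p : MvPolynomial σ K} (hp : p.IsWeightedHomogeneous w d) (a : K) (z : σ → K) :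
    MvPolynomial.eval (fun i => a ^ w i * z i) p = a ^ d * MvPolynomial.eval z p := by
  rw [MvPolynomial.eval_eq, MvPolynomial.eval_eq, Finset.mul_sum]
  refine Finset.sum_congr rfl fun m hm => ?_
  have hd : Finsupp.weight w m = d := hp (MvPolynomial.mem_support_iff.mp hm)
  rw [← hd, Finsupp.weight_apply, Finsupp.sum, ← Finset.prod_pow_eq_pow_sum]
  simp only [mul_pow, Finset.prod_mul_distrib, smul_eq_mul, ← pow_mul, mul_comm (w _)]
  ring

end IsWPoly

/-! ### Homogeneous functions and the Zariski topology -/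

section Homogeneous

variable {K : Type*} [Field K] {V : Type*} [AddCommGroup V] [Module K V]

/-- A homogeneous polynomial function on a vector space. -/
def IsHomFun (d : ℕ) (f : V → K) : Prop :=
  IsWPoly (1 : Module.Dual K V → ℕ) (fun ξ v => ξ v) d f

lemma IsHomFun.dual (ξ : Module.Dual K V) : IsHomFun 1 (fun v => ξ v) :=
  IsWPoly.coord (w := (1 : Module.Dual K V → ℕ)) (c := fun ξ v => ξ v) ξ

lemma IsHomFun.const (a : K) : IsHomFun 0 (fun _ : V => a) := IsWPoly.const a

lemma IsHomFun.mul {d e : ℕ} {f g : V → K} (hf : IsHomFun d f) (hg : IsHomFun e g) :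
    IsHomFun (d + e) (fun v => f v * g v) := IsWPoly.mul hf hg

lemma IsHomFun.map_smul {d : ℕ} {f : V → K} (hf : IsHomFun d f) (a : K) (v : V) :
    f (a • v) = a ^ d * f v := by
  obtain ⟨p, hp, hp'⟩ := hf
  rw [hp', hp', ← IsWPoly.eval_scale hp]
  simp

lemma IsHomFun.comp_linearMap {W : Type*} [AddCommGroup W] [Module K W] {d : ℕ} {f : V → K}
    (hf : IsHomFun d f) (T : W →ₗ[K] V) : IsHomFun d (fun v => f (T v)) :=
  IsWPoly.subst hf T fun ξ => IsHomFun.dual (ξ ∘ₗ T)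

/-- A homogeneous function on a subspace extends to the whole space. -/
lemma IsHomFun.exists_extend {W : Type*} [AddCommGroup W] [Module K W] {d : ℕ} {f : W → K}
    (hf : IsHomFun d f) (T : W →ₗ[K] V) (hT : Function.Injective T) :
    ∃ g : V → K, IsHomFun d g ∧ ∀ v, g (T v) = f v := by
  obtain ⟨S, hS⟩ := T.exists_leftInverse_of_injective (LinearMap.ker_eq_bot.mpr hT)
  refine ⟨fun v => f (S v), hf.comp_linearMap S, fun v => ?_⟩
  beta_reduce
  rw [← LinearMap.comp_apply, hS, LinearMap.id_apply]

/-- A polynomial curve in a vector space. -/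
def IsPolyCurve (γ : K → V) : Prop := ∀ ξ : Module.Dual K V, IsPolyFun (fun r => ξ (γ r))

lemma IsPolyCurve.smul {f : K → K} (hf : IsPolyFun f) (v : V) : IsPolyCurve (fun r => f r • v) := by
  intro ξ
  simpa using hf.mul (IsPolyFun.const (ξ v))

lemma IsPolyCurve.const (v : V) : IsPolyCurve (fun _ : K => v) := fun ξ => IsPolyFun.const (ξ v)

lemma IsPolyCurve.add {γ δ : K → V} (hγ : IsPolyCurve γ) (hδ : IsPolyCurve δ) :
    IsPolyCurve (fun r => γ r + δ r) := by
  intro ξ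
  simpa using (hγ ξ).add (hδ ξ)

lemma IsPolyCurve.line (v w : V) : IsPolyCurve (fun r : K => v + r • w) :=
  (IsPolyCurve.const v).add (IsPolyCurve.smul IsPolyFun.id w)

lemma IsPolyCurve.map {W : Type*} [AddCommGroup W] [Module K W] {γ : K → V} (hγ : IsPolyCurve γ)
    (T : V →ₗ[K] W) : IsPolyCurve (fun r => T (γ r)) := fun ξ => hγ (ξ ∘ₗ T)

lemma IsHomFun.comp_curve {d : ℕ} {f : V → K} (hf : IsHomFun d f) {γ : K → V}
    (hγ : IsPolyCurve γ) : IsPolyFun (fun r => f (γ r)) := by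
  obtain ⟨p, -, hp⟩ := hf
  simp only [hp]
  exact IsPolyFun.eval_mvPolynomial (fun ξ => hγ ξ) p

lemma IsHomFun.mk_rep_eq_zero {d : ℕ} {f : V → K} (hf : IsHomFun d f) {v : V} (hv : v ≠ 0) :
    f (Projectivization.mk K v hv).rep = 0 ↔ f v = 0 := by
  obtain ⟨a, ha⟩ := Projectivization.exists_smul_eq_mk_rep K v hv
  rw [← ha, Units.smul_def, hf.map_smul]
  simp

lemma IsHomFun.isOpen {d : ℕ} {f : V → K} (hf : IsHomFun d f) :
    IsOpen {x : ℙ K V | f x.rep ≠ 0} := by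
  obtain ⟨p, hp, hp'⟩ := hf
  refine TopologicalSpace.isOpen_generateFrom_of_mem ⟨d, p, hp, ?_⟩
  simp only [hp']

lemma IsHomFun.isClosed {d : ℕ} {f : V → K} (hf : IsHomFun d f) :
    IsClosed {x : ℙ K V | f x.rep = 0} := by
  rw [← isOpen_compl_iff]
  exact hf.isOpen

/-- Products of homogeneous functions are homogeneous, so the generating sets are stable under
intersection; the constant function one supplies the whole space. -/
lemma isTopologicalBasis_nonvanishing :
    TopologicalSpace.IsTopologicalBasis
      {U : Set (ℙ K V) | ∃ (d : ℕ) (f : V → K), IsHomFun d f ∧ U = {x | f x.rep ≠ 0}} := by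
  have key : {U : Set (ℙ K V) | ∃ (d : ℕ) (p : MvPolynomial (Module.Dual K V) K),
      p.IsHomogeneous d ∧
      U = {x : ℙ K V | MvPolynomial.eval (fun ξ : Module.Dual K V => ξ x.rep) p ≠ 0}} =
      {U : Set (ℙ K V) | ∃ (d : ℕ) (f : V → K), IsHomFun d f ∧ U = {x | f x.rep ≠ 0}} := by
    ext U
    constructor
    · rintro ⟨d, p, hp, rfl⟩
      have hf : IsHomFun d (fun v : V => MvPolynomial.eval (fun ξ : Module.Dual K V => ξ v) p) :=
        ⟨p, hp, fun _ => rfl⟩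
      exact ⟨d, _, hf, rfl⟩
    · rintro ⟨d, f, ⟨p, hp, hp'⟩, rfl⟩
      exact ⟨d, p, hp, by simp only [hp']⟩
  have hb := TopologicalSpace.isTopologicalBasis_of_subbasis_of_inter
    (t := (zariskiTopology : TopologicalSpace (ℙ K V))) (r := {U : Set (ℙ K V) |
      ∃ (d : ℕ) (f : V → K), IsHomFun d f ∧ U = {x | f x.rep ≠ 0}}) (by rw [← key]; rfl) ?_
  · rwa [Set.insert_eq_of_mem] at hb
    exact ⟨0, fun _ => 1, IsHomFun.const 1, by simp⟩
  · rintro _ ⟨d, f, hf, rfl⟩ _ ⟨e, g, hg, rfl⟩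
    refine ⟨d + e, fun v => f v * g v, hf.mul hg, ?_⟩
    ext x
    simp

lemma mem_closure_iff_homFun {S : Set (ℙ K V)} {x : ℙ K V} :
    x ∈ closure S ↔ ∀ (d : ℕ) (f : V → K), IsHomFun d f → (∀ y ∈ S, f y.rep = 0) → f x.rep = 0 := by
  rw [isTopologicalBasis_nonvanishing.mem_closure_iff]
  constructor
  · intro h d f hf hS
    by_contra hx
    obtain ⟨y, hy, hyS⟩ := h _ ⟨d, f, hf, rfl⟩ hx
    exact hy (hS y hyS)
  · rintro h _ ⟨d, f, hf, rfl⟩ hx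
    by_contra hcon
    exact hx (h d f hf fun y hy => by_contra fun hy' => hcon ⟨y, hy', hy⟩)

/-- A point on a polynomial curve lies in the closure of a set containing the general point of the
curve. -/
lemma mk_mem_closure_of_curve [Infinite K] {S : Set (ℙ K V)} {γ : K → V} (hγ : IsPolyCurve γ)
    {g : K → K} (hg : IsPolyFun g) {r₀ r₁ : K} (hr₀ : g r₀ ≠ 0)
    (h : ∀ r, g r ≠ 0 → ∀ hr : γ r ≠ 0, Projectivization.mk K (γ r) hr ∈ S) (h₁ : γ r₁ ≠ 0) :
    Projectivization.mk K (γ r₁) h₁ ∈ closure S := by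
  rw [mem_closure_iff_homFun]
  intro d f hf hS
  rw [hf.mk_rep_eq_zero]
  -- The curve may pass through the zero vector, where it defines no point. Multiplying `g` by `ξ ∘
  -- γ` excludes those parameters.
  obtain ⟨ξ, hξ⟩ : ∃ ξ : Module.Dual K V, ξ (γ r₁) ≠ 0 := by
    by_contra! hcon
    exact h₁ ((Module.forall_dual_apply_eq_zero_iff K _).mp hcon)
  obtain ⟨r₂, h₂, h₂'⟩ := hg.exists_ne_zero_and (hγ ξ) hr₀ hξ
  refine (hf.comp_curve hγ).eq_zero_of_forall_ne (hg.mul (hγ ξ)) (mul_ne_zero h₂ h₂') ?_ r₁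
  intro r hr
  obtain ⟨hr, hr'⟩ := mul_ne_zero_iff.mp hr
  have hne : γ r ≠ 0 := fun h0 => hr' (by simp [h0])
  exact (hf.mk_rep_eq_zero hne).mp (hS _ (h r hr hne))

/-- Injective linear maps induce topological embeddings of projective spaces. -/
lemma isInducing_map {W : Type*} [AddCommGroup W] [Module K W] (T : W →ₗ[K] V)
    (hT : Function.Injective T) : Topology.IsInducing (Projectivization.map T hT) := by
  have hrep : ∀ {d : ℕ} {f : V → K}, IsHomFun d f → ∀ x : ℙ K W,
      f (Projectivization.map T hT x).rep = 0 ↔ f (T x.rep) = 0 := by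
    intro d f hf x
    conv_lhs => rw [← x.mk_rep, Projectivization.map_mk]
    exact hf.mk_rep_eq_zero _
  rw [Topology.isInducing_iff_nhds]
  intro x
  refine le_antisymm ?_ ?_
  · rw [← Filter.tendsto_iff_comap]
    refine Continuous.tendsto ?_ x
    refine isTopologicalBasis_nonvanishing.continuous_iff.mpr ?_
    rintro _ ⟨d, f, hf, rfl⟩
    have := (hf.comp_linearMap T).isOpen
    convert this using 1
    ext y
    simp only [Set.mem_preimage, Set.mem_ofPred_eq, ne_eq, hrep hf]
  · intro s hs
    obtain ⟨_, ⟨d, f, hf, rfl⟩, hx, hsub⟩ := isTopologicalBasis_nonvanishing.mem_nhds_iff.mp hs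
    obtain ⟨g, hg, hgf⟩ := hf.exists_extend T hT
    refine ⟨{y | g y.rep ≠ 0}, hg.isOpen.mem_nhds ?_, fun y hy => hsub ?_⟩
    · simpa [hrep hg, hgf] using hx
    · simpa [hrep hg, hgf] using hy

end Homogeneous

/-! ### Primitive vectors over a factorial ring -/

section Primitive

variable {R : Type*} [CommRing R] [IsDomain R] [UniqueFactorizationMonoid R] {ι : Type*} [Fintype ι]

/-- Dividing a vector over a factorial ring by the greatest common divisor of its coordinates gives
a vector that divides every vector proportional to it. -/
lemma exists_primitive (F : ι → R) (hF : F ≠ 0) :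
    ∃ (g : R) (G : ι → R), (∀ i, F i = g * G i) ∧ G ≠ 0 ∧
      ∀ F' : ι → R, (∀ i j, F i * F' j = F j * F' i) → ∃ h, ∀ i, F' i = h * G i := by
  let _ : StrongNormalizationMonoid R := UniqueFactorizationMonoid.strongNormalizationMonoid
  let _ := UniqueFactorizationMonoid.toNormalizedGCDMonoid R
  obtain ⟨i₀, hi₀⟩ := Function.ne_iff.mp hF
  obtain ⟨G, hG, hG'⟩ := Finset.extract_gcd F ⟨i₀, Finset.mem_univ i₀⟩
  have hG₀ : G i₀ ≠ 0 := fun h => hi₀ (by simp [hG i₀ (Finset.mem_univ _), h])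
  have hg : Finset.univ.gcd F ≠ 0 := fun h => hi₀ (by
    rw [hG i₀ (Finset.mem_univ _), h, zero_mul]; rfl)
  refine ⟨Finset.univ.gcd F, G, fun i => hG i (Finset.mem_univ _), fun h => hG₀ (by simp [h]),
    fun F' hF' => ?_⟩
  have hGF : ∀ i j, G i * F' j = G j * F' i := by
    intro i j
    have := hF' i j
    rw [hG i (Finset.mem_univ _), hG j (Finset.mem_univ _), mul_assoc, mul_assoc] at this
    exact mul_left_cancel₀ hg this
  -- By proportionality `G i₀` divides every `G j * F' i₀`, hence their gcd. That gcd is associated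
  -- to `F' i₀` because the `G j` have gcd one.
  have hdvd : G i₀ ∣ F' i₀ := by
    have h1 : G i₀ ∣ Finset.univ.gcd (fun j => G j * F' i₀) :=
      Finset.dvd_gcd fun j _ => ⟨F' j, (hGF i₀ j).symm⟩
    have h2 := (Finset.gcd_mul_right' Finset.univ G (F' i₀)).dvd_iff_dvd_right.mp h1
    rwa [hG', one_mul] at h2
  obtain ⟨h, hh⟩ := hdvd
  refine ⟨h, fun j => mul_left_cancel₀ hG₀ ?_⟩
  rw [hGF i₀ j, hh]
  ring

end Primitive

/-! ### Factors of weighted homogeneous polynomials -/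

section Factor

/-- Degree and trailing degree are additive over a domain. They agree for the product, so they agree
for each factor. -/
lemma _root_.Polynomial.exists_eq_monomial_of_mul_eq_monomial {R : Type*} [CommRing R] [IsDomain R]
    {p q : Polynomial R} {d : ℕ} {c : R} (hc : c ≠ 0) (h : p * q = Polynomial.monomial d c) :
    ∃ e a, q = Polynomial.monomial e a := by
  have hpq : p * q ≠ 0 := by rw [h]; simpa using hc
  obtain ⟨hp, hq⟩ := mul_ne_zero_iff.mp hpq
  have h1 := Polynomial.natDegree_mul hp hq
  have h2 := Polynomial.natTrailingDegree_mul hp hq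
  rw [h, Polynomial.natDegree_monomial_eq _ hc] at h1
  rw [h, Polynomial.natTrailingDegree_monomial hc] at h2
  have h3 := Polynomial.natTrailingDegree_le_natDegree p
  have h4 := Polynomial.natTrailingDegree_le_natDegree q
  refine ⟨q.natDegree, q.coeff q.natDegree, ?_⟩
  ext k
  rw [Polynomial.coeff_monomial]
  split_ifs with hk
  · rw [hk]
  · rcases lt_or_gt_of_ne hk with hk | hk
    · exact Polynomial.coeff_eq_zero_of_natDegree_lt hk
    · exact Polynomial.coeff_eq_zero_of_lt_natTrailingDegree (by omega)

open MvPolynomial in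
/-- A factor of a nonzero weighted homogeneous polynomial is weighted homogeneous. -/
lemma exists_isWeightedHomogeneous_of_mul {K σ : Type*} [Field K] {w : σ → ℕ}
    {p q : MvPolynomial σ K} {d : ℕ} (hpq : (p * q).IsWeightedHomogeneous w d) (h0 : p * q ≠ 0) :
    ∃ e, q.IsWeightedHomogeneous w e := by
  classical
  -- With a new variable `T`, the map `Λ` sends `X i` to `T ^ w i * X i`. The coefficients in `T`
  -- are the weighted components, so homogeneous elements become monomials in `T`; setting `T = 1`
  -- inverts `Λ`.
  let Λ : MvPolynomial σ K →ₐ[K] Polynomial (MvPolynomial σ K) :=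
    aeval (fun i => Polynomial.monomial (w i) (X i))
  have hmon : ∀ (m : σ →₀ ℕ) (a : K), Λ (monomial m a) =
      Polynomial.monomial (Finsupp.weight w m) (monomial m a) := by
    intro m a
    have hC : ∀ a : K, algebraMap K (Polynomial (MvPolynomial σ K)) a =
        Polynomial.monomial 0 (C a) := fun a => by
      rw [Polynomial.monomial_zero_left, IsScalarTower.algebraMap_apply K (MvPolynomial σ K)]
      rfl
    simp only [Λ, aeval_monomial, hC]
    rw [monomial_eq, Finsupp.weight_apply, Finsupp.prod, Finsupp.prod, Finsupp.sum]
    simp only [Polynomial.monomial_pow]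
    induction m.support using Finset.induction_on with
    | empty => simp
    | insert a s ha ih =>
      rw [Finset.prod_insert ha, Finset.prod_insert ha, Finset.sum_insert ha, mul_left_comm, ih,
        Polynomial.monomial_mul_monomial]
      congr 1
      · simp [mul_comm]
      · ring
  have hmonC : ∀ a : K, Λ (C a) = Polynomial.monomial 0 (C a) := fun a => by
    simp
  have hcoeff : ∀ (k : ℕ) (r : MvPolynomial σ K),
      (Λ r).coeff k = weightedHomogeneousComponent w k r := by
    intro k r
    induction r using MvPolynomial.induction_on' with
    | monomial m a =>
      rw [hmon, Polynomial.coeff_monomial,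
        weightedHomogeneousComponent_of_mem (n := Finsupp.weight w m)
          (isWeightedHomogeneous_monomial w m a rfl)]
      simp only [eq_comm]
    | add r s hr hs => rw [map_add, Polynomial.coeff_add, hr, hs, map_add]
  have hΛ : Λ p * Λ q = Polynomial.monomial d (p * q) := by
    rw [← map_mul]
    ext1 k
    rw [hcoeff, Polynomial.coeff_monomial, weightedHomogeneousComponent_of_mem (n := d) hpq]
    simp only [eq_comm]
  obtain ⟨e, a, hea⟩ := Polynomial.exists_eq_monomial_of_mul_eq_monomial h0 hΛ
  refine ⟨e, ?_⟩
  have hone : ∀ r, (Λ r).eval 1 = r := by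
    intro r
    have : ((Polynomial.evalRingHom 1).comp Λ.toRingHom : MvPolynomial σ K →+* _) = RingHom.id _ := by
      refine MvPolynomial.ringHom_ext (fun a => ?_) fun i => ?_
      · simp [hmonC]
      · simp [Λ]
    exact RingHom.congr_fun this r
  have ha : a = q := by
    rw [← hone q, hea, Polynomial.eval_monomial, one_pow, mul_one]
  have hq : weightedHomogeneousComponent w e q = q := by
    rw [← hcoeff, hea, Polynomial.coeff_monomial, if_pos rfl, ha]
  rw [← hq]
  exact weightedHomogeneousComponent_isWeightedHomogeneous e q

end Factor

/-! ### Morphisms `𝔸ⁿ × ℙ(V) → ℙ(V)` in coordinates -/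

section Linearization

variable {K : Type*} [Field K] {V : Type*} [AddCommGroup V] [Module K V]

lemma IsHomFun.exists_dual {f : V → K} (hf : IsHomFun 1 f) : ∃ ξ : Module.Dual K V, ∀ v, f v = ξ v := by
  obtain ⟨p, hp, hp'⟩ := hf
  have hp1 : p ∈ MvPolynomial.homogeneousSubmodule (Module.Dual K V) K 1 := hp
  rw [MvPolynomial.homogeneousSubmodule_one_eq_span_X] at hp1
  simp only [hp']
  clear hp' hp
  induction hp1 using Submodule.span_induction with
  | mem x hx =>
    obtain ⟨ξ, rfl⟩ := hx
    exact ⟨ξ, by simp⟩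
  | zero => exact ⟨0, by simp⟩
  | add x y _ _ hx hy =>
    obtain ⟨ξ, hξ⟩ := hx
    obtain ⟨η, hη⟩ := hy
    exact ⟨ξ + η, by simp [hξ, hη]⟩
  | smul a x _ hx =>
    obtain ⟨ξ, hξ⟩ := hx
    exact ⟨a • ξ, by simp [hξ, MvPolynomial.smul_eval]⟩

variable {ι : Type*} [Fintype ι] (b : Module.Basis ι K V) {n : ℕ}

/-- The weights of the coordinates on `𝔸ⁿ × V`: parameters have weight zero. -/
abbrev wt (n : ℕ) (ι : Type*) : Fin n ⊕ ι → ℕ := Sum.elim (fun _ => 0) (fun _ => 1)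

/-- The coordinates of a point of `𝔸ⁿ × V`. -/
noncomputable def coords (t : Fin n → K) (v : V) : Fin n ⊕ ι → K := Sum.elim t (b.repr v)

/-- The vector with given polynomial coordinates at a point of `𝔸ⁿ × V`. -/
noncomputable def vecEval (G : ι → MvPolynomial (Fin n ⊕ ι) K) (t : Fin n → K) (v : V) : V :=
  b.equivFun.symm (fun i => MvPolynomial.eval (coords b t v) (G i))

lemma repr_vecEval (G : ι → MvPolynomial (Fin n ⊕ ι) K) (t : Fin n → K) (v : V) (i : ι) :
    b.repr (vecEval b G t v) i = MvPolynomial.eval (coords b t v) (G i) := by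
  rw [vecEval, ← b.equivFun_apply, LinearEquiv.apply_symm_apply]

lemma IsPolyHomogeneous.exists_coords {d : ℕ} {f : (Fin n → K) → V → K}
    (hf : IsPolyHomogeneous n d f) : ∃ P : MvPolynomial (Fin n ⊕ ι) K,
      P.IsWeightedHomogeneous (wt n ι) d ∧ ∀ t v, f t v = MvPolynomial.eval (coords b t v) P := by
  obtain ⟨p, hp, hp'⟩ := hf
  have h1 : IsWPoly (Sum.elim (fun _ => 0) (fun _ => 1) : Fin n ⊕ Module.Dual K V → ℕ)
      (fun i (x : (Fin n → K) × V) => Sum.elim x.1 (fun ξ : Module.Dual K V => ξ x.2) i) d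
      (fun x => f x.1 x.2) := ⟨p, hp, fun x => hp' x.1 x.2⟩
  have h2 := h1.subst (w' := wt n ι)
    (c' := fun i (x : (Fin n → K) × V) => coords b x.1 x.2 i) id ?_
  · obtain ⟨P, hP, hP'⟩ := h2
    exact ⟨P, hP, fun t v => hP' (t, v)⟩
  · rintro (k | ξ)
    · exact IsWPoly.coord (w := wt n ι) (Sum.inl k)
    · have : (fun x : (Fin n → K) × V => ξ x.2) =
          fun x => ∑ i, ξ (b i) * coords b x.1 x.2 (Sum.inr i) := by
        funext x
        conv_lhs => rw [← b.sum_repr x.2]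
        simp only [map_sum, map_smul, smul_eq_mul, coords, Sum.elim_inr, mul_comm]
      simp only [Sum.elim_inr, id]
      rw [this]
      exact IsWPoly.sum _ fun i _ =>
        (IsWPoly.coord (w := wt n ι) (c := fun i (x : (Fin n → K) × V) => coords b x.1 x.2 i)
          (Sum.inr i)).const_mul _

lemma vecEval_smul {d : ℕ} {G : ι → MvPolynomial (Fin n ⊕ ι) K}
    (hG : ∀ i, (G i).IsWeightedHomogeneous (wt n ι) d) (t : Fin n → K) (a : K) (v : V) :
    vecEval b G t (a • v) = a ^ d • vecEval b G t v := by
  apply b.repr.injective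
  ext i
  rw [map_smul, Finsupp.smul_apply, repr_vecEval, repr_vecEval, smul_eq_mul,
    ← IsWPoly.eval_scale (hG i)]
  congr 2
  funext j
  rcases j with j | j <;> simp [coords]

lemma isPolyFun_vecEval (G : ι → MvPolynomial (Fin n ⊕ ι) K) {t : K → Fin n → K} {γ : K → V}
    (ht : ∀ k, IsPolyFun fun r => t r k) (hγ : IsPolyCurve γ) (i : ι) :
    IsPolyFun (fun r => b.repr (vecEval b G (t r) (γ r)) i) := by
  simp only [repr_vecEval]
  refine IsPolyFun.eval_mvPolynomial ?_ _
  rintro (k | j)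
  · exact ht k
  · exact hγ (b.coord j)

/-- A morphism `𝔸ⁿ × ℙ(V) → ℙ(V)` is given globally by homogeneous polynomials without common
zeros. -/
lemma IsMorphism.exists_global [Infinite K] [Nontrivial V] {φ : (Fin n → K) → ℙ K V → ℙ K V}
    (hφ : IsMorphism n φ) : ∃ (e : ℕ) (G : ι → MvPolynomial (Fin n ⊕ ι) K),
      (∀ i, (G i).IsWeightedHomogeneous (wt n ι) e) ∧
      ∀ t v (hv : v ≠ 0), ∃ hG : vecEval b G t v ≠ 0,
        φ t (Projectivization.mk K v hv) = Projectivization.mk K (vecEval b G t v) hG := by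
  classical
  have loc : ∀ t₀ v₀, v₀ ≠ 0 → ∃ (d : ℕ) (P : ι → MvPolynomial (Fin n ⊕ ι) K),
      (∀ i, (P i).IsWeightedHomogeneous (wt n ι) d) ∧ vecEval b P t₀ v₀ ≠ 0 ∧
      ∀ t v (hv : v ≠ 0) (hP : vecEval b P t v ≠ 0),
        φ t (Projectivization.mk K v hv) = Projectivization.mk K (vecEval b P t v) hP := by
    intro t₀ v₀ hv₀
    obtain ⟨d, F, hF, hF₀, hFφ⟩ := hφ t₀ (Projectivization.mk K v₀ hv₀)
    choose P hP hP' using fun i => (hF (b.coord i)).exists_coords b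
    have hPF : ∀ t v, vecEval b P t v = F t v := by
      intro t v
      apply b.repr.injective
      ext i
      rw [repr_vecEval, ← hP' i t v, b.coord_apply]
    refine ⟨d, P, hP, fun h => hF₀ ?_, fun t v hv hPv => ?_⟩
    · obtain ⟨a, ha⟩ := Projectivization.exists_smul_eq_mk_rep K v₀ hv₀
      rw [← ha, ← hPF, Units.smul_def, vecEval_smul b hP, h, smul_zero]
    · simp only [hPF] at hPv ⊢
      exact hFφ t v hv hPv
  obtain ⟨v₀, hv₀⟩ := exists_ne (0 : V)
  obtain ⟨i₀⟩ : Nonempty ι := b.index_nonempty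
  obtain ⟨d, F, hF, hF₀, hFφ⟩ := loc 0 v₀ hv₀
  have hFne : F ≠ 0 := by
    rintro rfl
    apply hF₀
    apply b.repr.injective
    ext i
    simp [repr_vecEval]
  -- Dividing one local expression by the gcd of its coordinates makes it global. Any other local
  -- expression is a polynomial multiple of `G`, so `G` is nonzero wherever that expression is.
  obtain ⟨g, G, hFG, hG₀, hG⟩ := exists_primitive F hFne
  obtain ⟨i₁, hi₁⟩ := Function.ne_iff.mp hFne
  have hg : g ≠ 0 := fun h => hi₁ (by simp [hFG, h])
  obtain ⟨a, ha⟩ := exists_isWeightedHomogeneous_of_mul (p := G i₁) (q := g) (w := wt n ι) (d := d)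
    (by rw [mul_comm, ← hFG]; exact hF i₁) (by rw [mul_comm, ← hFG]; exact hi₁)
  have hGhom : ∀ i, G i ≠ 0 → ∃ e, (G i).IsWeightedHomogeneous (wt n ι) e ∧ a + e = d := by
    intro i hi
    have hgi : g * G i ≠ 0 := mul_ne_zero hg hi
    obtain ⟨e, he⟩ := exists_isWeightedHomogeneous_of_mul (p := g) (q := G i) (w := wt n ι) (d := d)
      (by rw [← hFG]; exact hF i) hgi
    exact ⟨e, he, MvPolynomial.IsWeightedHomogeneous.inj_right hgi (ha.mul he)
      (by rw [← hFG]; exact hF i)⟩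
  refine ⟨d - a, G, fun i => ?_, fun t v hv => ?_⟩
  · by_cases hi : G i = 0
    · rw [hi]
      exact MvPolynomial.isWeightedHomogeneous_zero K _ _
    · obtain ⟨e, he, hae⟩ := hGhom i hi
      rwa [show d - a = e by omega]
  · obtain ⟨d', P, hP, hP₀, hPφ⟩ := loc t v hv
    obtain ⟨h, hh⟩ := hG P (by
      intro i j
      -- The morphism says nothing at the zero vector. The extra factor `X` vanishes there, so the
      -- identity can be checked at all points.
      have hX : (MvPolynomial.X (Sum.inr i₀) : MvPolynomial (Fin n ⊕ ι) K) ≠ 0 :=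
        MvPolynomial.X_ne_zero _
      refine mul_left_cancel₀ hX (MvPolynomial.funext fun z => ?_)
      obtain ⟨s, u, rfl⟩ : ∃ (s : Fin n → K) (u : V), z = coords b s u :=
        ⟨fun k => z (Sum.inl k), b.equivFun.symm (fun k => z (Sum.inr k)), by
          funext k
          rcases k with k | k
          · rfl
          · simp [coords, ← b.equivFun_apply, -Module.Basis.equivFun_symm_apply]⟩
      simp only [map_mul, MvPolynomial.eval_X, ← repr_vecEval]
      by_cases hu : u = 0
      · simp [coords, hu]
      by_cases h1 : vecEval b F s u = 0
      · simp [h1]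
      by_cases h2 : vecEval b P s u = 0
      · simp [h2]
      have := (hFφ s u hu h1).symm.trans (hPφ s u hu h2)
      rw [Projectivization.mk_eq_mk_iff'] at this
      obtain ⟨c, hc⟩ := this
      rw [← hc]
      simp only [map_smul, Finsupp.smul_apply, smul_eq_mul]
      ring)
    have hPG : vecEval b P t v = MvPolynomial.eval (coords b t v) h • vecEval b G t v := by
      apply b.repr.injective
      ext i
      rw [map_smul, Finsupp.smul_apply, repr_vecEval, repr_vecEval, hh, map_mul, smul_eq_mul]
    have hGne : vecEval b G t v ≠ 0 := fun h0 => hP₀ (by rw [hPG, h0, smul_zero])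
    refine ⟨hGne, ?_⟩
    rw [hPφ t v hv hP₀, Projectivization.mk_eq_mk_iff']
    exact ⟨_, hPG.symm⟩

/-- A morphism `𝔸ⁿ × ℙ(V) → ℙ(V)` which is the identity at `0 ∈ 𝔸ⁿ` is given by linear maps. -/
lemma IsMorphism.exists_linear [IsAlgClosed K] [Nontrivial ι] [DecidableEq ι]
    {φ : (Fin n → K) → ℙ K V → ℙ K V} (hφ : IsMorphism n φ) (h0 : ∀ x, φ 0 x = x) :
    ∃ M : (Fin n → K) → Matrix ι ι K,
      (∀ (t : K → Fin n → K), (∀ k, IsPolyFun fun r => t r k) → ∀ i j, IsPolyFun fun r => M (t r) i j) ∧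
      ∀ t v (hv : v ≠ 0), ∃ hM : Matrix.toLin b b (M t) v ≠ 0,
        φ t (Projectivization.mk K v hv) = Projectivization.mk K (Matrix.toLin b b (M t) v) hM := by
  have : Infinite K := IsAlgClosed.instInfinite
  have : Nontrivial V := b.repr.toEquiv.nontrivial
  obtain ⟨e, G, hG, hGφ⟩ := hφ.exists_global b
  have hz : ∀ v, v ≠ 0 → ∃ c : K, c ≠ 0 ∧ vecEval b G 0 v = c • v := by
    intro v hv
    obtain ⟨h1, h2⟩ := hGφ 0 v hv
    rw [h0, eq_comm, Projectivization.mk_eq_mk_iff'] at h2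
    obtain ⟨c, hc⟩ := h2
    exact ⟨c, by rintro rfl; simp at hc; exact h1 hc.symm, hc.symm⟩
  obtain ⟨i, j, hij⟩ := exists_pair_ne ι
  -- At `t = 0` the vector `G` is a scalar multiple of its argument. Along `s • b i + b j` this
  -- scalar is the `j`-th coordinate of `G`, a polynomial in `s` without zeros, hence a constant
  -- `c`. By homogeneity the `i`-th coordinate at `b i + r • b j` is `c * r ^ (e - 1)` for `r ≠ 0`.
  -- It is polynomial in `r` and nonzero at `r = 0`, which leaves only `e = 1`.
  have he : e = 1 := by
    have hne1 : ∀ s : K, s • b i + b j ≠ 0 := fun s hs => by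
      have := congrArg (fun v => b.repr v j) hs
      simp [hij] at this
    have hne2 : ∀ s : K, b i + s • b j ≠ 0 := fun s hs => by
      have := congrArg (fun v => b.repr v i) hs
      simp [hij.symm] at this
    have hc1 : IsPolyCurve fun s : K => s • b i + b j :=
      (IsPolyCurve.smul IsPolyFun.id _).add (IsPolyCurve.const _)
    have hp : IsPolyFun fun s : K => b.repr (vecEval b G 0 (s • b i + b j)) j :=
      isPolyFun_vecEval b G (t := fun _ => 0) (fun k => IsPolyFun.const _) hc1 j
    have hpne : ∀ s : K, b.repr (vecEval b G 0 (s • b i + b j)) j ≠ 0 := by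
      intro s
      obtain ⟨c, hc, hc'⟩ := hz _ (hne1 s)
      simp [hc', hij, hc]
    have hconst := hp.eq_of_forall_ne_zero hpne
    set c := b.repr (vecEval b G 0 ((0 : K) • b i + b j)) j with hcdef
    have hc : c ≠ 0 := hpne 0
    have hi : ∀ s : K, b.repr (vecEval b G 0 (s • b i + b j)) i = c * s := by
      intro s
      obtain ⟨c', -, hc'⟩ := hz _ (hne1 s)
      have h1 : c' = c := by
        have := hconst s 0
        simp only [← hcdef] at this
        rw [← this, hc']
        simp [hij]
      rw [hc', h1]
      simp [hij.symm]
    have hr : ∀ r : K, r ≠ 0 → r * b.repr (vecEval b G 0 (b i + r • b j)) i = c * r ^ e := by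
      intro r hr
      have h1 : b i + r • b j = r • (r⁻¹ • b i + b j) := by
        rw [smul_add, smul_smul, mul_inv_cancel₀ hr, one_smul]
      rw [h1, vecEval_smul b hG, map_smul, Finsupp.smul_apply, hi, smul_eq_mul]
      field_simp
    have hf : IsPolyFun fun r : K => b.repr (vecEval b G 0 (b i + r • b j)) i :=
      isPolyFun_vecEval b G (t := fun _ => 0) (fun k => IsPolyFun.const _)
        (IsPolyCurve.line _ _) i
    rcases e with _ | _ | e
    · have := ((IsPolyFun.id.mul hf).sub (IsPolyFun.const c)).eq_zero_of_forall_ne IsPolyFun.id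
        (r₀ := 1) one_ne_zero (fun r hr0 => by simp [hr r hr0]) 0
      simp [hc] at this
    · rfl
    · have := (hf.sub ((IsPolyFun.const c).mul (IsPolyFun.id.pow (e + 1)))).eq_zero_of_forall_ne
        IsPolyFun.id (r₀ := 1) one_ne_zero (fun r hr0 => by
          refine mul_left_cancel₀ hr0 ?_
          simp only [mul_sub, hr r hr0]
          ring) 0
      obtain ⟨c', hc', hc''⟩ := hz (b i) (b.ne_zero i)
      simp [hc'', hc'] at this
  subst he
  have hlin : ∀ t i, ∃ ξ : Module.Dual K V, ∀ v, b.repr (vecEval b G t v) i = ξ v := by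
    intro t i
    refine IsHomFun.exists_dual ?_
    simp only [repr_vecEval]
    have h1 : IsWPoly (wt n ι) (fun i (x : (Fin n → K) × V) => coords b x.1 x.2 i) 1
      (fun x => MvPolynomial.eval (coords b x.1 x.2) (G i)) := ⟨G i, hG i, fun _ => rfl⟩
    refine h1.subst (fun v => (t, v)) ?_
    rintro (k | j)
    · exact IsHomFun.const _
    · exact IsHomFun.dual (b.coord j)
  choose ξ hξ using hlin
  have hM : ∀ t v, Matrix.toLin b b (Matrix.of fun i j => ξ t i (b j)) v = vecEval b G t v := by
    intro t v
    apply b.repr.injective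
    ext i
    rw [hξ]
    have : b.coord i ∘ₗ Matrix.toLin b b (Matrix.of fun i j => ξ t i (b j)) = ξ t i := by
      refine b.ext fun j => ?_
      simp [Matrix.toLin_self, Finsupp.single_apply]
    exact LinearMap.congr_fun this v
  refine ⟨fun t => Matrix.of fun i j => ξ t i (b j), fun t ht i j => ?_, fun t v hv => ?_⟩
  · simp only [Matrix.of_apply, ← hξ]
    exact isPolyFun_vecEval b G ht (IsPolyCurve.const _) i
  · simp only [hM]
    exact hGφ t v hv

end Linearization

/-! ### Polynomial representations of vector groups are exponentials -/

/-- The exponential series, truncated before degree `D`. -/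
noncomputable def nexp (K : Type*) [Field K] {A : Type*} [Ring A] [Algebra K A] (D : ℕ) (a : A) : A :=
  ∑ i ∈ Finset.range D, (i.factorial : K)⁻¹ • a ^ i

section OneParameter

open Polynomial

variable {K : Type*} [Field K] {ι : Type*} [Fintype ι] {n : ℕ}

lemma eval_sum_mul_apply (P Q : Matrix ι ι K[X]) (r : K) (i j : ι) :
    (∑ k, P i k * Q k j).eval r =
      (P.map (Polynomial.eval r) * Q.map (Polynomial.eval r)) i j := by
  simp [Polynomial.eval_finsetSum, Matrix.mul_apply]

variable [DecidableEq ι]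

/-- A polynomial projective representation of a vector group is, up to scalars, a homomorphism. -/
lemma map_add_of_projective [IsAlgClosed K] [Nonempty ι] {M : (Fin n → K) → Matrix ι ι K}
    {P : (Fin n → K) → Matrix ι ι K[X]} (hP : ∀ t r, (P t).map (Polynomial.eval r) = M (r • t))
    (h0 : M 0 = 1) (hdet : ∀ t, (M t).det ≠ 0)
    (hadd : ∀ s t, ∃ c : K, M (s + t) = c • (M s * M t)) (s t : Fin n → K) :
    M (s + t) = M s * M t := by
  have : Infinite K := IsAlgClosed.instInfinite
  have hdetP : ∀ t r, (P t).det.eval r = (M (r • t)).det := by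
    intro t r
    rw [← hP, ← Polynomial.coe_evalRingHom, RingHom.map_det]
    rfl
  have hadjP : ∀ t r, (P t).adjugate.map (Polynomial.eval r) = (M (r • t)).adjugate := by
    intro t r
    rw [← hP]
    exact (RingHom.map_adjugate (Polynomial.evalRingHom r) (P t))
  -- Along `r ↦ r • t` the determinant is a polynomial without zeros, so it keeps its value at `r =
  -- 0`.
  have hdet1 : ∀ t, (M t).det = 1 := by
    intro t
    have hf : IsPolyFun fun r : K => (M (r • t)).det := ⟨_, fun r => (hdetP t r).symm⟩
    have := hf.eq_of_forall_ne_zero (fun r => hdet _) 1 0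
    simpa [h0] using this
  obtain ⟨i⟩ := ‹Nonempty ι›
  choose c hc using hadd
  have hcN : ∀ s t, c s t ^ Fintype.card ι = 1 := by
    intro s t
    have := congrArg Matrix.det (hc s t)
    rw [Matrix.det_smul, Matrix.det_mul, hdet1, hdet1, hdet1] at this
    simpa using this.symm
  -- With determinants one, adjugates are inverses, so `q` expresses the cocycle `c (r • s) (r • t)`
  -- as a polynomial in `r`. Its values are roots of unity, so `q` is a unit, hence constant, and at
  -- `r = 0` it is one.
  let q : K[X] := (P (s + t) * ((P t).adjugate * (P s).adjugate)) i i
  have hq : ∀ r, q.eval r = c (r • s) (r • t) := by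
    intro r
    have h1 : q.eval r = ((P (s + t) * ((P t).adjugate * (P s).adjugate)).map
        (Polynomial.evalRingHom r)) i i := rfl
    rw [h1, Matrix.map_mul, Matrix.map_mul, Polynomial.coe_evalRingHom, hP, hadjP, hadjP, smul_add,
      hc, ← Matrix.adjugate_mul_distrib, smul_mul_assoc, Matrix.mul_adjugate, Matrix.det_mul, hdet1,
      hdet1]
    simp
  have hqN : q ^ Fintype.card ι = 1 := by
    refine Polynomial.funext fun r => ?_
    rw [Polynomial.eval_pow, hq, hcN, Polynomial.eval_one]
  have hqu : IsUnit q := IsUnit.of_pow_eq_one hqN Fintype.card_ne_zero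
  have h10 : q.eval 1 = q.eval 0 := by
    rw [Polynomial.eq_C_of_degree_eq_zero (Polynomial.degree_eq_zero_of_isUnit hqu)]
    simp
  have h00 : c 0 0 = 1 := by
    have := congrFun (congrFun (hc 0 0) i) i
    simpa [h0] using this.symm
  rw [hq, hq, one_smul, one_smul, zero_smul, zero_smul, h00] at h10
  rw [hc, h10, one_smul]

/-- A polynomial representation of a vector group is the exponential of a linear family of commuting
nilpotent matrices. -/
lemma exists_log_of_hom [CharZero K] [Nonempty ι] {M : (Fin n → K) → Matrix ι ι K}
    {P : (Fin n → K) → Matrix ι ι K[X]} (hP : ∀ t r, (P t).map (Polynomial.eval r) = M (r • t))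
    (h0 : M 0 = 1) (hadd : ∀ s t, M (s + t) = M s * M t) :
    ∃ N : (Fin n → K) →ₗ[K] Matrix ι ι K, (∀ t, IsNilpotent (N t)) ∧
      (∀ s t, Commute (N s) (N t)) ∧ ∀ t D, N t ^ D = 0 → M t = nexp K D (N t) := by
  have hP' : ∀ t r i j, (P t i j).eval r = M (r • t) i j := by
    intro t r i j
    rw [← hP]
    rfl
  -- `B t k` is the coefficient of `r ^ k` in `M (r • t)`; the logarithm `N t` will be `B t 1`.
  let B : (Fin n → K) → ℕ → Matrix ι ι K := fun t k => (P t).map (fun p => p.coeff k)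
  have hB0 : ∀ t, B t 0 = 1 := by
    intro t
    ext i j
    simp only [B, Matrix.map_apply]
    rw [Polynomial.coeff_zero_eq_eval_zero, hP', zero_smul, h0]
  have hBadd : ∀ s t, B (s + t) 1 = B s 1 + B t 1 := by
    intro s t
    ext i j
    have h1 : P (s + t) i j = ∑ k, P s i k * P t k j := by
      refine Polynomial.funext fun r => ?_
      rw [eval_sum_mul_apply, hP, hP, hP', smul_add, hadd]
    have h2 : ∀ t i j, (P t i j).coeff 0 = (1 : Matrix ι ι K) i j := fun t i j => by
      rw [← hB0 t]
      rfl
    simp only [B, Matrix.map_apply, Matrix.add_apply]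
    rw [h1, Polynomial.finsetSum_coeff]
    simp only [Polynomial.mul_coeff_one, h2, Matrix.one_apply]
    simp [Finset.sum_add_distrib, add_comm]
  have hBsmul : ∀ (a : K) t, B (a • t) 1 = a • B t 1 := by
    intro a t
    ext i j
    have h1 : P (a • t) i j = (P t i j).comp (Polynomial.C a * Polynomial.X) := by
      refine Polynomial.funext fun r => ?_
      rw [Polynomial.eval_comp, hP']
      simp only [Polynomial.eval_mul, Polynomial.eval_C, Polynomial.eval_X]
      rw [hP', smul_smul, mul_comm]
    simp only [B, Matrix.map_apply, Matrix.smul_apply]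
    rw [h1, Polynomial.comp_C_mul_X_coeff, pow_one, mul_comm, smul_eq_mul]
  let N : (Fin n → K) →ₗ[K] Matrix ι ι K :=
    { toFun := fun t => B t 1, map_add' := hBadd, map_smul' := hBsmul }
  -- The linear term in `h` of `M ((r + h) • t) = M (r • t) * M (h • t)` is the differential
  -- equation `P' = P * N`. Comparing coefficients gives `B t k = N t ^ k / k!`, and nilpotency
  -- follows since `P` has finite degree.
  have hder : ∀ t i j, Polynomial.derivative (P t i j) = ∑ k, P t i k * Polynomial.C (N t k j) := by
    intro t i j
    refine Polynomial.funext fun r => ?_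
    have h1 : Polynomial.taylor r (P t i j) = ∑ k, Polynomial.C ((P t i k).eval r) * P t k j := by
      refine Polynomial.funext fun h => ?_
      rw [Polynomial.taylor_apply, Polynomial.eval_comp]
      simp only [Polynomial.eval_add, Polynomial.eval_X, Polynomial.eval_C,
        Polynomial.eval_finsetSum, Polynomial.eval_mul, hP']
      rw [add_comm h r, add_smul, hadd, Matrix.mul_apply]
    have h2 := congrArg (fun p => p.coeff 1) h1
    simp only [Polynomial.taylor_coeff_one, Polynomial.finsetSum_coeff,
      Polynomial.coeff_C_mul] at h2
    rw [h2, Polynomial.eval_finsetSum]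
    simp [N, B]
  have hBk : ∀ t k, B t k = (k.factorial : K)⁻¹ • N t ^ k := by
    intro t k
    induction k with
    | zero => simp [hB0]
    | succ k ih =>
      have h1 : ((k : K) + 1) • B t (k + 1) = B t k * N t := by
        ext i j
        have := congrArg (fun p => p.coeff k) (hder t i j)
        simp only [Polynomial.coeff_derivative, Polynomial.finsetSum_coeff,
          Polynomial.coeff_mul_C] at this
        rw [Matrix.smul_apply, Matrix.mul_apply, smul_eq_mul, mul_comm]
        exact this
      have hk : (k : K) + 1 ≠ 0 := by exact_mod_cast Nat.succ_ne_zero k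
      have h2 : B t (k + 1) = ((k : K) + 1)⁻¹ • (B t k * N t) := by
        rw [← h1, smul_smul, inv_mul_cancel₀ hk, one_smul]
      rw [h2, ih, smul_mul_assoc, smul_smul, ← pow_succ, Nat.factorial_succ]
      push_cast
      rw [mul_inv]
  have hcomm1 : ∀ s t, M s * N t = N t * M s := by
    intro s t
    ext i j
    have h1 : ∑ k, Polynomial.C (M s i k) * P t k j = ∑ k, P t i k * Polynomial.C (M s k j) := by
      refine Polynomial.funext fun r => ?_
      simp only [Polynomial.eval_finsetSum, Polynomial.eval_mul, Polynomial.eval_C, hP']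
      rw [← Matrix.mul_apply, ← Matrix.mul_apply, ← hadd, ← hadd, add_comm]
    have h2 := congrArg (fun p => p.coeff 1) h1
    simp only [Polynomial.finsetSum_coeff, Polynomial.coeff_C_mul, Polynomial.coeff_mul_C] at h2
    rw [Matrix.mul_apply, Matrix.mul_apply]
    exact h2
  refine ⟨N, fun t => ?_, fun s t => ?_, fun t D hD => ?_⟩
  · obtain ⟨d, hd⟩ : ∃ d, ∀ i j, (P t i j).natDegree < d :=
      ⟨Finset.univ.sup (fun ij : ι × ι => (P t ij.1 ij.2).natDegree) + 1, fun i j =>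
        Nat.lt_succ_of_le (Finset.le_sup (f := fun ij : ι × ι => (P t ij.1 ij.2).natDegree)
          (Finset.mem_univ (i, j)))⟩
    refine ⟨d, ?_⟩
    have h1 : B t d = 0 := by
      ext i j
      exact Polynomial.coeff_eq_zero_of_natDegree_lt (hd i j)
    rw [hBk] at h1
    exact (smul_eq_zero.mp h1).resolve_left (inv_ne_zero (by exact_mod_cast d.factorial_ne_zero))
  · ext i j
    have h1 : ∑ k, P s i k * Polynomial.C (N t k j) = ∑ k, Polynomial.C (N t i k) * P s k j := by
      refine Polynomial.funext fun r => ?_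
      simp only [Polynomial.eval_finsetSum, Polynomial.eval_mul, Polynomial.eval_C, hP']
      rw [← Matrix.mul_apply, ← Matrix.mul_apply, hcomm1]
    have h2 := congrArg (fun p => p.coeff 1) h1
    simp only [Polynomial.finsetSum_coeff, Polynomial.coeff_C_mul, Polynomial.coeff_mul_C] at h2
    rw [Matrix.mul_apply, Matrix.mul_apply]
    exact h2
  · have hDpos : D ≠ 0 := by
      rintro rfl
      simp at hD
    ext i j
    have hdeg : (P t i j).natDegree < D := by
      suffices (P t i j).natDegree ≤ D - 1 by omega
      rw [Polynomial.natDegree_le_iff_coeff_eq_zero]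
      intro m hm
      have : B t m = 0 := by
        rw [hBk, pow_eq_zero_of_le (by omega) hD, smul_zero]
      exact congrFun (congrFun this i) j
    have h1 := hP' t 1 i j
    rw [one_smul, Polynomial.eval_eq_sum_range' hdeg] at h1
    rw [← h1, nexp, Matrix.sum_apply]
    refine Finset.sum_congr rfl fun k _ => ?_
    rw [← hBk]
    simp [B]

end OneParameter

/-! ### Lifting the projective action to operators -/

section Linearization

variable {K : Type*} [Field K] {V : Type*} [AddCommGroup V] [Module K V]

/-- Linear automorphisms inducing the same map of projective spaces are proportional. -/
lemma exists_smul_of_projective_eq {S T : V →ₗ[K] V} (hS : Function.Bijective S)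
    (h : ∀ v, v ≠ 0 → ∃ c : K, T v = c • S v) : ∃ c : K, T = c • S := by
  let e := LinearEquiv.ofBijective S hS
  -- Every nonzero vector is an eigenvector of `S⁻¹ ∘ T`, which forces a scalar operator.
  have hf : ∀ v, ¬ LinearIndependent K ![v, (e.symm.toLinearMap ∘ₗ T) v] := by
    intro v hv
    have hv0 : v ≠ 0 := by simpa using hv.ne_zero 0
    obtain ⟨c, hc⟩ := h v hv0
    have h1 : (e.symm.toLinearMap ∘ₗ T) v = c • v := by
      rw [LinearMap.comp_apply, hc]
      exact e.symm_apply_eq.mpr (by simp [e])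
    rw [h1] at hv
    rw [LinearIndependent.pair_iff] at hv
    simpa using (hv c (-1) (by simp)).2
  obtain ⟨a, ha⟩ := LinearMap.exists_eq_smul_id_of_forall_notLinearIndependent hf
  refine ⟨a, LinearMap.ext fun v => ?_⟩
  have := congrArg e (LinearMap.congr_fun ha v)
  simpa [e] using this

/-- An algebraic action of a vector group on a projective space of positive dimension is induced by
the exponential of a linear family of commuting nilpotent operators. -/
theorem exists_nilpotent_family [IsAlgClosed K] [CharZero K] [FiniteDimensional K V] {n : ℕ}
    {φ : (Fin n → K) → ℙ K V → ℙ K V} (hφ : IsMorphism n φ) (h0 : ∀ x, φ 0 x = x)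
    (hadd : ∀ s t x, φ (s + t) x = φ s (φ t x)) (hV : 1 < Module.finrank K V) :
    ∃ N : (Fin n → K) →ₗ[K] Module.End K V, (∀ t, IsNilpotent (N t)) ∧
      (∀ s t, Commute (N s) (N t)) ∧ ∀ t D, N t ^ D = 0 → ∀ v (hv : v ≠ 0),
        ∃ h : nexp K D (N t) v ≠ 0,
          φ t (Projectivization.mk K v hv) = Projectivization.mk K (nexp K D (N t) v) h := by
  classical
  let b := Module.finBasis K V
  have : Nontrivial (Fin (Module.finrank K V)) := Fin.nontrivial_iff_two_le.mpr hV
  obtain ⟨M, hMp, hM⟩ := hφ.exists_linear b h0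
  have hinj : ∀ t, Function.Bijective (Matrix.toLin b b (M t)) := by
    intro t
    have : Function.Injective (Matrix.toLin b b (M t)) := by
      rw [← LinearMap.ker_eq_bot, LinearMap.ker_eq_bot']
      intro v hv
      by_contra hv0
      exact (hM t v hv0).1 hv
    exact ⟨this, LinearMap.injective_iff_surjective.mp this⟩
  have hdet : ∀ t, (M t).det ≠ 0 := by
    intro t
    rw [← LinearMap.det_toLin b]
    exact (LinearEquiv.isUnit_det' (LinearEquiv.ofBijective _ (hinj t))).ne_zero
  obtain ⟨c, hc⟩ : ∃ c : K, Matrix.toLin b b (M 0) = c • LinearMap.id := by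
    refine exists_smul_of_projective_eq Function.bijective_id fun v hv => ?_
    obtain ⟨h1, h2⟩ := hM 0 v hv
    rw [h0, eq_comm, Projectivization.mk_eq_mk_iff'] at h2
    obtain ⟨a, ha⟩ := h2
    exact ⟨a, ha.symm⟩
  have hc0 : c ≠ 0 := by
    rintro rfl
    obtain ⟨h1, -⟩ := hM 0 (b ⟨0, by omega⟩) (b.ne_zero _)
    exact h1 (by simp [hc])
  have hM0 : M 0 = c • 1 := by
    apply (Matrix.toLin b b).injective
    rw [hc, map_smul, Matrix.toLin_one]
  have hMadd : ∀ s t, ∃ a : K, M (s + t) = a • (M s * M t) := by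
    intro s t
    obtain ⟨a, ha⟩ : ∃ a : K, Matrix.toLin b b (M (s + t)) =
        a • (Matrix.toLin b b (M s) ∘ₗ Matrix.toLin b b (M t)) := by
      refine exists_smul_of_projective_eq ((hinj s).comp (hinj t)) fun v hv => ?_
      obtain ⟨h1, h2⟩ := hM (s + t) v hv
      obtain ⟨h3, h4⟩ := hM t v hv
      obtain ⟨h5, h6⟩ := hM s _ h3
      rw [hadd, h4, h6, eq_comm, Projectivization.mk_eq_mk_iff'] at h2
      obtain ⟨a, ha⟩ := h2
      exact ⟨a, ha.symm⟩
    refine ⟨a, (Matrix.toLin b b).injective ?_⟩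
    rw [ha, map_smul, Matrix.toLin_mul b b b]
  -- The lift is determined only up to scalars; dividing by the scalar of `M 0` normalises it to one
  -- at the origin.
  let M' : (Fin n → K) → Matrix _ _ K := fun t => c⁻¹ • M t
  have hP : ∀ t, ∃ P : Matrix (Fin (Module.finrank K V)) (Fin (Module.finrank K V)) (Polynomial K),
      ∀ r, P.map (Polynomial.eval r) = M' (r • t) := by
    intro t
    choose P hP using fun i j => hMp (fun r => r • t) (fun k => by
      simpa using IsPolyFun.id.mul (IsPolyFun.const (t k))) i j
    refine ⟨Matrix.of fun i j => Polynomial.C c⁻¹ * P i j, fun r => ?_⟩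
    ext i j
    simp [M', hP]
  choose P hP using hP
  have hM'0 : M' 0 = 1 := by
    simp only [M', hM0, smul_smul]
    rw [inv_mul_cancel₀ hc0, one_smul]
  have hM'det : ∀ t, (M' t).det ≠ 0 := by
    intro t
    simp only [M', Matrix.det_smul]
    exact mul_ne_zero (pow_ne_zero _ (inv_ne_zero hc0)) (hdet t)
  have hM'add : ∀ s t, ∃ a : K, M' (s + t) = a • (M' s * M' t) := by
    intro s t
    obtain ⟨a, ha⟩ := hMadd s t
    refine ⟨a * c, ?_⟩
    simp only [M', ha, smul_mul_smul_comm, smul_smul]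
    congr 1
    field_simp
  obtain ⟨N, hN, hNc, hNe⟩ :=
    exists_log_of_hom hP hM'0 (map_add_of_projective hP hM'0 hM'det hM'add)
  have hpow : ∀ t k, Matrix.toLin b b (N t ^ k) = Matrix.toLin b b (N t) ^ k := fun t k =>
    map_pow (Matrix.toLinAlgEquiv b) (N t) k
  refine ⟨(Matrix.toLin b b).toLinearMap ∘ₗ N, fun t => ?_, fun s t => ?_, fun t D hD v hv => ?_⟩
  · obtain ⟨k, hk⟩ := hN t
    exact ⟨k, by simp only [LinearMap.comp_apply, LinearEquiv.coe_coe, ← hpow, hk, map_zero]⟩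
  · exact (hNc s t).map (Matrix.toLinAlgEquiv b)
  · have hD' : N t ^ D = 0 := by
      apply (Matrix.toLin b b).injective
      rw [hpow, map_zero]
      exact hD
    have h1 : nexp K D (((Matrix.toLin b b).toLinearMap ∘ₗ N) t) = c⁻¹ • Matrix.toLin b b (M t) := by
      rw [← map_smul]
      change _ = Matrix.toLin b b (M' t)
      rw [hNe t D hD', nexp, nexp, map_sum]
      refine Finset.sum_congr rfl fun k _ => ?_
      rw [map_smul, hpow]
      rfl
    obtain ⟨h2, h3⟩ := hM t v hv
    rw [h1]
    refine ⟨smul_ne_zero (inv_ne_zero hc0) h2, ?_⟩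
    rw [h3, Projectivization.mk_eq_mk_iff']
    exact ⟨c, by rw [LinearMap.smul_apply, smul_smul, mul_inv_cancel₀ hc0, one_smul]⟩

end Linearization

/-! ### Truncated exponential and logarithm -/

section Exp

variable {K : Type*} [Field K] {A : Type*} [CommRing A] [Algebra K A]

/-- The logarithmic series of `1 + z`, truncated after degree `D`. -/
noncomputable def nlog (K : Type*) [Field K] {A : Type*} [Ring A] [Algebra K A] (D : ℕ) (z : A) : A :=
  ∑ i ∈ Finset.range D, ((-1) ^ i * ((i : K) + 1)⁻¹) • z ^ (i + 1)

lemma nexp_zero {D : ℕ} (hD : D ≠ 0) : nexp K D (0 : A) = 1 := by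
  obtain ⟨D, rfl⟩ := Nat.exists_eq_succ_of_ne_zero hD
  simp [nexp, Finset.sum_range_succ']

lemma nexp_add [CharZero K] {D : ℕ} {a b : A} (ha : a ^ D = 0) (hb : b ^ D = 0)
    (hab : (a + b) ^ D = 0) : nexp K D (a + b) = nexp K D a * nexp K D b := by
  let _ : Module ℚ A := Module.compHom A (algebraMap ℚ K)
  have h : ∀ a : A, a ^ D = 0 → nexp K D a = IsNilpotent.exp a := by
    intro a ha
    rw [IsNilpotent.exp_eq_sum ha, nexp]
    refine Finset.sum_congr rfl fun i _ => ?_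
    change _ = algebraMap ℚ K _ • a ^ i
    simp
  rw [h a ha, h b hb, h _ hab]
  exact IsNilpotent.exp_add_of_commute (Commute.all a b) ⟨D, ha⟩ ⟨D, hb⟩

/-- The cofactor of `a` is one plus a multiple of a nilpotent. Consequently `exp a` and `a` see the
same kernel: `exp a` fixes a vector exactly when `a` kills it. -/
lemma nexp_sub_one [CharZero K] {D : ℕ} {a : A} (ha : a ^ D = 0) :
    ∃ s : A, IsUnit s ∧ nexp K D a - 1 = a * s := by
  rcases D with _ | _ | D
  · have : (1 : A) = 0 := by simpa using ha
    have hA : Subsingleton A := subsingleton_of_zero_eq_one this.symm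
    exact ⟨1, isUnit_one, Subsingleton.elim _ _⟩
  · have : a = 0 := by simpa using ha
    exact ⟨1, isUnit_one, by simp [nexp, this]⟩
  · refine ⟨1 + a * ∑ i ∈ Finset.range D, ((i + 2).factorial : K)⁻¹ • a ^ i,
      IsNilpotent.isUnit_one_add ((Commute.all _ _).isNilpotent_mul_right ⟨_, ha⟩), ?_⟩
    rw [nexp, Finset.sum_range_succ', Finset.sum_range_succ', Finset.mul_sum, mul_add,
      Finset.mul_sum]
    simp only [Nat.factorial_zero, Nat.factorial_one, zero_add, Nat.cast_one, inv_one, one_smul,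
      pow_zero, pow_one, mul_one, add_sub_cancel_right]
    rw [add_comm]
    congr 1
    refine Finset.sum_congr rfl fun i _ => ?_
    rw [mul_smul_comm, mul_smul_comm]
    congr 1
    ring

lemma nexp_injective [CharZero K] {D : ℕ} {a b : A} (ha : a ^ D = 0) (hb : b ^ D = 0)
    (hb' : (-b) ^ D = 0) (hab : (a - b) ^ D = 0) (h : nexp K D a = nexp K D b) : a = b := by
  rcases Nat.eq_zero_or_pos D with rfl | hD
  · have : (1 : A) = 0 := by simpa using ha
    have hA : Subsingleton A := subsingleton_of_zero_eq_one this.symm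
    exact Subsingleton.elim _ _
  have h1 : nexp K D (a - b) = nexp K D a * nexp K D (-b) := by
    rw [sub_eq_add_neg] at hab ⊢
    exact nexp_add ha hb' hab
  have h2 : nexp K D b * nexp K D (-b) = 1 := by
    rw [← nexp_add hb hb' (by simp [hD.ne']), add_neg_cancel, nexp_zero hD.ne']
  obtain ⟨s, hs, hs'⟩ := nexp_sub_one (K := K) hab
  rw [h1, h, h2, sub_self, eq_comm, hs.mul_left_eq_zero] at hs'
  exact sub_eq_zero.mp hs'

open Polynomial in
/-- The truncated exponential of the truncated logarithm. -/
lemma nexp_nlog [CharZero K] {D : ℕ} {z : A} (hz : z ^ D = 0) : nexp K D (nlog K D z) = 1 + z := by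
  rcases Nat.eq_zero_or_pos D with rfl | hD
  · have : (1 : A) = 0 := by simpa using hz
    have hA : Subsingleton A := subsingleton_of_zero_eq_one this.symm
    exact Subsingleton.elim _ _
  have hK : ∀ i : ℕ, ((i : K) + 1) ≠ 0 := fun i => by exact_mod_cast Nat.succ_ne_zero i
  have hsm : ∀ (i : ℕ) (y : A), ((i : A) + 1) * y = ((i : K) + 1) • y := by
    intro i y
    rw [Algebra.smul_def, map_add, map_natCast, map_one]
  -- `L` is `log (1 + z X)` with a formal parameter, and `E` below is `exp L`. The equation `(1 + z
  -- X) E' = z E` with `E(0) = 1` determines the coefficients recursively in characteristic zero, so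
  -- `E = 1 + z X`; then put `X = 1`.
  let L : A[X] := ∑ i ∈ Finset.range D, monomial (i + 1) (((-1) ^ i * ((i : K) + 1)⁻¹) • z ^ (i + 1))
  have hLz : ∃ L' : A[X], L = C z * L' := by
    refine ⟨∑ i ∈ Finset.range D, monomial (i + 1) (((-1) ^ i * ((i : K) + 1)⁻¹) • z ^ i), ?_⟩
    rw [Finset.mul_sum]
    refine Finset.sum_congr rfl fun i _ => ?_
    rw [C_mul_monomial, mul_smul_comm, pow_succ']
  obtain ⟨L', hL'⟩ := hLz
  have hLD : L ^ D = 0 := by rw [hL', mul_pow, ← C_pow, hz, C_0, zero_mul]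
  -- `L` is divisible by `z`, so this product contains `z ^ D`. It is the one term by which
  -- truncation could spoil the differential equation.
  have hLzD : L ^ (D - 1) * C z = 0 := by
    rw [hL', mul_pow, mul_right_comm, ← C_pow, ← C_mul, ← pow_succ, Nat.sub_add_cancel hD, hz, C_0,
      zero_mul]
  have hdL : (1 + C z * X) * derivative L = C z := by
    have h1 : derivative L = C z * ∑ i ∈ Finset.range D, (-(C z * X)) ^ i := by
      simp only [L, derivative_sum, derivative_monomial]
      rw [Finset.mul_sum]
      refine Finset.sum_congr rfl fun i _ => ?_
      rw [neg_pow (C z * X), mul_pow (C z), ← C_pow, add_tsub_cancel_right]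
      have h2 : (((-1) ^ i * ((i : K) + 1)⁻¹) • z ^ (i + 1) * ((i + 1 : ℕ) : A)) =
          (-1) ^ i * z ^ (i + 1) := by
        rw [mul_comm]
        push_cast
        rw [hsm, smul_smul, mul_left_comm, mul_inv_cancel₀ (hK i), mul_one, Algebra.smul_def]
        simp
      rw [h2, ← C_mul_X_pow_eq_monomial]
      simp only [map_mul, map_pow, map_neg, map_one]
      ring
    have h2 : (1 + C z * X) * ∑ i ∈ Finset.range D, (-(C z * X)) ^ i = 1 := by
      have := mul_neg_geom_sum (-(C z * X)) D
      rw [sub_neg_eq_add] at this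
      rw [this, neg_pow, mul_pow, ← C_pow, hz]
      simp
    rw [h1, mul_left_comm, h2, mul_one]
  let E : A[X] := ∑ i ∈ Finset.range D, (i.factorial : K)⁻¹ • L ^ i
  have hdE : (1 + C z * X) * derivative E = C z * E := by
    have h1 : derivative E =
        ∑ i ∈ Finset.range (D - 1), (i.factorial : K)⁻¹ • (L ^ i * derivative L) := by
      simp only [E, derivative_sum]
      conv_lhs => rw [← Nat.sub_add_cancel hD]
      rw [Finset.sum_range_succ']
      simp only [pow_zero, derivative_smul, derivative_one, smul_zero, add_zero]
      refine Finset.sum_congr rfl fun i _ => ?_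
      rw [derivative_pow_succ, Nat.factorial_succ]
      have : (C ((i : A) + 1) : A[X]) = algebraMap K A[X] ((i : K) + 1) := by
        simp
      rw [this, mul_assoc, ← Algebra.smul_def, smul_smul]
      push_cast
      rw [mul_inv, mul_comm ((i : K) + 1)⁻¹, mul_assoc, inv_mul_cancel₀ (hK i), mul_one]
    have h2 : C z * E = ∑ i ∈ Finset.range (D - 1), (i.factorial : K)⁻¹ • (L ^ i * C z) := by
      simp only [E]
      conv_lhs => rw [← Nat.sub_add_cancel hD]
      rw [Finset.sum_range_succ, mul_add, mul_smul_comm, mul_comm (C z) (L ^ (D - 1)), hLzD,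
        smul_zero, add_zero, Finset.mul_sum]
      refine Finset.sum_congr rfl fun i _ => ?_
      rw [mul_smul_comm, mul_comm (C z)]
    rw [h1, h2, Finset.mul_sum]
    refine Finset.sum_congr rfl fun i _ => ?_
    rw [mul_smul_comm, mul_left_comm, hdL]
  have hE0 : E.coeff 0 = 1 := by
    have hL0 : L.coeff 0 = 0 := by
      simp [L, coeff_monomial]
    rw [coeff_zero_eq_eval_zero] at hL0 ⊢
    simp only [E, eval_finsetSum, eval_smul, eval_pow, hL0]
    obtain ⟨D, rfl⟩ := Nat.exists_eq_succ_of_ne_zero hD.ne'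
    simp [Finset.sum_range_succ']
  have hcancel : ∀ (k : ℕ) (x y : A), ((k : A) + 1) * x = ((k : A) + 1) * y → x = y := by
    intro k x y h
    rw [hsm, hsm] at h
    have := congrArg (fun t => ((k : K) + 1)⁻¹ • t) h
    simpa [smul_smul, inv_mul_cancel₀ (hK k)] using this
  have hrec : ∀ k : ℕ, ((k : A) + 1) * E.coeff (k + 1) = (1 - (k : A)) * (z * E.coeff k) := by
    intro k
    have h1 := congrArg (fun p => p.coeff k) hdE
    simp only [add_mul, one_mul, coeff_add, coeff_C_mul, coeff_derivative, mul_assoc] at h1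
    rcases k with _ | k
    · simp only [coeff_X_mul_zero] at h1
      simp only [zero_add, Nat.cast_zero] at h1 ⊢
      linear_combination h1
    · rw [coeff_X_mul, coeff_derivative] at h1
      push_cast at h1 ⊢
      linear_combination h1
  have hE1 : E.coeff 1 = z := by
    have := hrec 0
    rw [hE0] at this
    simpa using this
  have hE2 : ∀ k, E.coeff (k + 2) = 0 := by
    intro k
    induction k with
    | zero => exact hcancel 1 _ _ (by rw [hrec 1]; simp)
    | succ k ih => exact hcancel (k + 2) _ _ (by
        have := hrec (k + 2)
        rw [ih] at this
        push_cast at this ⊢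
        rw [this]
        simp)
  have hE : E = 1 + C z * X := by
    ext k
    rcases k with _ | _ | k
    · simp [hE0]
    · simp [hE1, coeff_one]
    · simp [hE2, coeff_one]
  have h1 : E.eval 1 = nexp K D (nlog K D z) := by
    simp only [E, L, eval_finsetSum, eval_smul, eval_pow, nexp, nlog, eval_monomial, one_pow, mul_one]
  rw [← h1, hE]
  simp

end Exp

/-! ### Irreducible quadrics -/

section Quadric

variable {K : Type*} [Field K] {V : Type*} [AddCommGroup V] [Module K V]

lemma IsHomFun.sum {ι : Type*} (s : Finset ι) {d : ℕ} {f : ι → V → K}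
    (hf : ∀ i ∈ s, IsHomFun d (f i)) : IsHomFun d (fun v => ∑ i ∈ s, f i v) := IsWPoly.sum s hf

lemma isHomFun_quadraticForm [CharZero K] [FiniteDimensional K V] (q : QuadraticForm K V) :
    IsHomFun 2 q := by
  let b := Module.finBasis K V
  have h : (q : V → K) = fun v => ∑ i, b.coord i v * (QuadraticMap.associated (R := K) q (b i)) v := by
    funext v
    calc q v = QuadraticMap.associated (R := K) q v v :=
          (QuadraticMap.associated_eq_self_apply K q v).symm
      _ = QuadraticMap.associated (R := K) q (∑ i, b.repr v i • b i) v := by rw [b.sum_repr v]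
      _ = _ := by
        rw [map_sum, LinearMap.sum_apply]
        simp
  rw [h]
  exact IsHomFun.sum _ fun i _ => (IsHomFun.dual (b.coord i)).mul (IsHomFun.dual _)

lemma mem_quadric_mk (q : QuadraticForm K V) {v : V} (hv : v ≠ 0) :
    Projectivization.mk K v hv ∈ quadric q ↔ q v = 0 := by
  obtain ⟨a, ha⟩ := Projectivization.exists_smul_eq_mk_rep K v hv
  rw [quadric, Set.mem_ofPred_eq, ← ha, Units.smul_def, QuadraticMap.map_smul]
  simp

lemma isClosed_quadric [CharZero K] [FiniteDimensional K V] (q : QuadraticForm K V) :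
    IsClosed (quadric q) :=
  (isHomFun_quadraticForm q).isClosed

/-- A quadratic form that vanishes on a hyperplane is reducible. -/
lemma not_isIrreducibleForm_of_vanish {q : QuadraticForm K V} {f : Module.Dual K V} (hf : f ≠ 0)
    (h : ∀ v, f v = 0 → q v = 0) : ¬ IsIrreducibleForm q := by
  obtain ⟨e', he'⟩ : ∃ e, f e ≠ 0 := by
    by_contra! hcon
    exact hf (LinearMap.ext hcon)
  -- Write `v = f v • e + w` with `f w = 0`. Expanding `q`, the term `q w` drops out and the rest is
  -- divisible by `f v`.
  obtain ⟨e, he⟩ : ∃ e, f e = 1 := ⟨(f e')⁻¹ • e', by simp [he']⟩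
  refine fun hq => hq ⟨f, q e • f + (q.polarBilin e) ∘ₗ (LinearMap.id - f.smulRight e), fun v => ?_⟩
  have hw : q (v - f v • e) = 0 := h _ (by simp [he])
  have hv : v = f v • e + (v - f v • e) := by abel
  conv_lhs => rw [hv, QuadraticMap.map_add q, hw, QuadraticMap.polar_smul_left,
    QuadraticMap.map_smul]
  simp only [LinearMap.add_apply, LinearMap.smul_apply, LinearMap.comp_apply, LinearMap.sub_apply,
    LinearMap.id_apply, LinearMap.smulRight_apply, QuadraticMap.polarBilin_apply_apply, smul_eq_mul]
  ring

/-- An irreducible quadric is not contained in a hyperplane. -/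
lemma exists_mem_quadric_ne [IsAlgClosed K] [CharZero K] {q : QuadraticForm K V}
    (hq : IsIrreducibleForm q) {f : Module.Dual K V} (hf : f ≠ 0) : ∃ v, q v = 0 ∧ f v ≠ 0 := by
  by_contra! hcon
  obtain ⟨e, he⟩ : ∃ e, f e ≠ 0 := by
    by_contra! hcon
    exact hf (LinearMap.ext hcon)
  refine not_isIrreducibleForm_of_vanish hf (fun w hw => ?_) hq
  -- If every zero of `q` lay in the hyperplane, `q` would have no zero on the line `e + s • w`,
  -- hence be constant there, and its quadratic coefficient `q w` would vanish.
  have hpoly : ∀ s : K, q (e + s • w) = q e + s * QuadraticMap.polar q e w + s ^ 2 * q w := by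
    intro s
    rw [QuadraticMap.map_add q, QuadraticMap.map_smul, QuadraticMap.polar_smul_right]
    simp only [smul_eq_mul]
    ring
  have hP : IsPolyFun fun s : K => q (e + s • w) := by
    simp only [hpoly]
    exact ((IsPolyFun.const _).add (IsPolyFun.id.mul (IsPolyFun.const _))).add
      ((IsPolyFun.id.pow 2).mul (IsPolyFun.const _))
  have hconst := hP.eq_of_forall_ne_zero fun s hs => by
    have := hcon _ hs
    simp [hw, he] at this
  have h1 := hconst 1 0
  have h2 := hconst (-1) 0
  simp only [hpoly] at h1 h2
  have : (2 : K) * q w = 0 := by linear_combination h1 + h2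
  simpa using this

lemma exists_dual_ne_and {f g : Module.Dual K V} (hf : f ≠ 0) (hg : g ≠ 0) :
    ∃ v, f v ≠ 0 ∧ g v ≠ 0 := by
  by_contra! hcon
  obtain ⟨x, hx⟩ : ∃ x, f x ≠ 0 := by
    by_contra! hcon
    exact hf (LinearMap.ext hcon)
  refine hg (LinearMap.ext fun y => ?_)
  by_cases hy : f y = 0
  · have := hcon (x + y) (by simpa [hy] using hx)
    simpa [hcon x hx] using this
  · exact hcon y hy

/-- The complement of a hyperplane is dense in an irreducible quadric. -/
lemma quadric_subset_closure [IsAlgClosed K] [CharZero K] [FiniteDimensional K V]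
    {q : QuadraticForm K V} (hq : IsIrreducibleForm q) {f : Module.Dual K V} (hf : f ≠ 0)
    {S : Set (ℙ K V)}
    (hS : ∀ v (hv : v ≠ 0), q v = 0 → f v ≠ 0 → Projectivization.mk K v hv ∈ S) :
    quadric q ⊆ closure S := by
  have : Infinite K := IsAlgClosed.instInfinite
  intro x
  induction x using Projectivization.ind with | h z hz => ?_
  rw [mem_quadric_mk]
  intro hqz
  by_cases hfz : f z ≠ 0
  · exact subset_closure (hS z hz hqz hfz)
  rw [not_not] at hfz
  by_cases hB : q.polarBilin z = 0
  · obtain ⟨v, hqv, hfv⟩ := exists_mem_quadric_ne hq hf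
    have hcl := mk_mem_closure_of_curve (S := S) (IsPolyCurve.line z v) (g := fun r => f (z + r • v))
      (IsPolyCurve.line z v f) (r₀ := 1) (r₁ := 0) (by simpa [hfz] using hfv)
      (fun r hr hr' => hS _ hr' (by
        rw [QuadraticMap.map_add q, hqz, QuadraticMap.map_smul, hqv, QuadraticMap.polar_smul_right,
          ← QuadraticMap.polarBilin_apply_apply, hB]
        simp) hr) (by simpa using hz)
    simpa using hcl
  · obtain ⟨v₂, hv₂, hv₂'⟩ := exists_dual_ne_and hB hf
    obtain ⟨v₁, hv₁, hv₁'⟩ : ∃ v₁, q.polarBilin z v₁ = 0 ∧ q v₁ ≠ 0 := by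
      by_contra! hcon
      exact not_isIrreducibleForm_of_vanish hB hcon hq
    -- `γ r` lies where the line through `z` and `v₁ + r • v₂` meets the quadric again. Since `v₁`
    -- is tangent at `z` and `q v₁ ≠ 0`, it returns to `z` at `r = 0`; for general `r` it leaves the
    -- hyperplane.
    let γ : K → V := fun r =>
      q (v₁ + r • v₂) • z + (-(q.polarBilin z (v₁ + r • v₂))) • (v₁ + r • v₂)
    have hline : IsPolyCurve fun r : K => v₁ + r • v₂ := IsPolyCurve.line v₁ v₂
    have hqp : IsPolyFun fun r => q (v₁ + r • v₂) := (isHomFun_quadraticForm q).comp_curve hline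
    have hBp : IsPolyFun fun r => q.polarBilin z (v₁ + r • v₂) := hline _
    have hγ : IsPolyCurve γ := by
      intro ξ
      simp only [γ, map_add ξ, map_smul ξ, smul_eq_mul]
      refine (hqp.mul (IsPolyFun.const _)).add (IsPolyFun.mul ?_ ?_)
      · simpa using (IsPolyFun.const (0 : K)).sub hBp
      · simpa using hline ξ
    obtain ⟨r₁, hr₁⟩ : ∃ r : K, f (v₁ + r • v₂) ≠ 0 := by
      by_cases h : f v₁ = 0
      · exact ⟨1, by simpa [h] using hv₂'⟩
      · exact ⟨0, by simpa using h⟩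
    obtain ⟨r₀, hr₀, hr₀'⟩ := hBp.exists_ne_zero_and (hline f)
      (r₀ := 1) (by rw [map_add, hv₁, one_smul, zero_add]; exact hv₂) hr₁
    have hγ0 : γ 0 = q v₁ • z := by
      simp only [γ, zero_smul, add_zero, hv₁]
      simp
    have hγq : ∀ r, q (γ r) = 0 := by
      intro r
      simp only [γ]
      rw [QuadraticMap.map_add q, QuadraticMap.map_smul, QuadraticMap.map_smul, hqz,
        QuadraticMap.polar_smul_left, QuadraticMap.polar_smul_right,
        QuadraticMap.polarBilin_apply_apply]
      simp only [smul_eq_mul]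
      ring
    have hz0 : γ 0 ≠ 0 := by
      rw [hγ0]
      exact smul_ne_zero hv₁' hz
    have hcl := mk_mem_closure_of_curve (S := S) hγ (hγ f) (r₀ := r₀) (r₁ := 0) (by
        have : f (γ r₀) = -(q.polarBilin z (v₁ + r₀ • v₂)) * f (v₁ + r₀ • v₂) := by
          simp only [γ, map_add f, map_smul f, hfz, mul_zero, zero_add, smul_eq_mul]
        rw [this]
        exact mul_ne_zero (neg_ne_zero.mpr hr₀) hr₀')
      (fun r hr hr' => hS _ hr' (hγq r) hr) hz0
    have : Projectivization.mk K (γ 0) hz0 = Projectivization.mk K z hz := by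
      rw [Projectivization.mk_eq_mk_iff']
      exact ⟨q v₁, hγ0.symm⟩
    rwa [← this]

end Quadric

/-! ### Orbits of exponentials in a local algebra -/

section Orbit

variable {K : Type*} [Field K] {A : Type*} [CommRing A] [Algebra K A] {ε : A →ₐ[K] K} {D : ℕ}

lemma trunc_ne_zero (hD : ∀ a, ε a = 0 → a ^ D = 0) : D ≠ 0 := by
  rintro rfl
  have := congrArg ε (hD 0 (map_zero ε))
  simp at this

lemma augmentation_nexp (hD : ∀ a, ε a = 0 → a ^ D = 0) {a : A} (ha : ε a = 0) :
    ε (nexp K D a) = 1 := by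
  obtain ⟨D, rfl⟩ := Nat.exists_eq_succ_of_ne_zero (trunc_ne_zero hD)
  simp [nexp, Finset.sum_range_succ', ha]

lemma augmentation_nlog {z : A} (hz : ε z = 0) : ε (nlog K D z) = 0 := by
  simp [nlog, hz]

variable (ε) (D) in
/-- The logarithm of an element of a local algebra with nonzero augmentation, scaled to have
augmentation one. -/
noncomputable def dlog (a : A) : A := nlog K D ((ε a)⁻¹ • a - 1)

lemma augmentation_dlog {a : A} (ha : ε a ≠ 0) : ε (dlog ε D a) = 0 :=
  augmentation_nlog (by simp [ha])

lemma nexp_dlog [CharZero K] (hD : ∀ a, ε a = 0 → a ^ D = 0) {a : A} (ha : ε a ≠ 0) :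
    ε a • nexp K D (dlog ε D a) = a := by
  rw [dlog, nexp_nlog (hD _ (by simp [ha])), add_sub_cancel, smul_smul, mul_inv_cancel₀ ha, one_smul]

lemma nexp_add' [CharZero K] (hD : ∀ a, ε a = 0 → a ^ D = 0) {a b : A} (ha : ε a = 0)
    (hb : ε b = 0) : nexp K D (a + b) = nexp K D a * nexp K D b :=
  nexp_add (hD a ha) (hD b hb) (hD _ (by simp [ha, hb]))

lemma nexp_injective' [CharZero K] (hD : ∀ a, ε a = 0 → a ^ D = 0) {a b : A} (ha : ε a = 0)
    (hb : ε b = 0) (h : nexp K D a = nexp K D b) : a = b :=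
  nexp_injective (hD a ha) (hD b hb) (hD _ (by simp [hb])) (hD _ (by simp [ha, hb])) h

lemma dlog_smul_nexp [CharZero K] (hD : ∀ a, ε a = 0 → a ^ D = 0) {c : K} (hc : c ≠ 0) {w : A}
    (hw : ε w = 0) : dlog ε D (c • nexp K D w) = w := by
  have hε : ε (c • nexp K D w) = c := by simp [augmentation_nexp hD hw]
  refine nexp_injective' hD (augmentation_dlog (by rwa [hε])) hw ?_
  have := nexp_dlog hD (a := c • nexp K D w) (by rwa [hε])
  rw [hε] at this
  exact smul_right_injective A hc this

variable {V : Type*} [AddCommGroup V] [Module K V]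

/-- The points `[θ (exp w)]` for `w ∈ W`. -/
def expOrbit (θ : A ≃ₗ[K] V) (D : ℕ) (W : Set A) : Set (ℙ K V) :=
  {x | ∃ w ∈ W, ∃ h, x = Projectivization.mk K (θ (nexp K D w)) h}

lemma nexp_ne_zero (hD : ∀ a, ε a = 0 → a ^ D = 0) {w : A} (hw : ε w = 0) : nexp K D w ≠ 0 := by
  intro h
  have := augmentation_nexp hD hw
  simp [h] at this

lemma map_nexp_ne_zero (hD : ∀ a, ε a = 0 → a ^ D = 0) (θ : A ≃ₗ[K] V) {w : A} (hw : ε w = 0) :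
    θ (nexp K D w) ≠ 0 := by
  simpa using nexp_ne_zero hD hw

/-- An element of nonzero augmentation is `c • exp w` for a unique scalar `c` and a unique `w` of
augmentation zero. The logarithm therefore makes the orbit linear in the chart `ε ≠ 0`. -/
lemma mk_mem_expOrbit [CharZero K] (hD : ∀ a, ε a = 0 → a ^ D = 0) {θ : A ≃ₗ[K] V} {W : Set A}
    (hW : ∀ w ∈ W, ε w = 0) {a : A} (ha : θ a ≠ 0) :
    Projectivization.mk K (θ a) ha ∈ expOrbit θ D W ↔ ε a ≠ 0 ∧ dlog ε D a ∈ W := by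
  constructor
  · rintro ⟨w, hw, hw', h⟩
    rw [Projectivization.mk_eq_mk_iff'] at h
    obtain ⟨c, hc⟩ := h
    have hac : a = c • nexp K D w := θ.injective (by rw [← hc, map_smul])
    have hc0 : c ≠ 0 := by
      rintro rfl
      simp [hac] at ha
    rw [hac, dlog_smul_nexp hD hc0 (hW w hw)]
    refine ⟨?_, hw⟩
    simpa [augmentation_nexp hD (hW w hw)] using hc0
  · rintro ⟨h1, h2⟩
    refine ⟨_, h2, map_nexp_ne_zero hD θ (hW _ h2), ?_⟩
    rw [Projectivization.mk_eq_mk_iff']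
    exact ⟨ε a, by rw [← map_smul, nexp_dlog hD h1]⟩

lemma isHomFun_pow_comp [FiniteDimensional K V] (T : V →ₗ[K] A) (k : ℕ) (ξ : Module.Dual K A) :
    IsHomFun k (fun v => ξ (T v ^ k)) := by
  induction k generalizing ξ with
  | zero => simpa using IsHomFun.const (V := V) (ξ 1)
  | succ k ih =>
    let b := Module.finBasis K V
    have h : (fun v => ξ (T v ^ (k + 1))) =
        fun v => ∑ i, (ξ ∘ₗ LinearMap.mulLeft K (T (b i))) (T v ^ k) * b.coord i v := by
      funext v
      rw [pow_succ']
      conv_lhs => enter [2, 1]; rw [← b.sum_repr v]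
      simp only [map_sum, map_smul, Finset.sum_mul, smul_mul_assoc, smul_eq_mul,
        LinearMap.comp_apply, LinearMap.mulLeft_apply, b.coord_apply]
      exact Finset.sum_congr rfl fun i _ => mul_comm _ _
    rw [h]
    exact IsHomFun.sum _ fun i _ => (ih _).mul (IsHomFun.dual _)

lemma IsHomFun.const_mul {d : ℕ} {f : V → K} (hf : IsHomFun d f) (a : K) :
    IsHomFun d (fun v => a * f v) := IsWPoly.const_mul a hf

lemma IsHomFun.pow {d : ℕ} {f : V → K} (hf : IsHomFun d f) (k : ℕ) :
    IsHomFun (k * d) (fun v => f v ^ k) := IsWPoly.pow hf k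

/-- Linear forms of the logarithm become homogeneous polynomials after multiplication by a power of
the augmentation. -/
lemma exists_homFun_dlog [FiniteDimensional K V] (θ : A ≃ₗ[K] V) (ξ : Module.Dual K A) :
    ∃ f : V → K, IsHomFun D f ∧ ∀ a, ε a ≠ 0 → f (θ a) = ε a ^ D * ξ (dlog ε D a) := by
  let T : V →ₗ[K] A := (LinearMap.id - ε.toLinearMap.smulRight (1 : A)) ∘ₗ θ.symm.toLinearMap
  let e : Module.Dual K V := ε.toLinearMap ∘ₗ θ.symm.toLinearMap
  -- The term of degree `i + 1` of the logarithm is multiplied by `ε ^ (D - 1 - i)`, which brings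
  -- every term to degree `D`.
  refine ⟨fun v => ∑ i ∈ Finset.range D,
    ((-1) ^ i * ((i : K) + 1)⁻¹) * (e v ^ (D - 1 - i) * ξ (T v ^ (i + 1))), ?_, fun a ha => ?_⟩
  · refine IsHomFun.sum _ fun i hi => IsHomFun.const_mul ?_ _
    have := ((IsHomFun.dual e).pow (D - 1 - i)).mul (isHomFun_pow_comp T (i + 1) ξ)
    have hi := Finset.mem_range.mp hi
    rwa [show (D - 1 - i) * 1 + (i + 1) = D by omega] at this
  · simp only [dlog, nlog, map_sum, map_smul, smul_eq_mul, Finset.mul_sum]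
    refine Finset.sum_congr rfl fun i hi => ?_
    have hi := Finset.mem_range.mp hi
    have h1 : T (θ a) = ε a • ((ε a)⁻¹ • a - 1) := by
      simp [T, smul_sub, smul_smul, mul_inv_cancel₀ ha]
    have h2 : e (θ a) = ε a := by simp [e]
    rw [h1, h2, smul_pow, map_smul, smul_eq_mul]
    have h3 : ε a ^ D = ε a ^ (D - 1 - i) * ε a ^ (i + 1) := by
      rw [← pow_add]
      congr 1
      omega
    rw [h3]
    ring

lemma augmentation_rep_ne_zero (θ : A ≃ₗ[K] V) {a : A} (ha : θ a ≠ 0) :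
    ε (θ.symm (Projectivization.mk K (θ a) ha).rep) ≠ 0 ↔ ε a ≠ 0 := by
  have := (IsHomFun.dual (ε.toLinearMap ∘ₗ θ.symm.toLinearMap)).mk_rep_eq_zero ha
  simpa using not_congr this

lemma isOpen_augmentation_ne_zero (θ : A ≃ₗ[K] V) :
    IsOpen {x : ℙ K V | ε (θ.symm x.rep) ≠ 0} :=
  (IsHomFun.dual (ε.toLinearMap ∘ₗ θ.symm.toLinearMap)).isOpen

lemma exists_eq_mk (θ : A ≃ₗ[K] V) (x : ℙ K V) :
    ∃ a, ∃ ha : θ a ≠ 0, x = Projectivization.mk K (θ a) ha := by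
  refine ⟨θ.symm x.rep, by simpa using x.rep_nonzero, ?_⟩
  conv_lhs => rw [← x.mk_rep]
  simp

/-- The orbit of a vector subgroup is closed in the affine chart. -/
lemma closure_expOrbit_inter [CharZero K] [FiniteDimensional K V]
    (hD : ∀ a, ε a = 0 → a ^ D = 0) (θ : A ≃ₗ[K] V) {W : Submodule K A} (hW : ∀ w ∈ W, ε w = 0) :
    closure (expOrbit θ D W) ∩ {x : ℙ K V | ε (θ.symm x.rep) ≠ 0} = expOrbit θ D W := by
  refine Set.Subset.antisymm ?_ ?_
  · rintro x ⟨hx, hx'⟩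
    obtain ⟨a, ha, rfl⟩ := exists_eq_mk θ x
    rw [Set.mem_ofPred_eq, augmentation_rep_ne_zero] at hx'
    rw [mk_mem_expOrbit hD hW]
    refine ⟨hx', ?_⟩
    by_contra hcon
    -- A linear form vanishing on `W` but not at the logarithm becomes, once homogenised, an
    -- equation separating the point from the orbit.
    obtain ⟨ξ, hξ, hξW⟩ := Submodule.exists_le_ker_of_notMem hcon
    obtain ⟨f, hf, hf'⟩ := exists_homFun_dlog (ε := ε) (D := D) θ ξ
    have h1 := mem_closure_iff_homFun.mp hx D f hf ?_
    · rw [hf.mk_rep_eq_zero, hf' a hx'] at h1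
      exact mul_ne_zero (pow_ne_zero _ hx') hξ h1
    · rintro _ ⟨w, hw, h, rfl⟩
      have hε := augmentation_nexp hD (hW w hw)
      rw [hf.mk_rep_eq_zero, hf' _ (by rw [hε]; exact one_ne_zero)]
      have := dlog_smul_nexp hD one_ne_zero (hW w hw)
      rw [one_smul] at this
      rw [this, LinearMap.mem_ker.mp (hξW hw), mul_zero]
  · rintro _ ⟨w, hw, h, rfl⟩
    refine ⟨subset_closure ⟨w, hw, h, rfl⟩, ?_⟩
    rw [Set.mem_ofPred_eq, augmentation_rep_ne_zero, augmentation_nexp hD (hW w hw)]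
    exact one_ne_zero

lemma isOpen_expOrbit_in_closure [CharZero K] [FiniteDimensional K V]
    (hD : ∀ a, ε a = 0 → a ^ D = 0) (θ : A ≃ₗ[K] V) {W : Submodule K A} (hW : ∀ w ∈ W, ε w = 0) :
    IsOpen ((↑) ⁻¹' expOrbit θ D W : Set (closure (expOrbit θ D W))) := by
  have := (isOpen_augmentation_ne_zero (ε := ε) θ).preimage
    (continuous_subtype_val (p := fun x => x ∈ closure (expOrbit θ D W)))
  convert this using 1
  ext x
  have h := Set.ext_iff.mp (closure_expOrbit_inter hD θ hW) x
  exact ⟨fun hx => (h.mpr hx).2, fun hx => h.mp ⟨x.2, hx⟩⟩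

lemma isPolyCurve_nexp_line (θ : A →ₗ[K] V) (a c : A) :
    IsPolyCurve (fun r : K => θ (nexp K D (a + r • c))) := by
  have key : ∀ P : Polynomial A, IsPolyCurve (fun r : K => P.eval (algebraMap K A r)) := by
    intro P ξ
    simp only [Polynomial.eval_eq_sum_range, map_sum]
    refine IsPolyFun.sum _ fun i _ => ?_
    have h : ∀ r : K, ξ (P.coeff i * algebraMap K A r ^ i) = r ^ i * ξ (P.coeff i) := by
      intro r
      rw [← map_pow, mul_comm, ← Algebra.smul_def, map_smul, smul_eq_mul]
    simp only [h]
    exact (IsPolyFun.id.pow i).mul (IsPolyFun.const _)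
  refine IsPolyCurve.map ?_ θ
  have h := key (∑ i ∈ Finset.range D,
    (i.factorial : K)⁻¹ • (Polynomial.C a + Polynomial.X * Polynomial.C c) ^ i)
  convert h using 2 with r
  simp [nexp, Polynomial.eval_finsetSum, Algebra.smul_def, mul_comm c]

/-- Two points of the orbit lie on the polynomial curve of exponentials of the line through their
logarithms. -/
lemma isIrreducible_expOrbit [Infinite K] (hD : ∀ a, ε a = 0 → a ^ D = 0) (θ : A ≃ₗ[K] V)
    {W : Submodule K A} (hW : ∀ w ∈ W, ε w = 0) : IsIrreducible (expOrbit θ D (W : Set A)) := by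
  refine ⟨⟨_, 0, W.zero_mem, map_nexp_ne_zero hD θ (map_zero ε), rfl⟩, ?_⟩
  intro s t hs ht hsW htW
  obtain ⟨x, hxW, hxs⟩ := hsW
  obtain ⟨y, hyW, hyt⟩ := htW
  obtain ⟨_, ⟨d, f, hf, rfl⟩, hx, hfs⟩ :=
    isTopologicalBasis_nonvanishing.exists_subset_of_mem_open hxs hs
  obtain ⟨_, ⟨e, g, hg, rfl⟩, hy, hgt⟩ :=
    isTopologicalBasis_nonvanishing.exists_subset_of_mem_open hyt ht
  obtain ⟨w₁, hw₁, h₁, rfl⟩ := hxW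
  obtain ⟨w₂, hw₂, h₂, rfl⟩ := hyW
  rw [Set.mem_ofPred_eq, ne_eq, hf.mk_rep_eq_zero] at hx
  rw [Set.mem_ofPred_eq, ne_eq, hg.mk_rep_eq_zero] at hy
  have hγ := isPolyCurve_nexp_line (D := D) θ.toLinearMap w₁ (w₂ - w₁)
  obtain ⟨r, hr, hr'⟩ := (hf.comp_curve hγ).exists_ne_zero_and (hg.comp_curve hγ) (r₀ := 0) (r₁ := 1)
    (by simpa using hx) (by simpa using hy)
  have hw : w₁ + r • (w₂ - w₁) ∈ W := W.add_mem hw₁ (W.smul_mem r (W.sub_mem hw₂ hw₁))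
  have hne := map_nexp_ne_zero hD θ (hW _ hw)
  refine ⟨Projectivization.mk K _ hne, ⟨_, hw, hne, rfl⟩, hfs ?_, hgt ?_⟩
  · rw [Set.mem_ofPred_eq, ne_eq, hf.mk_rep_eq_zero]
    exact hr
  · rw [Set.mem_ofPred_eq, ne_eq, hg.mk_rep_eq_zero]
    exact hr'

/-- The orbit is the chart `ε ≠ 0`. On the line `a + r • 1` only the parameter `r = -ε a` leaves
this chart. -/
lemma closure_expOrbit_eq_univ [CharZero K] (hD : ∀ a, ε a = 0 → a ^ D = 0) (θ : A ≃ₗ[K] V)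
    {W : Submodule K A} (hW : ∀ w, w ∈ W ↔ ε w = 0) : closure (expOrbit θ D (W : Set A)) = Set.univ := by
  refine Set.eq_univ_of_forall fun x => ?_
  obtain ⟨a, ha, rfl⟩ := exists_eq_mk θ x
  have hcl := mk_mem_closure_of_curve (S := expOrbit θ D (W : Set A))
    (IsPolyCurve.line (θ a) (θ 1)) (g := fun r => ε a + r)
    ((IsPolyFun.const _).add IsPolyFun.id) (r₀ := 1 - ε a) (r₁ := 0) (by simp)
    (fun r hr hr' => by
      have h1 : θ a + r • θ 1 = θ (a + r • 1) := by simp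
      simp only [h1] at hr' ⊢
      rw [mk_mem_expOrbit hD fun w hw => (hW w).mp hw]
      have h2 : ε (a + r • 1) ≠ 0 := by simpa using hr
      exact ⟨h2, (hW _).mpr (augmentation_dlog h2)⟩) (by simpa using ha)
  simpa using hcl

/-- The orbit is the part of the quadric in the chart `ε ≠ 0`, which is dense in an irreducible
quadric. -/
lemma closure_expOrbit_eq_quadric [IsAlgClosed K] [CharZero K] [FiniteDimensional K V]
    (hD : ∀ a, ε a = 0 → a ^ D = 0) (θ : A ≃ₗ[K] V) {W : Submodule K A} (hW : ∀ w ∈ W, ε w = 0)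
    {q : QuadraticForm K V} (hq : IsIrreducibleForm q)
    (hqW : ∀ w, ε w = 0 → (q (θ (nexp K D w)) = 0 ↔ w ∈ W)) :
    closure (expOrbit θ D (W : Set A)) = quadric q := by
  refine Set.Subset.antisymm (closure_minimal ?_ (isClosed_quadric q)) ?_
  · rintro _ ⟨w, hw, h, rfl⟩
    rw [mem_quadric_mk]
    exact (hqW w (hW w hw)).mpr hw
  · refine quadric_subset_closure hq (f := ε.toLinearMap ∘ₗ θ.symm.toLinearMap) ?_ ?_
    · intro h
      have := LinearMap.congr_fun h (θ 1)
      simp at this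
    · intro v hv hqv hfv
      obtain ⟨a, rfl⟩ := θ.surjective v
      have hfv : ε a ≠ 0 := by simpa using hfv
      rw [mk_mem_expOrbit hD hW]
      refine ⟨hfv, (hqW _ (augmentation_dlog hfv)).mp ?_⟩
      rw [← nexp_dlog hD hfv, map_smul, QuadraticMap.map_smul] at hqv
      simpa [hfv] using hqv

/-- If the orbit spans, a quadratic form cutting it out in the affine chart is irreducible. -/
lemma isIrreducibleForm_of_expOrbit [CharZero K] (θ : A ≃ₗ[K] V)
    {W : Submodule K A} (hW : ∀ w ∈ W, ε w = 0) {q : QuadraticForm K V}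
    (hqW : ∀ w, ε w = 0 → (q (θ (nexp K D w)) = 0 ↔ w ∈ W))
    (hspan : ∀ f : Module.Dual K V, (∀ w ∈ W, f (θ (nexp K D w)) = 0) → f = 0)
    (hne : ∃ w, ε w = 0 ∧ w ∉ W) : IsIrreducibleForm q := by
  rintro ⟨f, g, hfg⟩
  obtain ⟨w, hw, hwW⟩ := hne
  -- If neither factor vanished on the whole orbit, irreducibility along a curve would give a point
  -- of the orbit with `f * g ≠ 0`. A factor vanishing on the orbit is zero because the orbit spans.
  have hcases : f = 0 ∨ g = 0 := by
    by_contra! hcon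
    have h1 : ∃ w ∈ W, f (θ (nexp K D w)) ≠ 0 := by
      by_contra! h
      exact hcon.1 (hspan f h)
    have h2 : ∃ w ∈ W, g (θ (nexp K D w)) ≠ 0 := by
      by_contra! h
      exact hcon.2 (hspan g h)
    obtain ⟨w₁, hw₁, h1⟩ := h1
    obtain ⟨w₂, hw₂, h2⟩ := h2
    have hγ := isPolyCurve_nexp_line (D := D) θ.toLinearMap w₁ (w₂ - w₁)
    obtain ⟨r, hr, hr'⟩ := (hγ f).exists_ne_zero_and (hγ g) (r₀ := 0) (r₁ := 1)
      (by simpa using h1) (by simpa using h2)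
    have hw : w₁ + r • (w₂ - w₁) ∈ W := W.add_mem hw₁ (W.smul_mem r (W.sub_mem hw₂ hw₁))
    have := (hqW _ (hW _ hw)).mpr hw
    rw [hfg] at this
    exact mul_ne_zero hr hr' this
  refine hwW ((hqW w hw).mp ?_)
  rcases hcases with h | h <;> simp [hfg, h]

end Orbit

lemma _root_.Topology.IsInducing.isIrreducible_preimage {X Y : Type*} [TopologicalSpace X]
    [TopologicalSpace Y] {f : Y → X} (hf : Topology.IsInducing f) {S : Set X}
    (hS : IsIrreducible S) (hSf : S ⊆ Set.range f) : IsIrreducible (f ⁻¹' S) := by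
  refine ⟨?_, ?_⟩
  · obtain ⟨x, hx⟩ := hS.1
    obtain ⟨y, rfl⟩ := hSf hx
    exact ⟨y, hx⟩
  · intro u v hu hv
    obtain ⟨u', hu', rfl⟩ := hf.isOpen_iff.mp hu
    obtain ⟨v', hv', rfl⟩ := hf.isOpen_iff.mp hv
    rintro ⟨y, hy, hyu⟩ ⟨z, hz, hzv⟩
    obtain ⟨x, hx, hxu, hxv⟩ := hS.2 u' v' hu' hv' ⟨_, hy, hyu⟩ ⟨_, hz, hzv⟩
    obtain ⟨y, rfl⟩ := hSf hx
    exact ⟨y, hx, hxu, hxv⟩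

/-! ### Lower bound for the dimension of an orbit closure -/

section LowerBound

variable {K : Type*} [Field K] {A : Type*} [CommRing A] [Algebra K A] {ε : A →ₐ[K] K} {D : ℕ}
  {V : Type*} [AddCommGroup V] [Module K V]

lemma expOrbit_mono (θ : A ≃ₗ[K] V) {W W' : Set A} (h : W ⊆ W') :
    expOrbit θ D W ⊆ expOrbit θ D W' := by
  rintro _ ⟨w, hw, hne, rfl⟩
  exact ⟨w, h hw, hne, rfl⟩

/-- Subspaces of `U` give irreducible closed sets. Strict inclusions stay strict because the chart
`ε ≠ 0` recovers each orbit from its closure. -/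
lemma finrank_le_topologicalKrullDim [CharZero K] [FiniteDimensional K V]
    (hD : ∀ a, ε a = 0 → a ^ D = 0) (θ : A ≃ₗ[K] V) {U : Submodule K A} (hU : ∀ w ∈ U, ε w = 0) :
    (Module.finrank K U : WithBot ℕ∞) ≤
      topologicalKrullDim (closure (expOrbit θ D (U : Set A))) := by
  have : FiniteDimensional K A := θ.symm.finiteDimensional
  have hlen := Module.length_eq_finrank K U
  have hlen' := Module.coe_length K U
  rw [hlen] at hlen'
  have : ((Module.finrank K U : ℕ∞) : WithBot ℕ∞) = (Module.finrank K U : WithBot ℕ∞) := rfl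
  rw [← this, hlen']
  have hsub : ∀ W : Submodule K U, ∀ w ∈ W.map U.subtype, ε w = 0 := by
    rintro W _ ⟨w, -, rfl⟩
    exact hU w w.2
  have hle : ∀ W : Submodule K U, W.map U.subtype ≤ U := fun W => Submodule.map_subtype_le U W
  let F : Submodule K U → TopologicalSpace.IrreducibleCloseds (closure (expOrbit θ D (U : Set A))) :=
    fun W =>
      { carrier := (↑) ⁻¹' closure (expOrbit θ D (W.map U.subtype : Set A))
        isIrreducible' := Topology.IsInducing.subtypeVal.isIrreducible_preimage
          (isIrreducible_expOrbit hD θ (hsub W)).closure (by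
            rw [Subtype.range_coe]
            exact closure_mono (expOrbit_mono θ (hle W)))
        isClosed' := isClosed_closure.preimage continuous_subtype_val }
  refine Order.krullDim_le_of_strictMono F ?_
  refine Monotone.strictMono_of_injective ?_ ?_
  · intro W W' h
    have h1 : (W.map U.subtype : Set A) ⊆ W'.map U.subtype := Submodule.map_mono h
    exact Set.preimage_mono (f := ((↑) : closure (expOrbit θ D (U : Set A)) → ℙ K V))
      (closure_mono (expOrbit_mono θ h1))
  · have key : ∀ W W' : Submodule K U, F W = F W' → W ≤ W' := by
      intro W W' h w hw
      have hw' : (w : A) ∈ W.map U.subtype := ⟨w, hw, rfl⟩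
      have hne := map_nexp_ne_zero hD θ (hU w w.2)
      have h1 : Projectivization.mk K _ hne ∈ expOrbit θ D (W.map U.subtype : Set A) :=
        ⟨w, hw', hne, rfl⟩
      have h2 := subset_closure (expOrbit_mono θ (hle W) h1)
      have h3 : (⟨_, h2⟩ : closure (expOrbit θ D (U : Set A))) ∈ F W := subset_closure h1
      rw [h] at h3
      have h4 : Projectivization.mk K _ hne ∈ expOrbit θ D (W'.map U.subtype : Set A) := by
        rw [← closure_expOrbit_inter hD θ (hsub W')]
        refine ⟨h3, ?_⟩
        rw [Set.mem_ofPred_eq, augmentation_rep_ne_zero, augmentation_nexp hD (hU w w.2)]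
        exact one_ne_zero
      have h5 := ((mk_mem_expOrbit hD (hsub W') hne).mp h4).2
      have h6 := dlog_smul_nexp hD one_ne_zero (hU w w.2)
      rw [one_smul] at h6
      rw [h6] at h5
      obtain ⟨w', hw', h⟩ := h5
      rwa [← Subtype.ext h]
    exact fun W W' h => le_antisymm (key W W' h) (key W' W h.symm)

end LowerBound

/-! ### Upper bound for the dimension, via homogeneous primes -/

section UpperBound

open MvPolynomial TopologicalSpace

variable {K : Type*} [Field K] {V : Type*} [AddCommGroup V] [Module K V] {ι : Type*}
  (b : Module.Basis ι K V)

/-- The ideal of polynomials vanishing on the cone over a subset of projective space. -/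
def vanishingIdeal (Z : Set (ℙ K V)) : Ideal (MvPolynomial ι K) where
  carrier := {p | ∀ v (hv : v ≠ 0), Projectivization.mk K v hv ∈ Z → eval (b.repr v) p = 0}
  add_mem' hp hq v hv hZ := by rw [map_add, hp v hv hZ, hq v hv hZ, add_zero]
  zero_mem' v hv hZ := map_zero _
  smul_mem' c p hp v hv hZ := by rw [smul_eq_mul, map_mul, hp v hv hZ, mul_zero]

lemma mem_vanishingIdeal {Z : Set (ℙ K V)} {p : MvPolynomial ι K} :
    p ∈ vanishingIdeal b Z ↔
      ∀ v (hv : v ≠ 0), Projectivization.mk K v hv ∈ Z → eval (b.repr v) p = 0 := Iff.rfl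

lemma isHomFun_eval {d : ℕ} {p : MvPolynomial ι K} (hp : p.IsHomogeneous d) :
    IsHomFun d (fun v : V => eval (b.repr v) p) := by
  have h : IsWPoly (1 : ι → ℕ) (fun i (z : ι → K) => z i) d (fun z => eval z p) :=
    ⟨p, hp, fun _ => rfl⟩
  exact h.subst (fun v : V => (b.repr v : ι → K)) fun i => IsHomFun.dual (b.coord i)

lemma IsHomFun.exists_isHomogeneous [Fintype ι] {d : ℕ} {f : V → K} (hf : IsHomFun d f) :
    ∃ p : MvPolynomial ι K, p.IsHomogeneous d ∧ ∀ v, f v = eval (b.repr v) p := by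
  refine IsWPoly.subst (w' := (1 : ι → ℕ)) (c' := fun i v => b.repr v i) hf id fun ξ => ?_
  have : (fun v => ξ v) = fun v => ∑ i, ξ (b i) * b.repr v i := by
    funext v
    conv_lhs => rw [← b.sum_repr v]
    simp [mul_comm, -Module.Basis.sum_repr]
  simp only [id]
  rw [this]
  exact IsWPoly.sum _ fun i _ => (IsWPoly.coord (w := (1 : ι → ℕ)) i).const_mul _

/-- On the line through `v`, the polynomial becomes a polynomial in the scale `r` whose coefficients
are the values of the components. It vanishes for all `r ≠ 0`. -/
lemma homogeneousComponent_mem_vanishingIdeal [Infinite K] {Z : Set (ℙ K V)} {p : MvPolynomial ι K}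
    (hp : p ∈ vanishingIdeal b Z) (d : ℕ) : homogeneousComponent d p ∈ vanishingIdeal b Z := by
  intro v hv hZ
  let P : Polynomial K := ∑ i ∈ Finset.range (p.totalDegree + 1),
    Polynomial.monomial i (eval (b.repr v) (homogeneousComponent i p))
  have hP : ∀ r : K, P.eval r = eval (b.repr (r • v)) p := by
    intro r
    conv_rhs => rw [← sum_homogeneousComponent p, map_sum]
    rw [Polynomial.eval_finsetSum]
    refine Finset.sum_congr rfl fun i _ => ?_
    rw [(isHomFun_eval b (homogeneousComponent_isHomogeneous i p)).map_smul,
      Polynomial.eval_monomial, mul_comm]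
  have hP0 : P = 0 := by
    have hf : IsPolyFun fun r => P.eval r := ⟨P, fun _ => rfl⟩
    refine Polynomial.funext fun r => ?_
    rw [Polynomial.eval_zero]
    refine hf.eq_zero_of_forall_ne IsPolyFun.id (r₀ := 1) one_ne_zero (fun r hr => ?_) r
    rw [hP]
    refine hp _ (smul_ne_zero hr hv) ?_
    convert hZ using 1
    rw [Projectivization.mk_eq_mk_iff']
    exact ⟨r, rfl⟩
  by_cases hd : d < p.totalDegree + 1
  · have := congrArg (fun q => q.coeff d) hP0
    simpa [P, Polynomial.finsetSum_coeff, Polynomial.coeff_monomial,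
      Finset.sum_ite_eq', Finset.mem_range, hd] using this
  · rw [homogeneousComponent_eq_zero d p (by omega), map_zero]

/-- For a homogeneous ideal, primality may be tested on homogeneous elements, where it is the
irreducibility of `Z`. -/
lemma isPrime_vanishingIdeal [Infinite K] {Z : Set (ℙ K V)} (hZ : IsIrreducible Z) :
    (vanishingIdeal b Z).IsPrime := by
  classical
  obtain ⟨x, hx⟩ := hZ.1
  let _ : GradedAlgebra (homogeneousSubmodule ι K) := MvPolynomial.gradedAlgebra
  refine Ideal.IsHomogeneous.isPrime_of_homogeneous_mem_or_mem
    (𝒜 := MvPolynomial.homogeneousSubmodule ι K) ?_ ?_ ?_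
  · intro d p hp
    have := homogeneousComponent_mem_vanishingIdeal b hp d
    rwa [← MvPolynomial.decomposition.decompose'_apply] at this
  · rw [Ideal.ne_top_iff_one]
    intro h
    have := h x.rep x.rep_nonzero (by rwa [x.mk_rep])
    simp at this
  · rintro p q ⟨d, hp⟩ ⟨e, hq⟩ hpq
    have hp : p.IsHomogeneous d := hp
    have hq : q.IsHomogeneous e := hq
    by_contra! hcon
    simp only [mem_vanishingIdeal] at hcon
    push Not at hcon
    obtain ⟨⟨v, hv, hvZ, hpv⟩, ⟨w, hw, hwZ, hqw⟩⟩ := hcon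
    obtain ⟨y, hyZ, hyp, hyq⟩ := hZ.2 _ _ (isHomFun_eval b hp).isOpen (isHomFun_eval b hq).isOpen
      ⟨_, hvZ, by
        rw [Set.mem_ofPred_eq, ne_eq, (isHomFun_eval b hp).mk_rep_eq_zero]
        exact hpv⟩
      ⟨_, hwZ, by
        rw [Set.mem_ofPred_eq, ne_eq, (isHomFun_eval b hq).mk_rep_eq_zero]
        exact hqw⟩
    have := hpq y.rep y.rep_nonzero (by rwa [y.mk_rep])
    rw [map_mul] at this
    exact mul_ne_zero hyp hyq this

lemma exists_mem_vanishingIdeal_of_notMem [Fintype ι] {Z : Set (ℙ K V)} (hZ : IsClosed Z) {x : ℙ K V}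
    (hx : x ∉ Z) : ∃ p ∈ vanishingIdeal b Z, eval (b.repr x.rep) p ≠ 0 := by
  rw [← hZ.closure_eq, mem_closure_iff_homFun] at hx
  push Not at hx
  obtain ⟨d, f, hf, hfZ, hfx⟩ := hx
  obtain ⟨p, hp, hfp⟩ := hf.exists_isHomogeneous b
  refine ⟨p, fun v hv hvZ => ?_, by rwa [← hfp]⟩
  rw [← hfp, ← hf.mk_rep_eq_zero hv]
  exact hfZ _ hvZ

/-- The prime ideals of irreducible closed subsets. -/
noncomputable def primeOf [Infinite K] (Z : IrreducibleCloseds (ℙ K V)) :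
    PrimeSpectrum (MvPolynomial ι K) :=
  ⟨vanishingIdeal b Z, isPrime_vanishingIdeal b Z.isIrreducible⟩

lemma vanishingIdeal_anti {Z Z' : Set (ℙ K V)} (h : Z ⊆ Z') :
    vanishingIdeal b Z' ≤ vanishingIdeal b Z := fun _ hp v hv hZ => hp v hv (h hZ)

lemma primeOf_strictAnti [Infinite K] [Fintype ι] :
    StrictAnti (primeOf b : IrreducibleCloseds (ℙ K V) → _) := by
  refine Antitone.strictAnti_of_injective ?_ ?_
  · intro Z Z' h
    exact vanishingIdeal_anti b h
  · have key : ∀ Z Z' : IrreducibleCloseds (ℙ K V), primeOf b Z = primeOf b Z' → Z ≤ Z' := by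
      intro Z Z' h x hx
      by_contra hx'
      obtain ⟨p, hp, hpx⟩ := exists_mem_vanishingIdeal_of_notMem b Z'.isClosed hx'
      have h1 : vanishingIdeal b (Z : Set (ℙ K V)) = vanishingIdeal b Z' :=
        congrArg PrimeSpectrum.asIdeal h
      rw [← h1] at hp
      exact hpx (hp _ x.rep_nonzero (by rwa [x.mk_rep]))
    exact fun Z Z' h => le_antisymm (key Z Z' h) (key Z' Z h.symm)

variable (K ι) in
/-- The irrelevant prime ideal. -/
noncomputable def irrelevantPrime : PrimeSpectrum (MvPolynomial ι K) :=
  ⟨RingHom.ker (eval (0 : ι → K)), RingHom.ker_isPrime _⟩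

/-- The prime added on top of every chain accounts for projective dimension being one less than that
of the cone. -/
lemma primeOf_lt_irrelevantPrime [Infinite K] (Z : IrreducibleCloseds (ℙ K V)) :
    primeOf b Z < irrelevantPrime K ι := by
  obtain ⟨x, hx⟩ := Z.isIrreducible.1
  refine lt_of_le_of_ne ?_ ?_
  · intro p hp
    have h0 := homogeneousComponent_mem_vanishingIdeal b hp 0 _ x.rep_nonzero (by rwa [x.mk_rep])
    rw [homogeneousComponent_zero, eval_C] at h0
    change eval (0 : ι → K) p = 0
    rw [← h0]
    exact RingHom.congr_fun eval_zero p
  · intro h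
    have h1 : vanishingIdeal b Z = RingHom.ker (eval (0 : ι → K)) :=
      congrArg PrimeSpectrum.asIdeal h
    obtain ⟨i, hi⟩ : ∃ i, b.repr x.rep i ≠ 0 := by
      by_contra! hcon
      exact x.rep_nonzero (b.repr.injective (by ext i; simp [hcon i]))
    have h2 : (X i : MvPolynomial ι K) ∈ vanishingIdeal b (Z : Set (ℙ K V)) := by
      rw [h1, RingHom.mem_ker]
      simp
    have := h2 _ x.rep_nonzero (by rwa [x.mk_rep])
    rw [eval_X] at this
    exact hi this

lemma bot_lt_primeOf [Infinite K] [Fintype ι] (Z : IrreducibleCloseds (ℙ K V))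
    (hZ : (Z : Set (ℙ K V)) ≠ Set.univ) : ⊥ < primeOf b Z := by
  obtain ⟨x, hx⟩ := (Set.ne_univ_iff_exists_notMem _).mp hZ
  obtain ⟨p, hp, hpx⟩ := exists_mem_vanishingIdeal_of_notMem b Z.isClosed hx
  refine lt_of_le_of_ne bot_le fun h => ?_
  have h1 : vanishingIdeal b (Z : Set (ℙ K V)) = ⊥ :=
    (congrArg PrimeSpectrum.asIdeal h).symm
  rw [h1, Ideal.mem_bot] at hp
  simp [hp] at hpx

lemma length_le_of_ltSeries [Fintype ι] (s : LTSeries (PrimeSpectrum (MvPolynomial ι K))) :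
    s.length ≤ Fintype.card ι := by
  have h1 := Order.LTSeries.length_le_krullDim s
  have h2 : Order.krullDim (PrimeSpectrum (MvPolynomial ι K)) = (Fintype.card ι : ℕ) := by
    have := MvPolynomial.ringKrullDim_of_isNoetherianRing (R := K) (ι := ι)
    rw [ringKrullDim_eq_zero_of_field, zero_add, Nat.card_eq_fintype_card] at this
    exact this
  rw [h2] at h1
  exact_mod_cast h1

/-- The chain of primes of a chain of irreducible closed subsets, with the irrelevant prime on
top. -/
lemma exists_ltSeries_primeOf [Infinite K] [Fintype ι] (s : LTSeries (IrreducibleCloseds (ℙ K V))) :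
    ∃ t : LTSeries (PrimeSpectrum (MvPolynomial ι K)), t.length = s.length + 1 ∧
      t.head = primeOf b s.last := by
  obtain ⟨t, ht, hhead, hlast⟩ : ∃ t : LTSeries (PrimeSpectrum (MvPolynomial ι K)),
      t.length = s.length ∧ t.head = primeOf b s.last ∧ t.last = primeOf b s.head := by
    refine ⟨LTSeries.mk s.length (fun i => primeOf b (s i.rev)) fun i j h =>
      primeOf_strictAnti b (s.strictMono (Fin.rev_lt_rev.mpr h)), rfl, ?_, ?_⟩
    · change primeOf b (s (Fin.rev 0)) = primeOf b (s (Fin.last _))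
      rw [Fin.rev_zero]
    · change primeOf b (s (Fin.rev (Fin.last _))) = primeOf b (s 0)
      rw [Fin.rev_last]
  have hlt : t.last < irrelevantPrime K ι := by
    rw [hlast]
    exact primeOf_lt_irrelevantPrime b _
  refine ⟨RelSeries.snoc t (irrelevantPrime K ι) hlt, ?_, ?_⟩
  · rw [RelSeries.snoc_length, ht]
  · rw [RelSeries.head_snoc, hhead]

lemma topologicalKrullDim_projectivization_le [Infinite K] [FiniteDimensional K V] {k : ℕ}
    (hk : Module.finrank K V ≤ k + 1) : topologicalKrullDim (ℙ K V) ≤ k := by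
  refine iSup_le fun s => ?_
  obtain ⟨t, ht, -⟩ := exists_ltSeries_primeOf (Module.finBasis K V) s
  have h := length_le_of_ltSeries t
  rw [Fintype.card_fin, ht] at h
  have : s.length ≤ k := by omega
  exact_mod_cast this

/-- For a proper closed set, a chain of primes can be extended by the irrelevant ideal above and by
the zero ideal below, so its length plus two is at most `dim V`. -/
lemma topologicalKrullDim_closed_le [Infinite K] [FiniteDimensional K V] {k : ℕ}
    (hk : Module.finrank K V ≤ k + 2) {Z : Set (ℙ K V)} (hZ : IsClosed Z) (hZ' : Z ≠ Set.univ) :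
    topologicalKrullDim Z ≤ k := by
  refine iSup_le fun s => ?_
  let s' := s.map _ (IrreducibleCloseds.map_strictMono_of_isInducing
    (Topology.IsInducing.subtypeVal (t := Z)))
  have hlast : ((RelSeries.last s' : IrreducibleCloseds (ℙ K V)) : Set (ℙ K V)) ≠ Set.univ := by
    intro h
    refine hZ' (Set.eq_univ_of_univ_subset ?_)
    rw [← h]
    exact closure_minimal (by rintro _ ⟨x, -, rfl⟩; exact x.2) hZ
  obtain ⟨t, ht, ht'⟩ := exists_ltSeries_primeOf (Module.finBasis K V) s'
  have h := length_le_of_ltSeries (t.cons ⊥ (by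
    rw [ht']
    exact bot_lt_primeOf _ _ hlast))
  have hs' : s'.length = s.length := rfl
  have hc : (t.cons ⊥ (by
    rw [ht']
    exact bot_lt_primeOf _ _ hlast)).length = t.length + 1 := RelSeries.cons_length _ _ _
  rw [hc, Fintype.card_fin, ht, hs'] at h
  have : s.length ≤ k := by omega
  exact_mod_cast this

end UpperBound

/-! ### Exponential actions are additive actions -/

section Core

variable {K : Type*} [Field K] {A : Type*} [CommRing A] [Algebra K A] {ε : A →ₐ[K] K} {D : ℕ}
  {V : Type*} [AddCommGroup V] [Module K V] {k : ℕ}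

lemma isPolyHomogeneous_iff {n d : ℕ} {f : (Fin n → K) → V → K} :
    IsPolyHomogeneous n d f ↔
      IsWPoly (Sum.elim (fun _ => 0) (fun _ => 1) : Fin n ⊕ Module.Dual K V → ℕ)
        (fun i (x : (Fin n → K) × V) => Sum.elim x.1 (fun ξ : Module.Dual K V => ξ x.2) i) d
        (fun x => f x.1 x.2) :=
  ⟨fun ⟨p, hp, h⟩ => ⟨p, hp, fun x => h x.1 x.2⟩, fun ⟨p, hp, h⟩ => ⟨p, hp, fun t v => h (t, v)⟩⟩

/-- Multiplication by the exponential is polynomial in the group and linear in the vector. -/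
lemma isPolyHomogeneous_nexp (θ : A ≃ₗ[K] V) (u : (Fin k → K) →ₗ[K] A) (ξ : Module.Dual K V) :
    IsPolyHomogeneous k 1 (fun s v => ξ (θ (nexp K D (u s) * θ.symm v))) := by
  rw [isPolyHomogeneous_iff]
  have key : ∀ (i : ℕ) (η : Module.Dual K A),
      IsWPoly (Sum.elim (fun _ => 0) (fun _ => 1) : Fin k ⊕ Module.Dual K V → ℕ)
        (fun i (x : (Fin k → K) × V) => Sum.elim x.1 (fun ξ : Module.Dual K V => ξ x.2) i) 1
        (fun x => η (u x.1 ^ i * θ.symm x.2)) := by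
    intro i
    induction i with
    | zero =>
      intro η
      simpa using IsWPoly.coord
        (w := (Sum.elim (fun _ => 0) (fun _ => 1) : Fin k ⊕ Module.Dual K V → ℕ))
        (c := fun i (x : (Fin k → K) × V) => Sum.elim x.1 (fun ξ : Module.Dual K V => ξ x.2) i)
        (Sum.inr (η ∘ₗ θ.symm.toLinearMap))
    | succ i ih =>
      intro η
      have h : (fun x : (Fin k → K) × V => η (u x.1 ^ (i + 1) * θ.symm x.2)) =
          fun x => ∑ j, x.1 j *
            (η ∘ₗ LinearMap.mulLeft K (u (Pi.single j 1))) (u x.1 ^ i * θ.symm x.2) := by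
        funext x
        have hu : u x.1 = ∑ j, x.1 j • u (Pi.single j 1) := by
          conv_lhs => rw [← LinearMap.sum_single_apply (fun _ : Fin k => K) x.1]
          rw [map_sum]
          refine Finset.sum_congr rfl fun j _ => ?_
          rw [← map_smul, ← Pi.single_smul, smul_eq_mul, mul_one]
        rw [pow_succ']
        conv_lhs => rw [mul_assoc]; enter [2, 1]; rw [hu]
        simp only [Finset.sum_mul, map_sum, smul_mul_assoc, map_smul, smul_eq_mul,
          LinearMap.comp_apply, LinearMap.mulLeft_apply]
      rw [h]
      refine IsWPoly.sum _ fun j _ => ?_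
      have h1 := (IsWPoly.coord
        (w := (Sum.elim (fun _ => 0) (fun _ => 1) : Fin k ⊕ Module.Dual K V → ℕ))
        (c := fun i (x : (Fin k → K) × V) => Sum.elim x.1 (fun ξ : Module.Dual K V => ξ x.2) i)
        (Sum.inl j)).mul (ih (η ∘ₗ LinearMap.mulLeft K (u (Pi.single j 1))))
      simpa only [Sum.elim_inl, zero_add] using h1
  simp only [nexp, Finset.sum_mul, map_sum, smul_mul_assoc, map_smul, smul_eq_mul]
  exact IsWPoly.sum _ fun i _ => (key i (ξ ∘ₗ θ.toLinearMap)).const_mul _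

/-- The map `ψ` is the action of a vector group on `ℙ(V)` through exponentials in an algebra that
is identified with `V` as a vector space. -/
def IsExpAction (θ : A ≃ₗ[K] V) (D : ℕ) (u : (Fin k → K) →ₗ[K] A)
    (ψ : (Fin k → K) → ℙ K V → ℙ K V) : Prop :=
  ∀ s a (ha : θ a ≠ 0), ∃ h : θ (nexp K D (u s) * a) ≠ 0,
    ψ s (Projectivization.mk K (θ a) ha) = Projectivization.mk K (θ (nexp K D (u s) * a)) h

lemma isUnit_nexp [CharZero K] (hD : ∀ a, ε a = 0 → a ^ D = 0) {w : A} (hw : ε w = 0) :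
    IsUnit (nexp K D w) := by
  refine IsUnit.of_mul_eq_one (nexp K D (-w)) ?_
  rw [← nexp_add' hD hw (by simp [hw]), add_neg_cancel, nexp_zero (trunc_ne_zero hD)]

lemma exists_isExpAction [CharZero K] (hD : ∀ a, ε a = 0 → a ^ D = 0) (θ : A ≃ₗ[K] V)
    {u : (Fin k → K) →ₗ[K] A} (hu : ∀ s, ε (u s) = 0) : ∃ ψ, IsExpAction θ D u ψ := by
  have hinj : ∀ s, Function.Injective
      (θ.toLinearMap ∘ₗ LinearMap.mulLeft K (nexp K D (u s)) ∘ₗ θ.symm.toLinearMap) := by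
    intro s
    exact fun x y h =>
      θ.symm.injective ((isUnit_nexp hD (hu s)).mul_left_cancel (θ.injective h))
  refine ⟨fun s => Projectivization.map _ (hinj s), fun s a ha => ?_⟩
  have h : θ (nexp K D (u s) * a) ≠ 0 := by
    intro h0
    have h1 : a = 0 := by
      rw [map_eq_zero_iff θ θ.injective] at h0
      exact (isUnit_nexp hD (hu s)).mul_right_eq_zero.mp h0
    simp [h1] at ha
  refine ⟨h, ?_⟩
  simp [Projectivization.map_mk]

/-- The exponential action is an additive action on the orbit closure as soon as the dimensions
agree. -/
lemma IsExpAction.isAdditiveAction [CharZero K] [FiniteDimensional K V]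
    (hD : ∀ a, ε a = 0 → a ^ D = 0) {θ : A ≃ₗ[K] V} {u : (Fin k → K) →ₗ[K] A}
    (hu : ∀ s, ε (u s) = 0) (hinj : Function.Injective u) {ψ : (Fin k → K) → ℙ K V → ℙ K V}
    (hψ : IsExpAction θ D u ψ)
    (hdim : topologicalKrullDim (closure (expOrbit θ D (LinearMap.range u : Set A))) ≤ k) :
    IsAdditiveAction k ψ (closure (expOrbit θ D (LinearMap.range u : Set A)))
      (expOrbit θ D (LinearMap.range u : Set A)) where
  zero_act x := by
    obtain ⟨a, ha, rfl⟩ := exists_eq_mk θ x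
    obtain ⟨h, h'⟩ := hψ 0 a ha
    rw [h']
    simp only [map_zero, nexp_zero (K := K) (A := A) (trunc_ne_zero hD), one_mul]
  add_act s t x := by
    obtain ⟨a, ha, rfl⟩ := exists_eq_mk θ x
    obtain ⟨h₁, h₁'⟩ := hψ t a ha
    obtain ⟨h₂, h₂'⟩ := hψ s _ h₁
    obtain ⟨h₃, h₃'⟩ := hψ (s + t) a ha
    rw [h₁', h₂', h₃']
    congr 2
    rw [map_add, nexp_add' hD (hu s) (hu t), mul_assoc]
  isMorphism t₀ x₀ := by
    obtain ⟨a, ha, rfl⟩ := exists_eq_mk θ x₀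
    refine ⟨1, fun s v => θ (nexp K D (u s) * θ.symm v), fun ξ => isPolyHomogeneous_nexp θ u ξ, ?_,
      fun t v hv hF => ?_⟩
    · obtain ⟨h, -⟩ := hψ t₀ (θ.symm (Projectivization.mk K (θ a) ha).rep)
        (by simpa using (Projectivization.mk K (θ a) ha).rep_nonzero)
      exact h
    · obtain ⟨h, h'⟩ := hψ t (θ.symm v) (by simpa using hv)
      rw [← h']
      simp
  effective t ht := by
    have hne : θ 1 ≠ 0 := by
      have := map_nexp_ne_zero hD θ (w := 0) (map_zero ε)
      rwa [nexp_zero (trunc_ne_zero hD)] at this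
    obtain ⟨h, h'⟩ := hψ t 1 hne
    have h1 := ht (Projectivization.mk K (θ 1) hne)
    rw [h', Projectivization.mk_eq_mk_iff'] at h1
    obtain ⟨c, hc⟩ := h1
    rw [← map_smul, mul_one] at hc
    have hc := θ.injective hc
    -- Comparing augmentations shows the scalar to be one; then `exp (u t) = 1` and injectivity of
    -- the exponential apply.
    have hc1 := congrArg ε hc
    rw [map_smul, map_one, augmentation_nexp hD (hu t), smul_eq_mul, mul_one] at hc1
    rw [hc1, one_smul, ← nexp_zero (K := K) (A := A) (trunc_ne_zero hD)] at hc
    have := nexp_injective' hD (map_zero ε) (hu t) hc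
    exact hinj (by rw [← this, map_zero])
  isClosed := isClosed_closure
  isIrreducible := (isIrreducible_expOrbit hD θ (by
    rintro _ ⟨s, rfl⟩
    exact hu s)).closure
  dim_eq := by
    refine le_antisymm hdim ?_
    have h := finrank_le_topologicalKrullDim hD θ (U := LinearMap.range u) (by
      rintro _ ⟨s, rfl⟩
      exact hu s)
    rwa [LinearMap.finrank_range_of_inj hinj, Module.finrank_fin_fun] at h
  invariant t x hx := by
    obtain ⟨a, ha, rfl⟩ := exists_eq_mk θ x
    obtain ⟨h, h'⟩ := hψ t a ha
    rw [h', mem_closure_iff_homFun]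
    intro d f hf hfO
    rw [hf.mk_rep_eq_zero]
    let T : V →ₗ[K] V :=
      θ.toLinearMap ∘ₗ LinearMap.mulLeft K (nexp K D (u t)) ∘ₗ θ.symm.toLinearMap
    have hT : ∀ a, T (θ a) = θ (nexp K D (u t) * a) := fun a => by simp [T]
    have h1 := mem_closure_iff_homFun.mp hx d _ (hf.comp_linearMap T) ?_
    · rw [(hf.comp_linearMap T).mk_rep_eq_zero ha, hT] at h1
      exact h1
    · rintro _ ⟨_, ⟨s, rfl⟩, hne, rfl⟩
      rw [(hf.comp_linearMap T).mk_rep_eq_zero hne, hT, ← nexp_add' hD (hu t) (hu s), ← map_add]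
      have hne' := map_nexp_ne_zero hD θ (hu (t + s))
      rw [← hf.mk_rep_eq_zero hne']
      exact hfO _ ⟨_, ⟨t + s, rfl⟩, hne', rfl⟩
  isOrbit := by
    have hne := map_nexp_ne_zero hD θ (w := 0) (map_zero ε)
    refine ⟨Projectivization.mk K _ hne, subset_closure ⟨0, Submodule.zero_mem _, hne, rfl⟩, ?_⟩
    have h0 : nexp K D (0 : A) = 1 := nexp_zero (trunc_ne_zero hD)
    ext x
    constructor
    · rintro ⟨_, ⟨s, rfl⟩, h, rfl⟩
      obtain ⟨h, h'⟩ := hψ s _ hne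
      refine ⟨s, ?_⟩
      simp only [h']
      simp only [h0, mul_one]
    · rintro ⟨s, rfl⟩
      obtain ⟨h, h'⟩ := hψ s _ hne
      simp only [h0, mul_one] at h h'
      exact ⟨u s, ⟨s, rfl⟩, h, by simp only [h0, h']⟩
  isOpen := isOpen_expOrbit_in_closure hD θ (by
    rintro _ ⟨s, rfl⟩
    exact hu s)

/-- An exponential action whose vector group is the whole augmentation ideal, or is cut out in it by
a quadratic form, is an additive action on projective space or on a hyperquadric. -/
theorem IsExpAction.isAdditiveAction_of_quadric [IsAlgClosed K] [CharZero K] [FiniteDimensional K V]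
    (hD : ∀ a, ε a = 0 → a ^ D = 0) {θ : A ≃ₗ[K] V} {u : (Fin k → K) →ₗ[K] A}
    (hu : ∀ s, ε (u s) = 0) (hinj : Function.Injective u) {ψ : (Fin k → K) → ℙ K V → ℙ K V}
    (hψ : IsExpAction θ D u ψ)
    (hspan : ∀ f : Module.Dual K V, (∀ s, f (θ (nexp K D (u s))) = 0) → f = 0)
    (halt : (∀ w, ε w = 0 → w ∈ LinearMap.range u) ∨ ∃ q : QuadraticForm K V,
      (∀ w, ε w = 0 → (q (θ (nexp K D w)) = 0 ↔ w ∈ LinearMap.range u)) ∧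
      ∃ e, ε e = 0 ∧ e ∉ LinearMap.range u ∧
        ∀ w, ε w = 0 → ∃ c : K, w - c • e ∈ LinearMap.range u) :
    IsAdditiveAction k ψ (closure (expOrbit θ D (LinearMap.range u : Set A)))
      (expOrbit θ D (LinearMap.range u : Set A)) ∧
    ((IsHyperquadric (closure (expOrbit θ D (LinearMap.range u : Set A))) ∧
      IsNondegenerateSubset (closure (expOrbit θ D (LinearMap.range u : Set A)))) ∨
      closure (expOrbit θ D (LinearMap.range u : Set A)) = Set.univ) := by
  have hW : ∀ w ∈ LinearMap.range u, ε w = 0 := by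
    rintro _ ⟨s, rfl⟩
    exact hu s
  have hdec : ∀ a : A, ε (a - ε a • 1) = 0 := fun a => by simp
  rcases halt with hall | ⟨q, hq, e, he, heU, hcodim⟩
  · have huniv := closure_expOrbit_eq_univ hD θ fun w => ⟨hW w, hall w⟩
    refine ⟨hψ.isAdditiveAction hD hu hinj ?_, Or.inr huniv⟩
    refine (topologicalKrullDim_subspace_le _ _).trans (topologicalKrullDim_projectivization_le ?_)
    -- Here `A` is spanned by `range u` and `1`, so `dim V ≤ k + 1`.
    let F : (Fin k → K) × K →ₗ[K] V :=
      θ.toLinearMap ∘ₗ u.coprod ((LinearMap.id : K →ₗ[K] K).smulRight (1 : A))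
    have hF : Function.Surjective F := by
      intro v
      obtain ⟨a, rfl⟩ := θ.surjective v
      obtain ⟨s, hs⟩ := hall _ (hdec a)
      exact ⟨(s, ε a), by simp [F, hs]⟩
    have := LinearMap.finrank_le_finrank_of_surjective hF
    simpa using this
  · have hirr : IsIrreducibleForm q := isIrreducibleForm_of_expOrbit θ hW hq (fun f hf =>
      hspan f fun s => hf _ ⟨s, rfl⟩) ⟨e, he, heU⟩
    have hquad := closure_expOrbit_eq_quadric hD θ hW hirr hq
    refine ⟨hψ.isAdditiveAction hD hu hinj ?_, Or.inl ⟨⟨q, hirr, hquad⟩, ?_⟩⟩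
    · refine topologicalKrullDim_closed_le ?_ isClosed_closure ?_
      -- Here `A` is spanned by `range u`, `e` and `1`, so `dim V ≤ k + 2`; the missing dimension is
      -- regained because `[exp e]` is off the quadric.
      · let F : (Fin k → K) × K × K →ₗ[K] V :=
          θ.toLinearMap ∘ₗ u.coprod (((LinearMap.id : K →ₗ[K] K).smulRight e).coprod
            ((LinearMap.id : K →ₗ[K] K).smulRight (1 : A)))
        have hF : Function.Surjective F := by
          intro v
          obtain ⟨a, rfl⟩ := θ.surjective v
          obtain ⟨c, s, hs⟩ := hcodim _ (hdec a)
          exact ⟨(s, c, ε a), by simp [F, hs]; abel⟩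
        have := LinearMap.finrank_le_finrank_of_surjective hF
        simpa using this
      · intro h
        rw [hquad] at h
        have hne := map_nexp_ne_zero hD θ he
        have h1 : Projectivization.mk K _ hne ∈ quadric q := h ▸ Set.mem_univ _
        rw [mem_quadric_mk] at h1
        exact heU ((hq e he).mp h1)
    · intro f hf
      by_contra! hcon
      refine hf (hspan f fun s => ?_)
      have hne := map_nexp_ne_zero hD θ (hu s)
      have := hcon _ (subset_closure ⟨u s, ⟨s, rfl⟩, hne, rfl⟩)
      rwa [(IsHomFun.dual f).mk_rep_eq_zero hne] at this

end Core

/-! ### The local algebra of a cyclic nilpotent family -/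

section Model

variable {K : Type*} [Field K] {V : Type*} [AddCommGroup V] [Module K V]

lemma _root_.Module.End.pow_finrank_eq_zero_of_isNilpotent [FiniteDimensional K V]
    {f : Module.End K V} (hf : IsNilpotent f) : f ^ Module.finrank K V = 0 := by
  obtain ⟨m, hm⟩ := hf
  have := Module.End.ker_pow_le_ker_pow_finrank f m
  rw [hm, LinearMap.ker_zero, top_le_iff, LinearMap.ker_eq_top] at this
  exact this

/-- A finite algebra generated by nilpotent elements over an algebraically closed field is local. -/
lemma exists_augmentation [IsAlgClosed K] {A : Type*} [CommRing A] [Algebra K A]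
    [FiniteDimensional K A] [Nontrivial A] {s : Set A} (hs : Algebra.adjoin K s = ⊤)
    (hnil : ∀ x ∈ s, IsNilpotent x) :
    ∃ ε : A →ₐ[K] K, ∀ a, IsNilpotent (a - algebraMap K A (ε a)) := by
  obtain ⟨m, hm⟩ := Ideal.exists_maximal A
  let _ : Field (A ⧸ m) := Ideal.Quotient.field m
  have hbij : Function.Bijective (algebraMap K (A ⧸ m)) :=
    IsAlgClosed.algebraMap_bijective_of_isIntegral
  let ε : A →ₐ[K] K :=
    ((AlgEquiv.ofBijective (Algebra.ofId K (A ⧸ m)) hbij).symm : (A ⧸ m) →ₐ[K] K).comp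
      (Ideal.Quotient.mkₐ K m)
  refine ⟨ε, fun a => ?_⟩
  have ha : a ∈ Algebra.adjoin K s := hs ▸ Algebra.mem_top
  -- Elements that differ from a scalar by a nilpotent form a subalgebra, and it contains the
  -- generators.
  induction ha using Algebra.adjoin_induction with
  | mem x hx =>
    have h : ε x = 0 := ((hnil x hx).map ε).eq_zero
    simpa [h] using hnil x hx
  | algebraMap r => simp
  | add x y _ _ hx hy =>
    have h : x + y - algebraMap K A (ε (x + y)) =
        (x - algebraMap K A (ε x)) + (y - algebraMap K A (ε y)) := by
      rw [map_add, map_add]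
      ring
    rw [h]
    exact (Commute.all _ _).isNilpotent_add hx hy
  | mul x y _ _ hx hy =>
    have h : x * y - algebraMap K A (ε (x * y)) =
        (x - algebraMap K A (ε x)) * y + algebraMap K A (ε x) * (y - algebraMap K A (ε y)) := by
      rw [map_mul, map_mul]
      ring
    rw [h]
    exact (Commute.all _ _).isNilpotent_add ((Commute.all _ _).isNilpotent_mul_right hx)
      ((Commute.all _ _).isNilpotent_mul_left hy)

open scoped IsMulCommutative in
/-- A commuting family of nilpotent operators with a cyclic vector makes the space a module of rank
one over a local algebra. -/
lemma exists_local_algebra {V : Type u} [AddCommGroup V] [Module K V] [IsAlgClosed K]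
    [FiniteDimensional K V] {n : ℕ}
    (N : (Fin n → K) →ₗ[K] Module.End K V) (hN : ∀ t, IsNilpotent (N t))
    (hNc : ∀ s t, Commute (N s) (N t)) {v₀ : V} (hv₀ : v₀ ≠ 0)
    (hspan : ∀ f : Module.Dual K V,
      (∀ t, f (nexp K (Module.finrank K V) (N t) v₀) = 0) → f = 0) :
    ∃ (A : Type u) (_ : CommRing A) (_ : Algebra K A) (ε : A →ₐ[K] K)
      (θ : A ≃ₗ[K] V) (u : (Fin n → K) →ₗ[K] A),
      (∀ a, ε a = 0 → a ^ Module.finrank K V = 0) ∧ (∀ t, ε (u t) = 0) ∧ θ 1 = v₀ ∧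
      ∀ t a, θ (nexp K (Module.finrank K V) (u t) * a) =
        nexp K (Module.finrank K V) (N t) (θ a) := by
  let S : Subalgebra K (Module.End K V) := Algebra.adjoin K (Set.range N)
  have hcomm : ∀ a ∈ Set.range N, ∀ b ∈ Set.range N, a * b = b * a := by
    rintro _ ⟨s, rfl⟩ _ ⟨t, rfl⟩
    exact hNc s t
  have : IsMulCommutative S := Algebra.isMulCommutative_adjoin K hcomm
  let _ : CommRing S := inferInstance
  have : Nontrivial V := ⟨v₀, 0, hv₀⟩
  have : FiniteDimensional K S := inferInstanceAs (FiniteDimensional K (Subalgebra.toSubmodule S))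
  obtain ⟨ε, hε⟩ := exists_augmentation (K := K) (A := S)
    (Algebra.adjoin_adjoin_coe_preimage (R := K) (s := Set.range N)) (by
      rintro x ⟨t, ht⟩
      obtain ⟨m, hm⟩ := hN t
      refine ⟨m, Subtype.ext ?_⟩
      rw [SubmonoidClass.coe_pow, ← ht, hm]
      rfl)
  let ev : S →ₗ[K] V := (LinearMap.applyₗ v₀) ∘ₗ S.val.toLinearMap
  have hev : ∀ a : S, ev a = (a : Module.End K V) v₀ := fun a => rfl
  let u : (Fin n → K) →ₗ[K] S :=
    N.codRestrict (Subalgebra.toSubmodule S) fun t => Algebra.subset_adjoin ⟨t, rfl⟩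
  have hu : ∀ t, ((u t : S) : Module.End K V) = N t := fun t => rfl
  have hnexp : ∀ t, ((nexp K (Module.finrank K V) (u t) : S) : Module.End K V) =
      nexp K (Module.finrank K V) (N t) := by
    intro t
    have := map_sum S.val (fun i => (i.factorial : K)⁻¹ • (u t) ^ i)
      (Finset.range (Module.finrank K V))
    exact this
  -- The image contains the whole orbit of `v₀`, which lies in no hyperplane.
  have hsurj : Function.Surjective ev := by
    rw [← LinearMap.range_eq_top]
    by_contra hcon
    obtain ⟨f, hf, hf'⟩ := Submodule.exists_le_ker_of_lt_top _ (lt_top_iff_ne_top.mpr hcon)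
    refine hf (hspan f fun t => ?_)
    rw [← hnexp, ← hev]
    exact hf' ⟨_, rfl⟩
  -- By commutativity, an operator of the algebra that kills the cyclic vector kills everything.
  have hinj : Function.Injective ev := by
    rw [injective_iff_map_eq_zero]
    intro a ha
    refine Subtype.ext (LinearMap.ext fun v => ?_)
    obtain ⟨b, rfl⟩ := hsurj v
    have h1 : ev (a * b) = 0 := by
      rw [mul_comm a b]
      exact (congrArg (b : Module.End K V) ha).trans (map_zero _)
    exact h1
  refine ⟨S, inferInstance, inferInstance, ε, LinearEquiv.ofBijective ev ⟨hinj, hsurj⟩, u, ?_, ?_,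
    ?_, ?_⟩
  · intro a ha
    obtain ⟨m, hm⟩ := hε a
    rw [ha, map_zero, sub_zero] at hm
    have h : IsNilpotent (a : Module.End K V) := ⟨m, by rw [← SubmonoidClass.coe_pow, hm]; rfl⟩
    refine Subtype.ext ?_
    rw [SubmonoidClass.coe_pow, Module.End.pow_finrank_eq_zero_of_isNilpotent h]
    rfl
  · intro t
    have h : IsNilpotent (u t) := by
      obtain ⟨m, hm⟩ := hN t
      refine ⟨m, Subtype.ext ?_⟩
      rw [SubmonoidClass.coe_pow, hu, hm]
      rfl
    exact (h.map ε).eq_zero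
  · rfl
  · intro t a
    rw [← hnexp]
    rfl

end Model

/-! ### Orbits of subgroups inside their linear span -/

section Core

variable {K : Type*} [Field K] {A : Type*} [CommRing A] [Algebra K A] {ε : A →ₐ[K] K} {D : ℕ}
  {V : Type*} [AddCommGroup V] [Module K V] {k : ℕ}

/-- A linear subspace of the augmentation ideal that is cut out by a quadratic form evaluated on
exponentials has codimension at most one. -/
lemma exists_sub_smul_mem [IsAlgClosed K] [CharZero K] [FiniteDimensional K V]
    (θ : A ≃ₗ[K] V) {U : Submodule K A}
    {q : QuadraticForm K V} (hq : ∀ w, ε w = 0 → (q (θ (nexp K D w)) = 0 ↔ w ∈ U)) {e : A}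
    (he : ε e = 0) (heU : e ∉ U) {w : A} (hw : ε w = 0) : ∃ c : K, w - c • e ∈ U := by
  have : Infinite K := IsAlgClosed.instInfinite
  by_contra! hcon
  have hε : ∀ x y : K, ε (x • w + y • e) = 0 := fun x y => by simp [he, hw]
  -- If `w` and `e` were independent modulo `U`, the polynomial `q (exp (x w + y e))` would vanish
  -- only at the origin of the plane. Lines missing the origin force it to be constant off the
  -- origin, hence also at the origin, a contradiction.
  have hne : ∀ x y : K, x ≠ 0 ∨ y ≠ 0 → q (θ (nexp K D (x • w + y • e))) ≠ 0 := by
    intro x y hxy h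
    rw [hq _ (hε x y)] at h
    by_cases hx : x = 0
    · have hy : y ≠ 0 := hxy.resolve_left (not_not.mpr hx)
      rw [hx, zero_smul, zero_add] at h
      exact heU ((U.smul_mem_iff hy).mp h)
    · refine hcon (-(x⁻¹ * y)) ((U.smul_mem_iff hx).mp ?_)
      rwa [smul_sub, smul_smul, mul_neg, mul_inv_cancel_left₀ hx, neg_smul, sub_neg_eq_add]
  have hpoly : ∀ a c : A, IsPolyFun fun r : K => q (θ (nexp K D (a + r • c))) := fun a c =>
    (isHomFun_quadraticForm q).comp_curve (isPolyCurve_nexp_line θ.toLinearMap a c)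
  have h1 : ∀ r : K, q (θ (nexp K D (r • w + (1 : K) • e))) =
      q (θ (nexp K D ((0 : K) • w + (1 : K) • e))) := by
    intro r
    have := (hpoly ((1 : K) • e) w).eq_of_forall_ne_zero (fun r => by
      rw [add_comm]
      exact hne r 1 (Or.inr one_ne_zero)) r 0
    rwa [add_comm, add_comm _ ((0 : K) • w)] at this
  have h2 : ∀ r : K, r ≠ 0 → q (θ (nexp K D (0 + r • w))) =
      q (θ (nexp K D ((0 : K) • w + (1 : K) • e))) := by
    intro r hr
    have := (hpoly (r • w) e).eq_of_forall_ne_zero (fun s => hne r s (Or.inl hr)) 0 1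
    rw [zero_smul, add_zero] at this
    rw [zero_add, this, h1]
  have h3 := ((hpoly 0 w).sub (IsPolyFun.const _)).eq_zero_of_forall_ne IsPolyFun.id (r₀ := 1)
    one_ne_zero (fun r hr => sub_eq_zero.mpr (h2 r hr)) 0
  rw [zero_smul, add_zero, sub_eq_zero] at h3
  refine hne 0 1 (Or.inr one_ne_zero) ?_
  rw [zero_smul]
  exact h3.symm.trans ((hq 0 (map_zero ε)).mpr U.zero_mem)

lemma nlog_mem {S : Subalgebra K A} {a : A} (ha : a ∈ S) : nlog K D a ∈ S :=
  sum_mem fun _ _ => S.smul_mem (pow_mem ha _) _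

/-- The exponentials of a vector group span a subalgebra. -/
lemma adjoin_range_nexp [CharZero K] (hD : ∀ a, ε a = 0 → a ^ D = 0)
    {u : (Fin k → K) →ₗ[K] A} (hu : ∀ s, ε (u s) = 0) :
    Subalgebra.toSubmodule (Algebra.adjoin K (Set.range fun s => nexp K D (u s))) =
      Submodule.span K (Set.range fun s => nexp K D (u s)) := by
  let M : Submonoid A :=
    { carrier := Set.range fun s => nexp K D (u s)
      one_mem' := ⟨0, by simp only [map_zero, nexp_zero (K := K) (A := A) (trunc_ne_zero hD)]⟩
      mul_mem' := by
        rintro _ _ ⟨s, rfl⟩ ⟨t, rfl⟩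
        exact ⟨s + t, by simp only [map_add, nexp_add' hD (hu s) (hu t)]⟩ }
  have hM : (M : Set A) = Set.range fun s => nexp K D (u s) := rfl
  rw [Algebra.adjoin_eq_span, ← hM, Submonoid.closure_eq]

/-- The logarithm of `exp (u s)` is a polynomial in `exp (u s) - 1`. -/
lemma mem_adjoin_range_nexp [CharZero K] (hD : ∀ a, ε a = 0 → a ^ D = 0)
    {u : (Fin k → K) →ₗ[K] A} (hu : ∀ s, ε (u s) = 0) (s : Fin k → K) :
    u s ∈ Algebra.adjoin K (Set.range fun s => nexp K D (u s)) := by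
  have h : nexp K D (u s) - 1 ∈ Algebra.adjoin K (Set.range fun s => nexp K D (u s)) :=
    sub_mem (Algebra.subset_adjoin ⟨s, rfl⟩) (one_mem _)
  have h' : ε (nexp K D (u s) - 1) = 0 := by simp [augmentation_nexp hD (hu s)]
  have h1 : nlog K D (nexp K D (u s) - 1) = u s := by
    refine nexp_injective' hD (augmentation_nlog h') (hu s) ?_
    rw [nexp_nlog (hD _ h'), add_sub_cancel]
  exact h1 ▸ nlog_mem h

/-- The orbit of a vector subgroup of the augmentation ideal, within its linear span: an additive
action on a hyperquadric or on the span. -/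
theorem exists_isAdditiveAction_span [IsAlgClosed K] [CharZero K] [FiniteDimensional K V]
    (hD : ∀ a, ε a = 0 → a ^ D = 0) (θ : A ≃ₗ[K] V) {u : (Fin k → K) →ₗ[K] A}
    (hu : ∀ s, ε (u s) = 0) (hinj : Function.Injective u) {A₁ : Subalgebra K A}
    (hA₁ : A₁ = Algebra.adjoin K (Set.range fun s => nexp K D (u s))) {L : Submodule K V}
    (hL : L = (Subalgebra.toSubmodule A₁).map θ.toLinearMap)
    (halt : (∀ w ∈ A₁, ε w = 0 → w ∈ LinearMap.range u) ∨ ∃ q : QuadraticForm K V,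
      (∀ w ∈ A₁, ε w = 0 → (q (θ (nexp K D w)) = 0 ↔ w ∈ LinearMap.range u)) ∧
      ∃ e ∈ A₁, ε e = 0 ∧ e ∉ LinearMap.range u ∧
        ∀ w ∈ A₁, ε w = 0 → ∃ c : K, w - c • e ∈ LinearMap.range u)
    {ι : ℙ K L → ℙ K V} (hι : ι = Projectivization.map L.subtype L.subtype_injective) :
    ∃ ψ : (Fin k → K) → ℙ K L → ℙ K L,
      (∀ s a (ha : θ a ≠ 0) x, ι x = Projectivization.mk K (θ a) ha →
        ∃ h, ι (ψ s x) = Projectivization.mk K (θ (nexp K D (u s) * a)) h) ∧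
      IsAdditiveAction k ψ (ι ⁻¹' closure (expOrbit θ D (LinearMap.range u : Set A)))
        (ι ⁻¹' expOrbit θ D (LinearMap.range u : Set A)) ∧
      ((IsHyperquadric (ι ⁻¹' closure (expOrbit θ D (LinearMap.range u : Set A))) ∧
        IsNondegenerateSubset (ι ⁻¹' closure (expOrbit θ D (LinearMap.range u : Set A)))) ∨
        ι ⁻¹' closure (expOrbit θ D (LinearMap.range u : Set A)) = Set.univ) := by
  have hmem : ∀ s, u s ∈ A₁ := fun s => hA₁ ▸ mem_adjoin_range_nexp hD hu s
  subst hL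
  -- All the data restrict to `A₁`, which `θ` identifies with `L`. The previous results then apply
  -- with `A₁` in place of `A`, the exponentials spanning it by construction.
  let ε₁ : A₁ →ₐ[K] K := ε.comp A₁.val
  let θ₁ : A₁ ≃ₗ[K] (Subalgebra.toSubmodule A₁).map θ.toLinearMap :=
    θ.submoduleMap (Subalgebra.toSubmodule A₁)
  let u₁ : (Fin k → K) →ₗ[K] A₁ := u.codRestrict (Subalgebra.toSubmodule A₁) hmem
  have hD₁ : ∀ a, ε₁ a = 0 → a ^ D = 0 := fun a ha => Subtype.ext (hD a ha)
  have hu₁ : ∀ s, ε₁ (u₁ s) = 0 := hu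
  have hθ₁ : ∀ a : A₁, (θ₁ a : V) = θ a := fun a => rfl
  have hnexp : ∀ a : A₁, ((nexp K D a : A₁) : A) = nexp K D (a : A) := fun a =>
    map_sum A₁.val _ _
  have hrange : ∀ a : A₁, a ∈ LinearMap.range u₁ ↔ (a : A) ∈ LinearMap.range u := fun a =>
    ⟨fun ⟨s, hs⟩ => ⟨s, congrArg Subtype.val hs⟩, fun ⟨s, hs⟩ => ⟨s, Subtype.ext hs⟩⟩
  obtain ⟨ψ, hψ⟩ := exists_isExpAction hD₁ θ₁ hu₁
  have hspan : ∀ f : Module.Dual K ((Subalgebra.toSubmodule A₁).map θ.toLinearMap),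
      (∀ s, f (θ₁ (nexp K D (u₁ s))) = 0) → f = 0 := by
    intro f hf
    refine LinearMap.ext fun v => ?_
    obtain ⟨⟨a, ha⟩, rfl⟩ := θ₁.surjective v
    have ha' : a ∈ Submodule.span K (Set.range fun s => nexp K D (u s)) := by
      rw [← adjoin_range_nexp hD hu, ← hA₁]
      exact ha
    have hle : Submodule.span K (Set.range fun s => nexp K D (u s)) ≤ Subalgebra.toSubmodule A₁ := by
      rw [← adjoin_range_nexp hD hu, ← hA₁]
    have key : ∀ b (hb : b ∈ Submodule.span K (Set.range fun s => nexp K D (u s))),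
        f (θ₁ ⟨b, hle hb⟩) = 0 := by
      intro b hb
      induction hb using Submodule.span_induction with
      | mem x hx =>
        obtain ⟨s, rfl⟩ := hx
        rw [← hf s]
        exact congrArg _ (congrArg _ (Subtype.ext (hnexp (u₁ s)).symm))
      | zero => exact (congrArg f (map_zero θ₁)).trans (map_zero f)
      | add x y hx hy h h' =>
        have := congrArg₂ (· + ·) h h'
        simp only [← map_add, add_zero] at this
        exact this
      | smul c x hx h =>
        have := congrArg (c • ·) h
        simp only [← map_smul, smul_zero] at this
        exact this
    exact key a ha'
  have horbit : ι ⁻¹' expOrbit θ D (LinearMap.range u : Set A) =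
      expOrbit θ₁ D (LinearMap.range u₁ : Set A₁) := by
    ext x
    obtain ⟨a, ha, rfl⟩ := exists_eq_mk θ₁ x
    have ha' : θ a ≠ 0 := fun h => ha (Subtype.ext h)
    have h1 : ι (Projectivization.mk K (θ₁ a) ha) = Projectivization.mk K (θ a) ha' := by
      rw [hι, Projectivization.map_mk]
      rfl
    have hdlog : ((dlog ε₁ D a : A₁) : A) = dlog ε D a := map_sum A₁.val _ _
    rw [Set.mem_preimage, h1, mk_mem_expOrbit hD, mk_mem_expOrbit hD₁, SetLike.mem_coe,
      SetLike.mem_coe, hrange, hdlog]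
    · rfl
    · rintro _ ⟨s, rfl⟩
      exact hu₁ s
    · rintro _ ⟨s, rfl⟩
      exact hu s
  have hclosure : ι ⁻¹' closure (expOrbit θ D (LinearMap.range u : Set A)) =
      closure (expOrbit θ₁ D (LinearMap.range u₁ : Set A₁)) := by
    have hind : Topology.IsInducing ι := hι ▸ isInducing_map _ _
    rw [hind.closure_eq_preimage_closure_image, ← horbit, Set.image_preimage_eq_of_subset]
    rintro _ ⟨_, ⟨s, rfl⟩, h, rfl⟩
    have h' : θ₁ (nexp K D (u₁ s)) ≠ 0 := map_nexp_ne_zero hD₁ θ₁ (hu₁ s)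
    refine ⟨Projectivization.mk K _ h', ?_⟩
    rw [hι, Projectivization.map_mk]
    congr 1
    exact congrArg θ (hnexp (u₁ s))
  rw [horbit, hclosure]
  refine ⟨ψ, fun s a ha x hx => ?_, hψ.isAdditiveAction_of_quadric hD₁ hu₁ ?_ hspan ?_⟩
  · obtain ⟨b, hb, rfl⟩ := exists_eq_mk θ₁ x
    obtain ⟨h, h'⟩ := hψ s b hb
    rw [h']
    rw [hι, Projectivization.map_mk, Projectivization.mk_eq_mk_iff'] at hx
    obtain ⟨c, hc⟩ := hx
    have hc' : c • a = b := θ.injective ((map_smul θ c a).trans hc)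
    have hne : θ (nexp K D (u s) * a) ≠ 0 := by
      intro h0
      have h1 := (map_eq_zero_iff θ θ.injective).mp h0
      rw [(isUnit_nexp hD (hu s)).mul_right_eq_zero] at h1
      simp [h1] at ha
    refine ⟨hne, ?_⟩
    rw [hι, Projectivization.map_mk, Projectivization.mk_eq_mk_iff']
    refine ⟨c, ?_⟩
    rw [← map_smul, ← mul_smul_comm, hc']
    exact congrArg θ (congrArg (· * (b : A)) (hnexp (u₁ s)).symm)
  · exact fun s t h => hinj (congrArg Subtype.val h)
  · rcases halt with h | ⟨q, hq, e, heA, he, heU, hc⟩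
    · exact Or.inl fun w hw => (hrange w).mpr (h w w.2 hw)
    · refine Or.inr ⟨q.comp (Submodule.subtype _), fun w hw => ?_, ⟨e, heA⟩, he,
        fun h => heU ((hrange _).mp h), fun w hw => ?_⟩
      · rw [hrange, ← hq w w.2 hw, ← hnexp]
        rfl
      · obtain ⟨c, hc⟩ := hc w w.2 hw
        exact ⟨c, (hrange _).mpr hc⟩

end Core

/-! ### From additive actions to local algebras, and the locus `K(X)` -/

section Main

variable {K : Type*} [Field K] {V : Type u} [AddCommGroup V] [Module K V] {n : ℕ}
  {φ : (Fin n → K) → ℙ K V → ℙ K V} {X O KX : Set (ℙ K V)}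

lemma subsingleton_projectivization [FiniteDimensional K V] (h : Module.finrank K V ≤ 1) :
    Subsingleton (ℙ K V) := by
  obtain ⟨v, hv⟩ := finrank_le_one_iff.mp h
  refine ⟨fun x y => ?_⟩
  obtain ⟨a, ha⟩ := hv x.rep
  obtain ⟨b, hb⟩ := hv y.rep
  have hb0 : b ≠ 0 := by
    rintro rfl
    exact y.rep_nonzero (by rw [← hb, zero_smul])
  rw [← x.mk_rep, ← y.mk_rep, Projectivization.mk_eq_mk_iff']
  exact ⟨a * b⁻¹, by rw [← hb, smul_smul, inv_mul_cancel_right₀ hb0, ha]⟩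

lemma IsAdditiveAction.orbit_subset (hφ : IsAdditiveAction n φ X O) : O ⊆ X := by
  obtain ⟨x, hx, rfl⟩ := hφ.isOrbit
  rintro _ ⟨t, rfl⟩
  exact hφ.invariant t x hx

/-- A nonempty open subset of an irreducible space is dense. -/
lemma IsAdditiveAction.closure_orbit (hφ : IsAdditiveAction n φ X O) : closure O = X := by
  refine Set.Subset.antisymm (closure_minimal hφ.orbit_subset hφ.isClosed) ?_
  have : IrreducibleSpace X := Subtype.irreducibleSpace hφ.isIrreducible
  obtain ⟨x, hx, hO⟩ := hφ.isOrbit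
  have hxO : x ∈ O := by
    rw [hO]
    exact ⟨0, hφ.zero_act x⟩
  have hd := hφ.isOpen.dense ⟨⟨x, hx⟩, hxO⟩
  refine (Subtype.dense_iff.mp hd).trans (closure_mono ?_)
  rintro _ ⟨y, hy, rfl⟩
  exact hy

lemma IsAdditiveAction.orbit_eq_range (hφ : IsAdditiveAction n φ X O) {x₀ : ℙ K V} (hx₀ : x₀ ∈ O) :
    O = Set.range fun t => φ t x₀ := by
  obtain ⟨x, -, hO⟩ := hφ.isOrbit
  rw [hO] at hx₀
  obtain ⟨s, rfl⟩ := hx₀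
  rw [hO]
  ext y
  constructor
  · rintro ⟨t, rfl⟩
    exact ⟨t - s, by simp only [← hφ.add_act, sub_add_cancel]⟩
  · rintro ⟨t, rfl⟩
    exact ⟨t + s, hφ.add_act t s x⟩

/-- An additive action on a subvariety that spans the projective space is the exponential action of
a vector group in a local algebra. -/
theorem IsAdditiveAction.exists_isExpAction [IsAlgClosed K] [CharZero K] [FiniteDimensional K V]
    (hφ : IsAdditiveAction n φ X O) (hV : 1 < Module.finrank K V)
    (hspan : ∀ f : Module.Dual K V, (∀ x ∈ X, f x.rep = 0) → f = 0) {x₀ : ℙ K V} (hx₀ : x₀ ∈ O) :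
    ∃ (A : Type u) (_ : CommRing A) (_ : Algebra K A) (ε : A →ₐ[K] K) (D : ℕ)
      (θ : A ≃ₗ[K] V) (u : (Fin n → K) →ₗ[K] A),
      (∀ a, ε a = 0 → a ^ D = 0) ∧ (∀ t, ε (u t) = 0) ∧ Function.Injective u ∧
      IsExpAction θ D u φ ∧ θ 1 = x₀.rep ∧ O = expOrbit θ D (LinearMap.range u : Set A) := by
  obtain ⟨N, hN, hNc, hφN⟩ := exists_nilpotent_family hφ.isMorphism hφ.zero_act hφ.add_act hV
  have hNpow : ∀ t, N t ^ Module.finrank K V = 0 := fun t =>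
    Module.End.pow_finrank_eq_zero_of_isNilpotent (hN t)
  obtain ⟨A, _, _, ε, θ, u, hD, hu, hθ, hact⟩ := exists_local_algebra N hN hNc x₀.rep_nonzero (by
    -- The orbit is dense in `X` and `X` spans, so no hyperplane contains the orbit of `x₀`.
    intro f hf
    refine hspan f fun x hx => ?_
    rw [← hφ.closure_orbit] at hx
    refine mem_closure_iff_homFun.mp hx 1 f (IsHomFun.dual f) fun y hy => ?_
    rw [hφ.orbit_eq_range hx₀] at hy
    obtain ⟨t, rfl⟩ := hy
    obtain ⟨h, h'⟩ := hφN t _ (hNpow t) x₀.rep x₀.rep_nonzero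
    rw [x₀.mk_rep] at h'
    simp only [h']
    rw [(IsHomFun.dual f).mk_rep_eq_zero]
    exact hf t)
  have hexp : IsExpAction θ (Module.finrank K V) u φ := by
    intro t a ha
    rw [hact]
    exact hφN t _ (hNpow t) _ ha
  have hφ0 : ∀ t, ∃ h, φ t x₀ = Projectivization.mk K (θ (nexp K (Module.finrank K V) (u t))) h := by
    intro t
    have := hexp t 1 (by rw [hθ]; exact x₀.rep_nonzero)
    simpa only [mul_one, hθ, x₀.mk_rep] using this
  refine ⟨A, inferInstance, inferInstance, ε, _, θ, u, hD, hu, ?_, hexp, hθ, ?_⟩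
  · rw [injective_iff_map_eq_zero]
    intro t ht
    refine hφ.effective t fun x => ?_
    obtain ⟨a, ha, rfl⟩ := exists_eq_mk θ x
    obtain ⟨h, h'⟩ := hexp t a ha
    rw [h']
    simp only [ht, nexp_zero (K := K) (A := A) (trunc_ne_zero hD), one_mul]
  · rw [hφ.orbit_eq_range hx₀]
    ext x
    constructor
    · rintro ⟨t, rfl⟩
      obtain ⟨h, h'⟩ := hφ0 t
      exact ⟨u t, ⟨t, rfl⟩, h, h'⟩
    · rintro ⟨_, ⟨t, rfl⟩, h, rfl⟩
      obtain ⟨h, h'⟩ := hφ0 t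
      exact ⟨t, h'⟩

lemma IsKLocus.subset (h : IsKLocus X O KX) : KX ⊆ X := by
  rcases h with ⟨q, -, rfl, rfl⟩ | ⟨rfl, rfl⟩
  · exact fun x hx => hx.1
  · exact Set.subset_univ _

lemma IsKLocus.eq_zero_of_forall [IsAlgClosed K] [CharZero K] (h : IsKLocus X O KX)
    (f : Module.Dual K V) (hf : ∀ x ∈ X, f x.rep = 0) : f = 0 := by
  by_contra hne
  rcases h with ⟨q, hq, rfl, -⟩ | ⟨rfl, -⟩
  · obtain ⟨v, hv, hfv⟩ := exists_mem_quadric_ne hq hne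
    have hv0 : v ≠ 0 := by
      rintro rfl
      simp at hfv
    exact hfv (((IsHomFun.dual f).mk_rep_eq_zero hv0).mp (hf _ ((mem_quadric_mk q hv0).mpr hv)))
  · refine hne (LinearMap.ext fun v => ?_)
    by_cases hv0 : v = 0
    · simp [hv0]
    · exact ((IsHomFun.dual f).mk_rep_eq_zero hv0).mp (hf _ (Set.mem_univ _))

section Model

variable {A : Type*} [CommRing A] [Algebra K A] {ε : A →ₐ[K] K} {D : ℕ} {k : ℕ}

lemma mk_nexp_mem_closure_iff [CharZero K] [FiniteDimensional K V]
    (hD : ∀ a, ε a = 0 → a ^ D = 0) (θ : A ≃ₗ[K] V)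
    {W : Submodule K A} (hW : ∀ w ∈ W, ε w = 0) {w : A} (hw : ε w = 0)
    (h : θ (nexp K D w) ≠ 0) :
    Projectivization.mk K (θ (nexp K D w)) h ∈ closure (expOrbit θ D (W : Set A)) ↔ w ∈ W := by
  constructor
  · intro hx
    have h1 : Projectivization.mk K (θ (nexp K D w)) h ∈ {x : ℙ K V | ε (θ.symm x.rep) ≠ 0} := by
      rw [Set.mem_ofPred_eq, augmentation_rep_ne_zero, augmentation_nexp hD hw]
      exact one_ne_zero
    have h2 := closure_expOrbit_inter hD θ hW ▸ Set.mem_inter hx h1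
    have h3 := ((mk_mem_expOrbit hD hW h).mp h2).2
    have h4 := dlog_smul_nexp hD (one_ne_zero (α := K)) hw
    rw [one_smul] at h4
    rwa [h4] at h3
  · exact fun hx => subset_closure ⟨w, hx, h, rfl⟩

/-- The locus `K(X)` is a linear subspace, and the open orbit is given by a linear subspace of the
augmentation ideal that is either everything or is cut out by a quadratic form. -/
lemma IsKLocus.exists_submodule [CharZero K] [FiniteDimensional K V]
    (hD : ∀ a, ε a = 0 → a ^ D = 0) (θ : A ≃ₗ[K] V)
    {W : Submodule K A} (hW : ∀ w ∈ W, ε w = 0)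
    (h : IsKLocus (closure (expOrbit θ D (W : Set A))) (expOrbit θ D (W : Set A)) KX) :
    ∃ J : Submodule K A, (∀ a (ha : θ a ≠ 0), Projectivization.mk K (θ a) ha ∈ KX ↔ a ∈ J) ∧
      ((∀ w, ε w = 0 → w ∈ W) ∨
        ∃ q : QuadraticForm K V, ∀ w, ε w = 0 → (q (θ (nexp K D w)) = 0 ↔ w ∈ W)) := by
  rcases h with ⟨q, hq, hX, rfl⟩ | ⟨hX, rfl⟩
  -- The singular locus is the radical of the polar form; its vectors lie on the quadric
  -- automatically, since `polar v v = 2 q v`.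
  · refine ⟨(LinearMap.ker q.polarBilin).comap θ.toLinearMap, fun a ha => ?_, Or.inr ⟨q, ?_⟩⟩
    · obtain ⟨c, hc⟩ := Projectivization.exists_smul_eq_mk_rep K (θ a) ha
      have hpol : (∀ w, QuadraticMap.polar q (Projectivization.mk K (θ a) ha).rep w = 0) ↔
          ∀ w, QuadraticMap.polar q (θ a) w = 0 := by
        refine forall_congr' fun w => ?_
        rw [← hc, Units.smul_def, QuadraticMap.polar_smul_left]
        simp
      rw [singularLocus, Set.mem_ofPred_eq, hpol, mem_quadric_mk, Submodule.mem_comap,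
        LinearMap.mem_ker]
      constructor
      · exact fun h => LinearMap.ext h.2
      · intro h
        have hp : ∀ w, QuadraticMap.polar q (θ a) w = 0 := fun w => LinearMap.congr_fun h w
        refine ⟨?_, hp⟩
        have := hp (θ a)
        rw [QuadraticMap.polar_self] at this
        simpa using this
    · intro w hw
      have hne := map_nexp_ne_zero hD θ hw
      rw [← mem_quadric_mk q hne, ← hX, mk_nexp_mem_closure_iff hD θ hW hw]
  · have hall : ∀ w, ε w = 0 → w ∈ W := fun w hw => by
      rw [← mk_nexp_mem_closure_iff hD θ hW hw (map_nexp_ne_zero hD θ hw), hX]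
      exact Set.mem_univ _
    -- The orbit is the whole chart `ε ≠ 0`, so the boundary is the hyperplane `ε = 0`.
    refine ⟨LinearMap.ker ε.toLinearMap, fun a ha => ?_, Or.inl hall⟩
    rw [hX, Set.mem_sdiff, mk_mem_expOrbit hD hW, LinearMap.mem_ker]
    constructor
    · rintro ⟨-, h⟩
      by_contra h0
      exact h ⟨h0, hall _ (augmentation_dlog h0)⟩
    · exact fun h0 => ⟨Set.mem_univ _, fun h => h.1 h0⟩

/-- An element of the group fixes `[θ a]` if and only if its logarithm annihilates `a`. -/
lemma IsExpAction.apply_eq_self_iff [CharZero K] (hD : ∀ a, ε a = 0 → a ^ D = 0) {θ : A ≃ₗ[K] V}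
    {u : (Fin n → K) →ₗ[K] A} (hu : ∀ t, ε (u t) = 0) (hψ : IsExpAction θ D u φ) (t : Fin n → K)
    {a : A} (ha : θ a ≠ 0) :
    φ t (Projectivization.mk K (θ a) ha) = Projectivization.mk K (θ a) ha ↔ u t * a = 0 := by
  obtain ⟨h, h'⟩ := hψ t a ha
  obtain ⟨s, hs, hs'⟩ := nexp_sub_one (K := K) (hD _ (hu t))
  rw [h', Projectivization.mk_eq_mk_iff']
  constructor
  · rintro ⟨c, hc⟩
    rw [← map_smul] at hc
    have hc := θ.injective hc
    -- A unipotent element has no eigenvalue but one: for `c ≠ 1` the difference `c - exp (u t)` is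
    -- a nonzero scalar minus a nilpotent, hence a unit.
    have hc1 : c = 1 := by
      by_contra hne
      have hunit : IsUnit (algebraMap K A (c - 1) - u t * s) := by
        have hnil : IsNilpotent (u t * s) := ⟨D, by rw [mul_pow, hD _ (hu t), zero_mul]⟩
        rw [sub_eq_add_neg]
        exact hnil.neg.isUnit_add_left_of_commute
          ((IsUnit.mk0 _ (sub_ne_zero.mpr hne)).map (algebraMap K A)) (Commute.all _ _)
      have h0 : (algebraMap K A (c - 1) - u t * s) * a = 0 := by
        rw [← hs', map_sub, map_one, sub_sub_sub_cancel_right, sub_mul, ← hc, Algebra.smul_def,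
          sub_self]
      rw [hunit.mul_right_eq_zero] at h0
      simp [h0] at ha
    rw [hc1, one_smul] at hc
    have h0 : s * (u t * a) = 0 := by
      rw [← mul_assoc, mul_comm s, ← hs', sub_mul, one_mul, ← hc, sub_self]
    exact hs.mul_right_eq_zero.mp h0
  · intro h0
    refine ⟨1, ?_⟩
    have : nexp K D (u t) * a = a := by
      rw [← sub_eq_zero, ← sub_one_mul, hs', mul_right_comm, h0, zero_mul]
    rw [one_smul, this]

lemma closure_subset_subspace {L : Projectivization.Subspace K V} {S : Set (ℙ K V)}
    (hS : S ⊆ (L : Set (ℙ K V))) : closure S ⊆ (L : Set (ℙ K V)) := by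
  intro x hx
  have hmem : ∀ y : ℙ K V, y ∈ L ↔ y.rep ∈ Projectivization.Subspace.submodule L := fun y => by
    rw [Projectivization.Subspace.mem_submodule_iff _ y.rep_nonzero, y.mk_rep]
  rw [SetLike.mem_coe, hmem]
  by_contra hcon
  obtain ⟨f, hf, hfL⟩ := Submodule.exists_le_ker_of_notMem hcon
  exact hf (mem_closure_iff_homFun.mp hx 1 f (IsHomFun.dual f) fun y hy =>
    hfL ((hmem y).mp (hS hy)))

end Model

end Main

end AddAct

/-! ### The common stabilizer and its orbit -/

theorem theorem1p6 {K : Type*} [Field K] [IsAlgClosed K] [CharZero K]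
    {V : Type*} [AddCommGroup V] [Module K V] [FiniteDimensional K V]
    (n : ℕ) (φ : (Fin n → K) → ℙ K V → ℙ K V) (X O KX : Set (ℙ K V))
    (hφ : AddAct.IsAdditiveAction n φ X O)
    (hKX : AddAct.IsKLocus X O KX)
    (hfix : ¬ KX ⊆ AddAct.fixedPoints φ X)
    (x₀ : ℙ K V) (hx₀ : x₀ ∈ O)
    (G₁ : Set (Fin n → K)) (hG₁ : G₁ = AddAct.commonStabilizer φ KX)
    (O₁ : Set (ℙ K V)) (hO₁ : O₁ = (fun g => φ g x₀) '' G₁)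
    (L₁ : Projectivization.Subspace K V) (hL₁ : L₁ = Projectivization.Subspace.span O₁)
    (Q₁ : Set (ℙ K V)) (hQ₁ : Q₁ = closure O₁) :
    -- the linear span is a proper subspace
    L₁ < ⊤ ∧
    -- it is invariant, and contains the closure of the orbit
    (∀ g ∈ G₁, ∀ x ∈ L₁, φ g x ∈ L₁) ∧
    Q₁ ⊆ (L₁ : Set (ℙ K V)) ∧
    -- `G₁` is (through `e`) a vector group of some dimension `k`, and its action `ψ` on `L₁`, the
    -- restriction of `φ`, is an additive action on `Q₁` with open orbit `O₁`
    (∃ (k : ℕ) (e : (Fin k → K) →ₗ[K] (Fin n → K))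
        (ψ : (Fin k → K) → ℙ K (Projectivization.Subspace.submodule L₁) →
          ℙ K (Projectivization.Subspace.submodule L₁)),
      Function.Injective e ∧ Set.range e = G₁ ∧
      (∀ s y, AddAct.incl L₁ (ψ s y) = φ (e s) (AddAct.incl L₁ y)) ∧
      AddAct.IsAdditiveAction k ψ (AddAct.incl L₁ ⁻¹' Q₁) (AddAct.incl L₁ ⁻¹' O₁)) ∧
    -- `Q₁` is a non-degenerate hyperquadric in `L₁` or all of `L₁`
    ((AddAct.IsHyperquadric (AddAct.incl L₁ ⁻¹' Q₁) ∧
        AddAct.IsNondegenerateSubset (AddAct.incl L₁ ⁻¹' Q₁)) ∨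
      Q₁ = (L₁ : Set (ℙ K V))) := by
  have hKXX := hKX.subset
  have hV : 1 < Module.finrank K V := by
    by_contra hcon
    have := AddAct.subsingleton_projectivization (not_lt.mp hcon)
    exact hfix fun x hx => ⟨hKXX hx, fun t => Subsingleton.elim _ _⟩
  obtain ⟨A, _, _, ε, D, θ, u, hD, hu, hinj, hexp, hθ, hO⟩ :=
    hφ.exists_isExpAction hV hKX.eq_zero_of_forall hx₀
  have hX := hφ.closure_orbit
  have hU : ∀ w ∈ LinearMap.range u, ε w = 0 := by
    rintro _ ⟨t, rfl⟩
    exact hu t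
  rw [hO] at hX
  obtain ⟨J, hJ, halt⟩ : ∃ J : Submodule K A,
      (∀ a (ha : θ a ≠ 0), Projectivization.mk K (θ a) ha ∈ KX ↔ a ∈ J) ∧
      ((∀ w, ε w = 0 → w ∈ LinearMap.range u) ∨ ∃ q : QuadraticForm K V,
        ∀ w, ε w = 0 → (q (θ (AddAct.nexp K D w)) = 0 ↔ w ∈ LinearMap.range u)) := by
    rw [hO, ← hX] at hKX
    exact hKX.exists_submodule hD θ hU
  have hne : ∀ {a : A}, a ≠ 0 → θ a ≠ 0 := fun h => (map_ne_zero_iff θ θ.injective).mpr h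
  -- In terms of logarithms the common stabilizer is an annihilator, hence a linear subspace.
  have hG : ∀ t, t ∈ G₁ ↔ ∀ j ∈ J, u t * j = 0 := by
    intro t
    rw [hG₁]
    constructor
    · intro ht j hj
      by_cases hj0 : j = 0
      · rw [hj0, mul_zero]
      · exact (hexp.apply_eq_self_iff hD hu t (hne hj0)).mp (ht _ ((hJ j (hne hj0)).mpr hj))
    · intro ht x hx
      obtain ⟨a, ha, rfl⟩ := AddAct.exists_eq_mk θ x
      exact (hexp.apply_eq_self_iff hD hu t ha).mpr (ht a ((hJ a ha).mp hx))
  let G : Submodule K (Fin n → K) :=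
    { carrier := G₁
      zero_mem' := (hG 0).mpr fun j _ => by rw [map_zero, zero_mul]
      add_mem' := fun {s t} hs ht => (hG _).mpr fun j hj => by
        rw [map_add, add_mul, (hG s).mp hs j hj, (hG t).mp ht j hj, add_zero]
      smul_mem' := fun c t ht => (hG _).mpr fun j hj => by
        rw [map_smul, smul_mul_assoc, (hG t).mp ht j hj, smul_zero] }
  let e : (Fin (Module.finrank K G) → K) →ₗ[K] (Fin n → K) :=
    G.subtype ∘ₗ (Module.finBasis K G).equivFun.symm.toLinearMap
  have he : Function.Injective e :=
    G.subtype_injective.comp (Module.finBasis K G).equivFun.symm.injective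
  have heG : Set.range e = G₁ := by
    ext t
    constructor
    · rintro ⟨s, rfl⟩
      exact ((Module.finBasis K G).equivFun.symm s).2
    · intro ht
      exact ⟨(Module.finBasis K G).equivFun ⟨t, ht⟩, by simp [e]⟩
  have heG' : ∀ s, e s ∈ G₁ := fun s => heG ▸ ⟨s, rfl⟩
  let u₁ := u ∘ₗ e
  have hu₁ : ∀ s, ε (u₁ s) = 0 := fun s => hu (e s)
  let A₁ : Subalgebra K A := Algebra.adjoin K (Set.range fun s => AddAct.nexp K D (u₁ s))
  -- The generators of `A₁` are exponentials fixing `J` pointwise, so `A₁` acts on `J` by scalars.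
  -- Everything specific to `G₁` comes from this.
  have hann : ∀ a ∈ A₁, ∀ j ∈ J, a * j = ε a • j := by
    intro a ha j hj
    induction ha using Algebra.adjoin_induction with
    | mem x hx =>
      obtain ⟨s, rfl⟩ := hx
      obtain ⟨r, -, hr⟩ := AddAct.nexp_sub_one (K := K) (hD _ (hu₁ s))
      have h0 : u₁ s * j = 0 := (hG _).mp (heG' s) j hj
      simp only [AddAct.augmentation_nexp hD (hu₁ s), one_smul]
      rw [← sub_eq_zero, ← sub_one_mul, hr, mul_right_comm, h0, zero_mul]
    | algebraMap c => simp [Algebra.smul_def]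
    | add x y _ _ hx hy => rw [add_mul, hx, hy, map_add, add_smul]
    | mul x y _ _ hx hy => rw [mul_assoc, hy, mul_smul_comm, hx, map_mul, smul_smul, mul_comm]
  -- A logarithm lying in `A₁` has augmentation zero, so it kills `J` and belongs to `G₁`.
  have hback : ∀ w ∈ A₁, w ∈ LinearMap.range u → w ∈ LinearMap.range u₁ := by
    rintro _ hw ⟨t, rfl⟩
    have ht : t ∈ G₁ := (hG t).mpr fun j hj => by rw [hann _ hw j hj, hu, zero_smul]
    rw [← heG] at ht
    obtain ⟨s, rfl⟩ := ht
    exact ⟨s, rfl⟩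
  have hforth : ∀ w ∈ LinearMap.range u₁, w ∈ LinearMap.range u := by
    rintro _ ⟨s, rfl⟩
    exact ⟨e s, rfl⟩
  have hact : ∀ t, ∃ h, φ t x₀ = Projectivization.mk K (θ (AddAct.nexp K D (u t))) h := by
    intro t
    have := hexp t 1 (by rw [hθ]; exact x₀.rep_nonzero)
    simpa only [mul_one, hθ, x₀.mk_rep] using this
  have hO₁' : O₁ = AddAct.expOrbit θ D (LinearMap.range u₁ : Set A) := by
    rw [hO₁, ← heG, ← Set.range_comp]
    ext x
    constructor
    · rintro ⟨s, rfl⟩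
      obtain ⟨h, h'⟩ := hact (e s)
      exact ⟨u₁ s, ⟨s, rfl⟩, h, h'⟩
    · rintro ⟨_, ⟨s, rfl⟩, h, rfl⟩
      obtain ⟨h, h'⟩ := hact (e s)
      exact ⟨s, h'⟩
  have hL : Projectivization.Subspace.submodule L₁ =
      (Subalgebra.toSubmodule A₁).map θ.toLinearMap := by
    refine le_antisymm ?_ ?_
    · rw [← OrderIso.le_symm_apply, hL₁, Projectivization.Subspace.span_le_subspace_iff, hO₁']
      rintro _ ⟨_, ⟨s, rfl⟩, h, rfl⟩
      rw [SetLike.mem_coe, Submodule.mk_mem_projectivization_iff]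
      exact ⟨_, Algebra.subset_adjoin ⟨s, rfl⟩, rfl⟩
    · rw [AddAct.adjoin_range_nexp hD hu₁, Submodule.map_span_le]
      rintro _ ⟨s, rfl⟩
      have h := AddAct.map_nexp_ne_zero hD θ (hu₁ s)
      refine (Projectivization.Subspace.mem_submodule_iff _ h).mpr ?_
      rw [hL₁]
      exact Projectivization.Subspace.subset_span _ (hO₁' ▸ ⟨_, ⟨s, rfl⟩, h, rfl⟩)
  have hmemL : ∀ a (ha : θ a ≠ 0), Projectivization.mk K (θ a) ha ∈ L₁ ↔ a ∈ A₁ := by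
    intro a ha
    rw [← Projectivization.Subspace.mem_submodule_iff, hL]
    exact θ.injective.mem_set_image (s := (A₁ : Set A))
  have hincl : ∀ x ∈ L₁, ∃ y, AddAct.incl L₁ y = x := by
    intro x hx
    rw [← x.mk_rep, ← Projectivization.Subspace.mem_submodule_iff] at hx
    refine ⟨Projectivization.mk K ⟨x.rep, hx⟩ fun h => x.rep_nonzero (congrArg Subtype.val h), ?_⟩
    rw [AddAct.incl, Projectivization.map_mk]
    exact x.mk_rep
  obtain ⟨ψ, hψ, hψ', hcases⟩ := AddAct.exists_isAdditiveAction_span hD θ hu₁ (hinj.comp he) rfl hL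
    (by
      by_cases hall : ∀ w ∈ A₁, ε w = 0 → w ∈ LinearMap.range u₁
      · exact Or.inl hall
      · push Not at hall
        obtain ⟨w, hw, hεw, hwU⟩ := hall
        have hwU' : w ∉ LinearMap.range u := fun h => hwU (hback w hw h)
        -- An element of the augmentation ideal outside `range u` excludes `X = ℙ(V)`. So `X` is a
        -- quadric, and the restriction of its form cuts out the logarithms of `G₁` in `A₁`.
        obtain ⟨q, hq⟩ := halt.resolve_left fun h => hwU' (h w hεw)
        refine Or.inr ⟨q, fun v hv hεv => ?_, w, hw, hεw, hwU, fun v hv hεv => ?_⟩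
        · exact (hq v hεv).trans ⟨hback v hv, hforth v⟩
        · obtain ⟨c, hc⟩ := AddAct.exists_sub_smul_mem θ hq hεw hwU' hεv
          exact ⟨c, hback _ (sub_mem hv (A₁.smul_mem hw c)) hc⟩)
    (ι := AddAct.incl L₁) rfl
  rw [← hO₁', ← hQ₁] at hψ' hcases
  have hQL : Q₁ ⊆ (L₁ : Set (ℙ K V)) := by
    rw [hQ₁, hL₁]
    exact AddAct.closure_subset_subspace (Projectivization.Subspace.subset_span _)
  refine ⟨lt_top_iff_ne_top.mpr fun htop => hfix ?_, ?_, hQL,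
    ⟨_, e, ψ, he, heG, fun s y => ?_, hψ'⟩, ?_⟩
  -- If `L₁` were everything, each `u t` would lie in `A₁` with augmentation zero and kill `J`, so
  -- all points of `K(X)` would be fixed.
  · intro x hx
    refine ⟨hKXX hx, fun t => ?_⟩
    obtain ⟨a, ha, rfl⟩ := AddAct.exists_eq_mk θ x
    rw [hexp.apply_eq_self_iff hD hu t ha]
    by_cases ht : u t = 0
    · rw [ht, zero_mul]
    · have : u t ∈ A₁ := (hmemL _ (hne ht)).mp (by
        rw [htop, ← Projectivization.Subspace.span_univ]
        exact Projectivization.Subspace.subset_span _ (Set.mem_univ _))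
      rw [hann _ this a ((hJ a ha).mp hx), hu, zero_smul]
  · intro g hg x hx
    obtain ⟨a, ha, rfl⟩ := AddAct.exists_eq_mk θ x
    obtain ⟨h, h'⟩ := hexp g a ha
    rw [← heG] at hg
    obtain ⟨s, rfl⟩ := hg
    rw [h', hmemL]
    exact mul_mem (Algebra.subset_adjoin ⟨s, rfl⟩) ((hmemL a ha).mp hx)
  · obtain ⟨a, ha, hy⟩ := AddAct.exists_eq_mk θ (AddAct.incl L₁ y)
    obtain ⟨h₁, h₁'⟩ := hψ s a ha y hy
    obtain ⟨h₂, h₂'⟩ := hexp (e s) a ha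
    rw [h₁', hy, h₂']
    rfl
  · refine hcases.imp_right fun huniv => Set.Subset.antisymm hQL fun x hx => ?_
    obtain ⟨y, rfl⟩ := hincl x hx
    exact Set.eq_univ_iff_forall.mp huniv y
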